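/- All points lie in the plane, graphs are drawn with straight segments, and a graph is \emph{non-crossing} if no two of its edges cross. A \emph{non-crossing path partition} (ncp partition) of a finite point set $S$ is a non-crossing graph with vertex set $S$ each of whose components is a path; isolated vertices (paths of length $0$) are allowed, and such a vertex is both endpoints of its path. If the points of $S$ are numbered from $1$ to $n$, an ncp partition is \emph{ordered} if, whenever $i<j$ are the endpoints of one of its paths, no endpoint of a path is a point $m$ with $i<m<j$. A \emph{polygonization} is a non-crossing Hamiltonian cycle. A \emph{double chain} of $N=2n$ points, $n\ge 2$, consists of a chain $U$ of $n$ points that lie, from left to right, on the graph of a strictly convex function, and a chain $L$ of $n$ points that lie, from left to right, on the graph of a strictly concave function, such that each line through two points of $U$ leaves all points of $L$ strictly below and each line through two points of $L$ leaves all points of $U$ strictly above. The points of $U$ and of $L$ are numbered from left to right. Let $\rho=4.6421263038\ldots$ be the real root of $4x^5-36x^4+112x^3-168x^2+117x-32$ with $|\rho-4.6421263038|<10^{-10}$. Then: 1. There are integers $1\le k(n)\le n$ and constants $c,C>0$, $d\ge 0$ such that for every $n\ge1$ and every set of $n$ points in convex position, numbered clockwise, the number of ordered ncp partitions consisting of exactly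 $k(n)$ paths is at least $c\,n^{-d}\rho^n$ and at most $C\,n^{d}\rho^n$. 2. Let $(U,L)$ be a double chain of $2n$ points, $n\ge 2$. Take an ordered ncp partition of $U$ and one of $L$ with the same number $k$ of paths, and list the $2k$ endpoints on each chain from left to right (a singleton twice). Skip the first endpoint on $U$ and the last endpoint on $L$, and join the remaining $2k-1$ endpoints on $U$ to those on $L$ in order, from left to right. The result is a non-crossing Hamiltonian path on $U\cup L$. 3. For every double chain $(U,L)$ of $2n$ points, $n\ge2$, one can add two points to each chain so as to obtain a double chain of $2n+4$ points such that every Hamiltonian path obtained as in 2 is contained in a polygonization of the larger double chain. 4. There are constants $c>0$, $d\ge 0$ such that for every $n\ge 2$ every double chain of $N=2n$ points admits at least $c\,N^{-d}\rho^{N}$ polygonizations. -/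

import Mathlib

namespace NCPath

/-- Twice the signed area of the triangle `p q r`. It is positive iff `r` lies to the left of the
line directed from `p` to `q`; if `p.1 < q.1`, this means that `r` lies strictly above the line
through `p` and `q`, and a negative value means strictly below. -/
def orient (p q r : ℝ × ℝ) : ℝ :=
  (q.1 - p.1) * (r.2 - p.2) - (q.2 - p.2) * (r.1 - p.1)

/-- The points `p 0, …, p (n-1)` are in (strictly) convex position, numbered clockwise. -/
def ConvexClockwise {n : ℕ} (p : Fin n → ℝ × ℝ) : Prop :=
  Function.Injective p ∧ ∀ i j k : Fin n, i < j → j < k → orient (p i) (p j) (p k) < 0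

/-- Drawn with straight edges on the points `p v`, no two distinct edges of `G` cross. -/
def NonCrossing {V : Type*} (p : V → ℝ × ℝ) (G : SimpleGraph V) : Prop :=
  ∀ a b c d : V, G.Adj a b → G.Adj c d → s(a, b) ≠ s(c, d) →
    Disjoint (openSegment ℝ (p a) (p b)) (openSegment ℝ (p c) (p d))

/-- The number of edges of `G` at `v`. -/
noncomputable def deg {V : Type*} (G : SimpleGraph V) (v : V) : ℕ := (G.neighborSet v).ncard

/-- A non-crossing path partition of the finite point set `p`: a non-crossing graph all of whose
components are paths, i.e. without cycles and with at most two edges at each vertex. Isolated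
vertices are paths of length 0. -/
structure IsNCPPartition {V : Type*} [Finite V] (p : V → ℝ × ℝ) (G : SimpleGraph V) : Prop where
  nonCrossing : NonCrossing p G
  acyclic : G.IsAcyclic
  deg_le_two : ∀ v, deg G v ≤ 2

/-- `v` is an endpoint of its path (for a singleton, both endpoints). -/
def IsEndpoint {V : Type*} (G : SimpleGraph V) (v : V) : Prop := deg G v ≤ 1

/-- An ordered ncp partition: if `i < j` are the endpoints of a path, then no endpoint of a path
lies between `i` and `j` in the numbering. -/
structure IsOrderedNCPPartition {n : ℕ} (p : Fin n → ℝ × ℝ) (G : SimpleGraph (Fin n)) : Prop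
    extends IsNCPPartition p G where
  ordered : ∀ i j m : Fin n, i < j → IsEndpoint G i → IsEndpoint G j → G.Reachable i j →
    i < m → m < j → ¬ IsEndpoint G m

/-- The number of paths (components) of a path partition. -/
noncomputable def numPaths {V : Type*} (G : SimpleGraph V) : ℕ := Nat.card G.ConnectedComponent

/-- The number of ordered ncp partitions of `p` that consist of `k` paths. -/
noncomputable def orderedCount {n : ℕ} (p : Fin n → ℝ × ℝ) (k : ℕ) : ℕ :=
  {G : SimpleGraph (Fin n) | IsOrderedNCPPartition p G ∧ numPaths G = k}.ncard

/-- A double chain of `2 * n` points: the upper chain `U` and the lower chain `L`, each listed from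
left to right. -/
structure IsDoubleChain {n : ℕ} (U L : Fin n → ℝ × ℝ) : Prop where
  upper_left_right : StrictMono fun i => (U i).1
  lower_left_right : StrictMono fun i => (L i).1
  /-- The upper chain turns left: it is convex, bulging downwards, towards `L`. -/
  upper_convex : ∀ i j k : Fin n, i < j → j < k → 0 < orient (U i) (U j) (U k)
  /-- The lower chain turns right: it has the opposite concavity. -/
  lower_concave : ∀ i j k : Fin n, i < j → j < k → orient (L i) (L j) (L k) < 0
  /-- The line through two points of `U` leaves all the points of `L` below. -/
  lower_below : ∀ i j k : Fin n, i < j → orient (U i) (U j) (L k) < 0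
  /-- The line through two points of `L` leaves all the points of `U` above. -/
  upper_above : ∀ i j k : Fin n, i < j → 0 < orient (L i) (L j) (U k)

/-- The points of a double chain: `Sum.inl i` is the `i`-th point of `U`, `Sum.inr j` the `j`-th
point of `L`. -/
def points {n : ℕ} (U L : Fin n → ℝ × ℝ) : Fin n ⊕ Fin n → ℝ × ℝ := Sum.elim U L

/-- The graph `G` consists exactly of the edges of a Hamiltonian path. -/
def IsHamiltonianPath {V : Type*} [DecidableEq V] (G : SimpleGraph V) : Prop :=
  ∃ (a b : V) (w : G.Walk a b), w.IsHamiltonian ∧ ∀ e ∈ G.edgeSet, e ∈ w.edges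

/-- The graph `G` consists exactly of the edges of a Hamiltonian cycle. -/
def IsHamiltonianCycle {V : Type*} [DecidableEq V] (G : SimpleGraph V) : Prop :=
  ∃ (a : V) (w : G.Walk a a), w.IsHamiltonianCycle ∧ ∀ e ∈ G.edgeSet, e ∈ w.edges

/-- A polygonization of the point set `p`: a non-crossing Hamiltonian cycle. -/
structure IsPolygonization {V : Type*} [DecidableEq V] (p : V → ℝ × ℝ) (G : SimpleGraph V) :
    Prop where
  nonCrossing : NonCrossing p G
  hamiltonian : IsHamiltonianCycle G

/-- The number of polygonizations that the point set `p` admits. -/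
noncomputable def numPolygonizations {V : Type*} [DecidableEq V] (p : V → ℝ × ℝ) : ℕ :=
  {G : SimpleGraph V | IsPolygonization p G}.ncard

/-- The endpoints of the paths of a path partition, from left to right, a singleton being listed
twice because it is both endpoints of its path. -/
noncomputable def endpointList {n : ℕ} (G : SimpleGraph (Fin n)) : List (Fin n) :=
  (List.finRange n).flatMap fun i => List.replicate (2 - deg G i) i

/-- The alternating edges added between the two chains: skip the first endpoint on `U` and the last
endpoint on `L`, and match the remaining endpoints in order from left to right. -/
noncomputable def alternatingEdges {n : ℕ} (G H : SimpleGraph (Fin n)) :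
    List (Fin n × Fin n) :=
  (endpointList G).tail.zip (endpointList H).dropLast

/-- The path partitions `G` of the upper and `H` of the lower chain together with the alternating
edges. -/
def joinGraph {n : ℕ} (G H : SimpleGraph (Fin n)) : SimpleGraph (Fin n ⊕ Fin n) where
  Adj
    | .inl i, .inl j => G.Adj i j
    | .inr i, .inr j => H.Adj i j
    | .inl i, .inr j => (i, j) ∈ alternatingEdges G H
    | .inr j, .inl i => (i, j) ∈ alternatingEdges G H
  symm := ⟨by
    rintro (i | i) (j | j) h
    · exact SimpleGraph.Adj.symm h
    · exact h
    · exact h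
    · exact SimpleGraph.Adj.symm h⟩
  loopless := ⟨by
    rintro (i | i) h
    · exact G.irrefl h
    · exact H.irrefl h⟩

end NCPath

namespace NCPath

/-! ### Orientation and segments -/

theorem orient_rot (p q r : ℝ × ℝ) : orient q r p = orient p q r := by
  simp only [orient]; ring

theorem orient_swap (p q r : ℝ × ℝ) : orient q p r = -orient p q r := by
  simp only [orient]; ring

theorem orient_self_left (p q : ℝ × ℝ) : orient p q p = 0 := by
  simp only [orient]; ring

theorem orient_self_right (p q : ℝ × ℝ) : orient p q q = 0 := by
  simp only [orient]; ring

theorem orient_combo (p q r t : ℝ × ℝ) {a b : ℝ} (hab : a + b = 1) :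
    orient p q (a • r + b • t) = a * orient p q r + b * orient p q t := by
  obtain rfl : b = 1 - a := by linarith
  simp only [orient, Prod.fst_add, Prod.snd_add, Prod.smul_fst, Prod.smul_snd, smul_eq_mul]
  ring

theorem disjoint_of_sides (s : ℝ) {p q r t : ℝ × ℝ} (hr : 0 ≤ s * orient p q r)
    (ht : 0 ≤ s * orient p q t) (h : 0 < s * orient p q r ∨ 0 < s * orient p q t) :
    Disjoint (openSegment ℝ p q) (openSegment ℝ r t) := by
  rw [Set.disjoint_left]
  rintro x ⟨a, b, ha, hb, hab, rfl⟩ ⟨c, d, hc, hd, hcd, h'⟩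
  have h1 := orient_combo p q p q hab
  have h2 := orient_combo p q r t hcd
  rw [h', h1, orient_self_left, orient_self_right] at h2
  have h3 : c * (s * orient p q r) + d * (s * orient p q t) = 0 := by
    linear_combination (-s) * h2
  rcases h with h | h
  · have := mul_pos hc h
    have := mul_nonneg hd.le ht
    linarith
  · have := mul_pos hd h
    have := mul_nonneg hc.le hr
    linarith

theorem disjoint_of_side_pos {p q r t : ℝ × ℝ} (hr : 0 ≤ orient p q r)
    (ht : 0 ≤ orient p q t) (h : 0 < orient p q r ∨ 0 < orient p q t) :
    Disjoint (openSegment ℝ p q) (openSegment ℝ r t) :=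
  disjoint_of_sides 1 (by simpa using hr) (by simpa using ht) (by simpa using h)

/-- The diagonals of a convex quadrilateral cross. -/
theorem not_disjoint_diagonals (s : ℝ) {a b c d : ℝ × ℝ} (habc : 0 < s * orient a b c)
    (habd : 0 < s * orient a b d) (hacd : 0 < s * orient a c d) (hbcd : 0 < s * orient b c d) :
    ¬ Disjoint (openSegment ℝ a c) (openSegment ℝ b d) := by
  have hsum : orient a b d + orient b c d = orient a b c + orient a c d := by
    simp only [orient]; ring
  set S := s * orient a b d + s * orient b c d with hS
  have hS' : S = s * orient a b c + s * orient a c d := by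
    rw [hS]; linear_combination s * hsum
  have hpos : 0 < S := add_pos habd hbcd
  rw [Set.not_disjoint_iff]
  refine ⟨(s * orient b c d / S) • a + (s * orient a b d / S) • c,
    ⟨_, _, div_pos hbcd hpos, div_pos habd hpos, by rw [← add_div, add_comm]; exact div_self hpos.ne',
      rfl⟩, ⟨s * orient a c d / S, s * orient a b c / S, div_pos hacd hpos, div_pos habc hpos,
      by rw [← add_div, add_comm, ← hS']; exact div_self hpos.ne', ?_⟩⟩
  have hne := hpos.ne'
  ext
  · simp only [Prod.fst_add, Prod.smul_fst, smul_eq_mul]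
    field_simp
    simp only [orient]; ring
  · simp only [Prod.snd_add, Prod.smul_snd, smul_eq_mul]
    field_simp
    simp only [orient]; ring

/-! ### Crossings in convex position -/

/-- No two edges of `G` interleave. -/
def NC {n : ℕ} (G : SimpleGraph (Fin n)) : Prop :=
  ∀ a b c d : Fin n, a < b → b < c → c < d → G.Adj a c → ¬ G.Adj b d

theorem disjoint_of_not_interleaved {n : ℕ} {p : Fin n → ℝ × ℝ} (s : ℝ)
    (hp : ∀ i j k : Fin n, i < j → j < k → 0 < s * orient (p i) (p j) (p k))
    {a b c d : Fin n} (hab : a < b) (hcd : c < d) (hne : ¬ (a = c ∧ b = d))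
    (h1 : ¬ (a < c ∧ c < b ∧ b < d)) (h2 : ¬ (c < a ∧ a < d ∧ d < b)) :
    Disjoint (openSegment ℝ (p a) (p b)) (openSegment ℝ (p c) (p d)) := by
  have out : ∀ x, x < a ∨ b < x → 0 < s * orient (p a) (p b) (p x) := by
    rintro x (h | h)
    · rw [orient_rot]; exact hp _ _ _ h hab
    · exact hp _ _ _ hab h
  have ins : ∀ x, a < x → x < b → 0 < -s * orient (p a) (p b) (p x) := by
    intro x hx hx'
    have := hp _ _ _ hx hx'
    rw [← orient_rot, ← orient_rot, orient_swap] at this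
    linarith
  have e1 : orient (p a) (p b) (p a) = 0 := orient_self_left _ _
  have e2 : orient (p a) (p b) (p b) = 0 := orient_self_right _ _
  have out' : ∀ x, ¬ (a < x ∧ x < b) → 0 ≤ s * orient (p a) (p b) (p x) := by
    intro x hx
    rcases lt_trichotomy x a with h | h | h
    · exact (out x (Or.inl h)).le
    · rw [h, e1]; simp
    · rcases lt_trichotomy x b with h' | h' | h'
      · exact absurd ⟨h, h'⟩ hx
      · rw [h', e2]; simp
      · exact (out x (Or.inr h')).le
  have ins' : ∀ x, a ≤ x → x ≤ b → 0 ≤ -s * orient (p a) (p b) (p x) := by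
    intro x h h'
    rcases h.eq_or_lt with rfl | h
    · rw [e1]; simp
    rcases h'.eq_or_lt with rfl | h'
    · rw [e2]; simp
    exact (ins x h h').le
  by_cases hc : a < c ∧ c < b
  · have hd : d ≤ b := by
      by_contra hd
      exact h1 ⟨hc.1, hc.2, not_le.1 hd⟩
    exact disjoint_of_sides (-s) (ins' c hc.1.le hc.2.le) (ins' d (hc.1.trans hcd).le hd)
      (Or.inl (ins c hc.1 hc.2))
  · by_cases hd : a < d ∧ d < b
    · have hca : a ≤ c := by
        by_contra hca
        exact h2 ⟨not_le.1 hca, hd.1, hd.2⟩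
      exact disjoint_of_sides (-s) (ins' c hca (hcd.trans hd.2).le) (ins' d hd.1.le hd.2.le)
        (Or.inr (ins d hd.1 hd.2))
    · refine disjoint_of_sides s (out' c hc) (out' d hd) ?_
      by_contra hcon
      rw [not_or] at hcon
      have hc' : ¬ (c < a ∨ b < c) := fun h => hcon.1 (out c h)
      have hd' : ¬ (d < a ∨ b < d) := fun h => hcon.2 (out d h)
      omega

theorem nonCrossing_iff_nc {n : ℕ} {p : Fin n → ℝ × ℝ} (s : ℝ)
    (hp : ∀ i j k : Fin n, i < j → j < k → 0 < s * orient (p i) (p j) (p k))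
    (G : SimpleGraph (Fin n)) : NonCrossing p G ↔ NC G := by
  constructor
  · intro h a b c d hab hbc hcd hac hbd
    refine not_disjoint_diagonals s (hp a b c hab hbc) (hp a b d hab (hbc.trans hcd))
      (hp a c d (hab.trans hbc) hcd) (hp b c d hbc hcd) (h a c b d hac hbd ?_)
    simp only [ne_eq, Sym2.eq_iff]
    omega
  · intro h
    have key : ∀ a b c d : Fin n, a < b → c < d → G.Adj a b → G.Adj c d → ¬ (a = c ∧ b = d) →
        Disjoint (openSegment ℝ (p a) (p b)) (openSegment ℝ (p c) (p d)) := by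
      intro a b c d hab hcd h1 h2 hne
      exact disjoint_of_not_interleaved s hp hab hcd hne
        (fun h' => h a c b d h'.1 h'.2.1 h'.2.2 h1 h2)
        (fun h' => h c a d b h'.1 h'.2.1 h'.2.2 h2 h1)
    intro a b c d h1 h2 hne
    simp only [ne_eq, Sym2.eq_iff, not_or] at hne
    rcases lt_or_gt_of_ne h1.ne with hab | hab <;> rcases lt_or_gt_of_ne h2.ne with hcd | hcd
    · exact key a b c d hab hcd h1 h2 (by tauto)
    · rw [openSegment_symm ℝ (p c)]
      exact key a b d c hab hcd h1 h2.symm (by tauto)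
    · rw [openSegment_symm ℝ (p a)]
      exact key b a c d hab hcd h1.symm h2 (by tauto)
    · rw [openSegment_symm ℝ (p a), openSegment_symm ℝ (p c)]
      exact key b a d c hab hcd h1.symm h2.symm (by tauto)

/-- The combinatorial form of an ordered ncp partition of points in convex position. -/
structure Ord {n : ℕ} (G : SimpleGraph (Fin n)) : Prop where
  nc : NC G
  acyclic : G.IsAcyclic
  deg_le_two : ∀ v, deg G v ≤ 2
  ordered : ∀ i j m : Fin n, i < j → IsEndpoint G i → IsEndpoint G j → G.Reachable i j →
    i < m → m < j → ¬ IsEndpoint G m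

theorem isOrderedNCPPartition_iff {n : ℕ} {p : Fin n → ℝ × ℝ} (s : ℝ)
    (hp : ∀ i j k : Fin n, i < j → j < k → 0 < s * orient (p i) (p j) (p k))
    (G : SimpleGraph (Fin n)) : IsOrderedNCPPartition p G ↔ Ord G := by
  constructor
  · intro h
    exact ⟨(nonCrossing_iff_nc s hp G).1 h.nonCrossing, h.acyclic, h.deg_le_two, h.ordered⟩
  · intro h
    exact ⟨⟨(nonCrossing_iff_nc s hp G).2 h.nc, h.acyclic, h.deg_le_two⟩, h.ordered⟩

/-- The number of combinatorial ordered ncp partitions of `n` points into `k` paths. -/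
noncomputable def ordCount (n k : ℕ) : ℕ :=
  {G : SimpleGraph (Fin n) | Ord G ∧ numPaths G = k}.ncard

theorem orderedCount_eq {n : ℕ} {p : Fin n → ℝ × ℝ} (s : ℝ)
    (hp : ∀ i j k : Fin n, i < j → j < k → 0 < s * orient (p i) (p j) (p k)) (k : ℕ) :
    orderedCount p k = ordCount n k := by
  simp only [orderedCount, ordCount, isOrderedNCPPartition_iff s hp]

/-! ### Crossings in a double chain -/

/-- The graph on a double chain formed by `G` on the upper chain, `H` on the lower chain and the
edges between the chains listed in `M`. -/
def linkGraph {m n : ℕ} (G : SimpleGraph (Fin m)) (H : SimpleGraph (Fin n))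
    (M : List (Fin m × Fin n)) : SimpleGraph (Fin m ⊕ Fin n) where
  Adj
    | .inl i, .inl j => G.Adj i j
    | .inr i, .inr j => H.Adj i j
    | .inl i, .inr j => (i, j) ∈ M
    | .inr j, .inl i => (i, j) ∈ M
  symm := ⟨by
    rintro (i | i) (j | j) h
    · exact SimpleGraph.Adj.symm h
    · exact h
    · exact h
    · exact SimpleGraph.Adj.symm h⟩
  loopless := ⟨by
    rintro (i | i) h
    · exact G.irrefl h
    · exact H.irrefl h⟩

theorem joinGraph_eq {n : ℕ} (G H : SimpleGraph (Fin n)) :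
    joinGraph G H = linkGraph G H (alternatingEdges G H) := by
  ext x y
  rcases x with x | x <;> rcases y with y | y <;> rfl

section DoubleChain

variable {n : ℕ} {U L : Fin n → ℝ × ℝ}

theorem IsDoubleChain.exists_line_upper (h : IsDoubleChain U L) (hn : 2 ≤ n) (k : Fin n) :
    ∃ i j : Fin n, (∀ m, 0 ≤ orient (U i) (U j) (U m)) ∧ (∀ m, orient (U i) (U j) (L m) < 0) ∧
      orient (U i) (U j) (U k) = 0 := by
  have key : ∀ i j : Fin n, i < j → j.val = i.val + 1 → ∀ m, 0 ≤ orient (U i) (U j) (U m) := by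
    intro i j hij hj m
    rcases lt_trichotomy m i with h' | rfl | h'
    · rw [orient_rot]; exact (h.upper_convex _ _ _ h' hij).le
    · rw [orient_self_left]
    · rcases lt_trichotomy m j with h'' | rfl | h''
      · omega
      · rw [orient_self_right]
      · exact (h.upper_convex _ _ _ hij h'').le
  by_cases hk : k.val + 1 < n
  · have hlt : k < ⟨k.val + 1, hk⟩ := by simp [Fin.lt_def]
    exact ⟨k, ⟨k.val + 1, hk⟩, key _ _ hlt rfl, fun m => h.lower_below _ _ _ hlt,
      orient_self_left _ _⟩
  · have hlt : (⟨k.val - 1, by omega⟩ : Fin n) < k := by simp only [Fin.lt_def]; omega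
    exact ⟨⟨k.val - 1, by omega⟩, k, key _ _ hlt (by simp only; omega),
      fun m => h.lower_below _ _ _ hlt, orient_self_right _ _⟩

theorem IsDoubleChain.exists_line_lower (h : IsDoubleChain U L) (hn : 2 ≤ n) (k : Fin n) :
    ∃ i j : Fin n, (∀ m, orient (L i) (L j) (L m) ≤ 0) ∧ (∀ m, 0 < orient (L i) (L j) (U m)) ∧
      orient (L i) (L j) (L k) = 0 := by
  have key : ∀ i j : Fin n, i < j → j.val = i.val + 1 → ∀ m, orient (L i) (L j) (L m) ≤ 0 := by
    intro i j hij hj m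
    rcases lt_trichotomy m i with h' | rfl | h'
    · rw [orient_rot]; exact (h.lower_concave _ _ _ h' hij).le
    · rw [orient_self_left]
    · rcases lt_trichotomy m j with h'' | rfl | h''
      · omega
      · rw [orient_self_right]
      · exact (h.lower_concave _ _ _ hij h'').le
  by_cases hk : k.val + 1 < n
  · have hlt : k < ⟨k.val + 1, hk⟩ := by simp [Fin.lt_def]
    exact ⟨k, ⟨k.val + 1, hk⟩, key _ _ hlt rfl, fun m => h.upper_above _ _ _ hlt,
      orient_self_left _ _⟩
  · have hlt : (⟨k.val - 1, by omega⟩ : Fin n) < k := by simp only [Fin.lt_def]; omega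
    exact ⟨⟨k.val - 1, by omega⟩, k, key _ _ hlt (by simp only; omega),
      fun m => h.upper_above _ _ _ hlt, orient_self_right _ _⟩

theorem disjoint_of_line {P Q a b c d : ℝ × ℝ} (s : ℝ) (ha : 0 ≤ s * orient P Q a)
    (hb : 0 ≤ s * orient P Q b) (hc : s * orient P Q c ≤ 0) (hd : s * orient P Q d < 0) :
    Disjoint (openSegment ℝ a b) (openSegment ℝ c d) := by
  rw [Set.disjoint_left]
  rintro x ⟨t, u, ht, hu, htu, rfl⟩ ⟨v, w, hv, hw, hvw, h'⟩
  have h1 := orient_combo P Q a b htu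
  have h2 := orient_combo P Q c d hvw
  rw [h', h1] at h2
  have h3 : t * (s * orient P Q a) + u * (s * orient P Q b) =
      v * (s * orient P Q c) + w * (s * orient P Q d) := by
    linear_combination s * h2
  have := mul_nonneg ht.le ha
  have := mul_nonneg hu.le hb
  have := mul_nonpos_of_nonneg_of_nonpos hv.le hc
  have := mul_neg_of_pos_of_neg hw hd
  linarith

theorem IsDoubleChain.disjoint_upper_link (h : IsDoubleChain U L) (hn : 2 ≤ n) (a b i j : Fin n) :
    Disjoint (openSegment ℝ (U a) (U b)) (openSegment ℝ (U i) (L j)) := by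
  obtain ⟨P, Q, h1, h2, h3⟩ := h.exists_line_upper hn i
  exact disjoint_of_line (P := U P) (Q := U Q) 1 (by simpa using h1 a) (by simpa using h1 b)
    (by simp [h3]) (by simpa using h2 j)

theorem IsDoubleChain.disjoint_lower_link (h : IsDoubleChain U L) (hn : 2 ≤ n) (a b i j : Fin n) :
    Disjoint (openSegment ℝ (L a) (L b)) (openSegment ℝ (U i) (L j)) := by
  obtain ⟨P, Q, h1, h2, h3⟩ := h.exists_line_lower hn j
  rw [openSegment_symm ℝ (U i)]
  exact disjoint_of_line (P := L P) (Q := L Q) (-1) (by simpa using h1 a) (by simpa using h1 b)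
    (by simp [h3]) (by simpa using h2 i)

theorem IsDoubleChain.disjoint_upper_lower (h : IsDoubleChain U L) (hn : 2 ≤ n) (a b i j : Fin n) :
    Disjoint (openSegment ℝ (U a) (U b)) (openSegment ℝ (L i) (L j)) := by
  obtain ⟨P, Q, h1, h2, -⟩ := h.exists_line_upper hn a
  exact disjoint_of_line (P := U P) (Q := U Q) 1 (by simpa using h1 a) (by simpa using h1 b)
    (by simpa using (h2 i).le) (by simpa using h2 j)

theorem IsDoubleChain.disjoint_links (h : IsDoubleChain U L) {i i' j j' : Fin n}
    (hi : i ≤ i') (hj : j ≤ j') (hne : ¬ (i = i' ∧ j = j')) :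
    Disjoint (openSegment ℝ (U i) (L j)) (openSegment ℝ (U i') (L j')) := by
  have e1 : i < i' → 0 < orient (U i) (L j) (U i') := by
    intro hlt
    have := h.lower_below _ _ j hlt
    rw [← orient_rot, ← orient_rot, orient_swap] at this
    linarith
  have e2 : j < j' → 0 < orient (U i) (L j) (L j') := by
    intro hlt
    rw [← orient_rot, ← orient_rot, orient_rot]
    exact h.upper_above _ _ i hlt
  rcases hi.eq_or_lt with rfl | hi
  · rcases hj.eq_or_lt with rfl | hj
    · exact absurd ⟨rfl, rfl⟩ hne
    · exact disjoint_of_side_pos (by rw [orient_self_left]) (e2 hj).le (Or.inr (e2 hj))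
  · rcases hj.eq_or_lt with rfl | hj
    · exact disjoint_of_side_pos (e1 hi).le (by rw [orient_self_right]) (Or.inl (e1 hi))
    · exact disjoint_of_side_pos (e1 hi).le (e2 hj).le (Or.inr (e2 hj))

/-- Edges between the chains that are listed from left to right do not cross each other, nor do
they cross edges within the chains. -/
theorem IsDoubleChain.nonCrossing_linkGraph (h : IsDoubleChain U L) (hn : 2 ≤ n)
    {G H : SimpleGraph (Fin n)} (hG : NonCrossing U G) (hH : NonCrossing L H)
    {M : List (Fin n × Fin n)} (hM : M.Pairwise fun x y => x.1 ≤ y.1 ∧ x.2 ≤ y.2) :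
    NonCrossing (points U L) (linkGraph G H M) := by
  have hlinks : ∀ i j i' j', (i, j) ∈ M → (i', j') ∈ M → ¬ (i = i' ∧ j = j') →
      Disjoint (openSegment ℝ (U i) (L j)) (openSegment ℝ (U i') (L j')) := by
    intro i j i' j' h1 h2 hne
    have : (i, j) ≠ (i', j') := by simpa using hne
    have hsym : Std.Symm fun x y : Fin n × Fin n =>
      (x.1 ≤ y.1 ∧ x.2 ≤ y.2) ∨ (y.1 ≤ x.1 ∧ y.2 ≤ x.2) := ⟨fun a b => Or.symm⟩
    have hM' : M.Pairwise fun x y =>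
      (x.1 ≤ y.1 ∧ x.2 ≤ y.2) ∨ (y.1 ≤ x.1 ∧ y.2 ≤ x.2) := hM.imp fun h => Or.inl h
    rcases hM'.forall h1 h2 this with h' | h'
    · exact h.disjoint_links h'.1 h'.2 hne
    · exact (h.disjoint_links h'.1 h'.2 (by tauto)).symm
  rintro (a | a) (b | b) (c | c) (d | d) h1 h2 hne <;>
    simp only [points, Sum.elim_inl, Sum.elim_inr]
  · exact hG a b c d h1 h2 (fun e => hne (by
      simp only [Sym2.eq_iff, Sum.inl.injEq] at e ⊢; exact e))
  · exact h.disjoint_upper_link hn a b c d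
  · rw [openSegment_symm ℝ (L c)]; exact h.disjoint_upper_link hn a b d c
  · exact h.disjoint_upper_lower hn a b c d
  · exact (h.disjoint_upper_link hn c d a b).symm
  · exact hlinks a b c d h1 h2 (fun e => hne (by rw [e.1, e.2]))
  · rw [openSegment_symm ℝ (L c)]
    exact hlinks a b d c h1 h2 (fun e => hne (by rw [e.1, e.2, Sym2.eq_swap]))
  · exact (h.disjoint_lower_link hn c d a b).symm
  · rw [openSegment_symm ℝ (L a)]; exact (h.disjoint_upper_link hn c d b a).symm
  · rw [openSegment_symm ℝ (L a)]
    exact hlinks b a c d h1 h2 (fun e => hne (by rw [e.1, e.2, Sym2.eq_swap]))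
  · rw [openSegment_symm ℝ (L a), openSegment_symm ℝ (L c)]
    exact hlinks b a d c h1 h2 (fun e => hne (by rw [e.1, e.2]))
  · rw [openSegment_symm ℝ (L a)]; exact (h.disjoint_lower_link hn c d b a).symm
  · exact (h.disjoint_upper_lower hn c d a b).symm
  · exact h.disjoint_lower_link hn a b c d
  · rw [openSegment_symm ℝ (L c)]; exact h.disjoint_lower_link hn a b d c
  · exact hH a b c d h1 h2 (fun e => hne (by
      simp only [Sym2.eq_iff, Sum.inr.injEq] at e ⊢; exact e))

end DoubleChain

end NCPath

namespace NCPath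

open SimpleGraph

/-! ### Graphs of maximum degree two -/

theorem mem_edges_getVert {V : Type*} {G : SimpleGraph V} {a b : V} (w : G.Walk a b) {i : ℕ} (hi : i < w.length) :
    s(w.getVert i, w.getVert (i + 1)) ∈ w.edges :=
  Walk.adj_toSubgraph_iff_mem_edges.1 (w.toSubgraph_adj_getVert hi)

section Paths

variable {V : Type*} [Finite V] {G : SimpleGraph V}

theorem eq_of_deg_le_one {v x y : V} (h : deg G v ≤ 1) (hx : G.Adj v x) (hy : G.Adj v y) :
    x = y :=
  (Set.ncard_le_one (Set.toFinite _)).1 h x hx y hy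

theorem deg_le_one_of_forall {v : V} (h : ∀ x y, G.Adj v x → G.Adj v y → x = y) : deg G v ≤ 1 :=
  (Set.ncard_le_one (Set.toFinite _)).2 fun x hx y hy => h x y hx hy

theorem eq_of_deg_le_two {v x y z : V} (h : deg G v ≤ 2) (hx : G.Adj v x) (hy : G.Adj v y)
    (hz : G.Adj v z) (hxy : x ≠ y) : z = x ∨ z = y := by
  by_contra hcon
  rw [not_or] at hcon
  have : 2 < (G.neighborSet v).ncard :=
    (Set.two_lt_ncard_iff (Set.toFinite _)).2 ⟨x, y, z, hx, hy, hz, hxy, Ne.symm hcon.1, Ne.symm hcon.2⟩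
  exact absurd h (not_le.2 this)

theorem two_le_deg {v x y : V} (hx : G.Adj v x) (hy : G.Adj v y) (hxy : x ≠ y) : 2 ≤ deg G v :=
  (Set.one_lt_ncard_iff (Set.toFinite _)).2 ⟨x, y, hx, hy, hxy⟩

theorem deg_eq_zero {v : V} : deg G v = 0 ↔ ∀ x, ¬ G.Adj v x := by
  rw [deg, Set.ncard_eq_zero (Set.toFinite _), Set.eq_empty_iff_forall_notMem]
  rfl

theorem mem_edges_of_interior {a b : V} {w : G.Walk a b} (hw : w.IsPath)
    (hdeg : ∀ v, deg G v ≤ 2) {i : ℕ} (h0 : 0 < i) (hi : i < w.length) {y : V}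
    (hy : G.Adj (w.getVert i) y) : s(w.getVert i, y) ∈ w.edges := by
  obtain ⟨j, rfl⟩ : ∃ j, i = j + 1 := ⟨i - 1, by omega⟩
  have e1 := mem_edges_getVert w (i := j) (by omega)
  have e2 := mem_edges_getVert w (i := j + 1) hi
  rw [Sym2.eq_swap] at e1
  have hne : w.getVert j ≠ w.getVert (j + 1 + 1) := by
    intro h
    have := hw.getVert_injOn (by simp only [Set.mem_ofPred_eq]; omega)
      (by simp only [Set.mem_ofPred_eq]; omega) h
    omega
  rcases eq_of_deg_le_two (hdeg _) (w.adj_of_mem_edges e1) (w.adj_of_mem_edges e2) hy hne with h | h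
  · rw [h]; exact e1
  · rw [h]; exact e2

theorem two_le_deg_interior {a b : V} {w : G.Walk a b} (hw : w.IsPath) {i : ℕ} (h0 : 0 < i)
    (hi : i < w.length) : 2 ≤ deg G (w.getVert i) := by
  obtain ⟨j, rfl⟩ : ∃ j, i = j + 1 := ⟨i - 1, by omega⟩
  have e1 := mem_edges_getVert w (i := j) (by omega)
  have e2 := mem_edges_getVert w (i := j + 1) hi
  rw [Sym2.eq_swap] at e1
  refine two_le_deg (w.adj_of_mem_edges e1) (w.adj_of_mem_edges e2) fun h => ?_
  have := hw.getVert_injOn (by simp only [Set.mem_ofPred_eq]; omega)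
      (by simp only [Set.mem_ofPred_eq]; omega) h
  omega

/-- In a graph of maximum degree two a component is covered by a path, which contains all its
edges with the possible exception of an edge between the two endpoints of the path. -/
theorem exists_covering_path (hdeg : ∀ v, deg G v ≤ 2) (v : V) :
    ∃ (a b : V) (w : G.Walk a b), w.IsPath ∧ G.Reachable v a ∧
      (∀ u, G.Reachable v u → u ∈ w.support) ∧
      ∀ x y, x ∈ w.support → G.Adj x y → s(x, y) ∈ w.edges ∨ (x = a ∧ y = b) ∨ (x = b ∧ y = a) := by
  classical
  have := Fintype.ofFinite V
  let S : Set ℕ := {n | ∃ (a b : V) (w : G.Walk a b), w.IsPath ∧ G.Reachable v a ∧ w.length = n}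
  have hS : S.Nonempty := ⟨0, v, v, Walk.nil, Walk.IsPath.nil, Reachable.refl _, rfl⟩
  have hbdd : BddAbove S := ⟨Fintype.card V, by
    rintro _ ⟨a, b, w, hw, -, rfl⟩
    exact hw.length_lt.le⟩
  obtain ⟨a, b, w, hw, hva, hlen⟩ := Nat.sSup_mem hS hbdd
  have hmax : ∀ (a' b' : V) (w' : G.Walk a' b'), w'.IsPath → G.Reachable v a' →
      w'.length ≤ w.length := by
    intro a' b' w' hw' hr
    rw [hlen]
    exact le_csSup hbdd ⟨a', b', w', hw', hr, rfl⟩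
  have hstart : ∀ y, G.Adj a y → y ∈ w.support := by
    intro y hy
    by_contra hn
    have := hmax y b (Walk.cons hy.symm w) (hw.cons hn) (hva.trans hy.reachable)
    simp at this
  have hend : ∀ y, G.Adj b y → y ∈ w.support := by
    intro y hy
    by_contra hn
    have hn' : y ∉ w.reverse.support := by simpa using hn
    have := hmax y a (Walk.cons hy.symm w.reverse) (hw.reverse.cons hn')
      ((hva.trans ⟨w⟩).trans hy.reachable)
    simp at this
  have hedges : ∀ x y, x ∈ w.support → G.Adj x y →
      s(x, y) ∈ w.edges ∨ (x = a ∧ y = b) ∨ (x = b ∧ y = a) := by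
    intro x y hx hxy
    have hint : ∀ x y, x ∈ w.support → G.Adj x y → x ≠ a → x ≠ b → s(x, y) ∈ w.edges := by
      intro x y hx hxy hxa hxb
      obtain ⟨i, rfl, hi⟩ := Walk.mem_support_iff_exists_getVert.1 hx
      refine mem_edges_of_interior hw hdeg ?_ ?_ hxy
      · rcases Nat.eq_zero_or_pos i with rfl | h
        · simp at hxa
        · exact h
      · rcases hi.eq_or_lt with rfl | h
        · simp at hxb
        · exact h
    by_cases hxa : x = a
    · subst hxa
      by_cases hyb : y = b
      · exact Or.inr (Or.inl ⟨rfl, hyb⟩)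
      · left
        rw [Sym2.eq_swap]
        exact hint y x (hstart y hxy) hxy.symm hxy.ne' hyb
    · by_cases hxb : x = b
      · subst hxb
        by_cases hya : y = a
        · exact Or.inr (Or.inr ⟨rfl, hya⟩)
        · left
          rw [Sym2.eq_swap]
          exact hint y x (hend y hxy) hxy.symm hya hxy.ne'
      · exact Or.inl (hint x y hx hxy hxa hxb)
  refine ⟨a, b, w, hw, hva, ?_, hedges⟩
  have hclosed : ∀ x y, x ∈ w.support → G.Adj x y → y ∈ w.support := by
    intro x y hx hxy
    rcases hedges x y hx hxy with h | ⟨-, rfl⟩ | ⟨-, rfl⟩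
    · exact w.snd_mem_support_of_mem_edges h
    · exact w.end_mem_support
    · exact w.start_mem_support
  intro u hu
  obtain ⟨q⟩ := hva.symm.trans hu
  have : ∀ {x y : V} (q : G.Walk x y), x ∈ w.support → y ∈ w.support := by
    intro x y q
    induction q with
    | nil => exact id
    | cons h _ ih => exact fun hx => ih (hclosed _ _ hx h)
  exact this q w.start_mem_support

theorem isHamiltonianPath_of_connected [DecidableEq V] (hconn : G.Connected)
    (hdeg : ∀ v, deg G v ≤ 2) (hone : ∃ v, deg G v ≤ 1) : IsHamiltonianPath G := by
  obtain ⟨v, hv⟩ := hone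
  obtain ⟨a, b, w, hw, hva, hcov, hedges⟩ := exists_covering_path hdeg v
  have hall : ∀ u, u ∈ w.support := fun u => hcov u (hconn.preconnected v u)
  refine ⟨a, b, w, hw.isHamiltonian_of_mem hall, ?_⟩
  have hab : G.Adj a b → s(a, b) ∈ w.edges := by
    intro hab
    by_contra hn
    have hlen : 0 < w.length := by
      rw [Nat.pos_iff_ne_zero]
      exact fun h => hab.ne (Walk.eq_of_length_eq_zero h)
    have h2 : ∀ i, i ≤ w.length → 2 ≤ deg G (w.getVert i) := by
      intro i hi
      rcases Nat.eq_zero_or_pos i with rfl | h0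
      · have e := mem_edges_getVert w hlen
        rw [Walk.getVert_zero] at e ⊢
        exact two_le_deg (w.adj_of_mem_edges e) hab (fun h => hn (by rw [h] at e; exact e))
      · rcases hi.eq_or_lt with rfl | hi
        · have e := mem_edges_getVert w (i := w.length - 1) (by omega)
          rw [Nat.sub_add_cancel hlen, Walk.getVert_length, Sym2.eq_swap] at e
          rw [Walk.getVert_length]
          refine two_le_deg (w.adj_of_mem_edges e) hab.symm (fun h => hn ?_)
          rw [h, Sym2.eq_swap] at e
          exact e
        · exact two_le_deg_interior hw h0 hi
    obtain ⟨i, rfl, hi⟩ := Walk.mem_support_iff_exists_getVert.1 (hall v)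
    have := h2 i hi
    omega
  intro e he
  induction e with
  | h x y =>
    rcases hedges x y (hall x) he with h | ⟨rfl, rfl⟩ | ⟨rfl, rfl⟩
    · exact h
    · exact hab he
    · rw [Sym2.eq_swap]; exact hab (G.adj_symm he)

theorem isHamiltonianCycle_of_connected [DecidableEq V] (hconn : G.Connected)
    (hdeg : ∀ v, deg G v = 2) : IsHamiltonianCycle G := by
  obtain ⟨v⟩ := hconn.nonempty
  obtain ⟨a, b, w, hw, hva, hcov, hedges⟩ := exists_covering_path (fun v => (hdeg v).le) v
  have hall : ∀ u, u ∈ w.support := fun u => hcov u (hconn.preconnected v u)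
  have hab : G.Adj b a ∧ s(b, a) ∉ w.edges := by
    have h2 := hdeg a
    rw [deg, Set.ncard_eq_two] at h2
    obtain ⟨x, y, hxy, hset⟩ := h2
    have hx : G.Adj a x := by
      have : x ∈ G.neighborSet a := by rw [hset]; simp
      exact this
    have hy : G.Adj a y := by
      have : y ∈ G.neighborSet a := by rw [hset]; simp
      exact this
    have key : ∃ z, G.Adj a z ∧ s(a, z) ∉ w.edges := by
      by_contra hcon
      push Not at hcon
      exact hxy ((hw.eq_snd_of_mem_edges (hcon x hx)).trans (hw.eq_snd_of_mem_edges (hcon y hy)).symm)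
    obtain ⟨z, hz, hz'⟩ := key
    rcases hedges a z w.start_mem_support hz with h | ⟨-, rfl⟩ | ⟨rfl, rfl⟩
    · exact absurd h hz'
    · exact ⟨hz.symm, by rwa [Sym2.eq_swap]⟩
    · exact ⟨hz, hz'⟩
  refine ⟨b, Walk.cons hab.1 w, ?_, ?_⟩
  · rw [Walk.isHamiltonianCycle_iff_isCycle_and_support_count_tail_eq_one]
    exact ⟨(Walk.cons_isCycle_iff w hab.1).2 ⟨hw, hab.2⟩, by

      rw [Walk.support_cons, List.tail_cons]
      exact hw.isHamiltonian_of_mem hall⟩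
  · intro e he
    induction e with
    | h x y =>
      rw [Walk.edges_cons, List.mem_cons]
      rcases hedges x y (hall x) he with h | ⟨rfl, rfl⟩ | ⟨rfl, rfl⟩
      · exact Or.inr h
      · exact Or.inl Sym2.eq_swap
      · exact Or.inl rfl

/-- The two endpoints of the component of `v` in a path partition. -/
theorem exists_endpoints (hac : G.IsAcyclic) (hdeg : ∀ v, deg G v ≤ 2) (v : V) :
    ∃ a b : V, G.Reachable v a ∧ G.Reachable v b ∧ IsEndpoint G a ∧ IsEndpoint G b ∧
      (∀ u, G.Reachable v u → IsEndpoint G u → u = a ∨ u = b) ∧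
      (a = b → ∀ u, G.Reachable v u → u = a) := by
  obtain ⟨a, b, w, hw, hva, hcov, hedges⟩ := exists_covering_path hdeg v
  have hvb : G.Reachable v b := hva.trans ⟨w⟩
  have hab : G.Adj a b → s(a, b) ∈ w.edges := by
    intro hab
    by_contra hn
    rw [Sym2.eq_swap] at hn
    exact hac _ ((Walk.cons_isCycle_iff w hab.symm).2 ⟨hw, hn⟩)
  have hedges' : ∀ x y, G.Reachable v x → G.Adj x y → s(x, y) ∈ w.edges := by
    intro x y hx hxy
    rcases hedges x y (hcov x hx) hxy with h | ⟨rfl, rfl⟩ | ⟨rfl, rfl⟩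
    · exact h
    · exact hab hxy
    · rw [Sym2.eq_swap]; exact hab hxy.symm
  refine ⟨a, b, hva, hvb, ?_, ?_, ?_, ?_⟩
  · refine deg_le_one_of_forall fun x y hx hy => ?_
    rw [hw.eq_snd_of_mem_edges (hedges' a x hva hx), hw.eq_snd_of_mem_edges (hedges' a y hva hy)]
  · refine deg_le_one_of_forall fun x y hx hy => ?_
    have h1 := hedges' b x hvb hx
    have h2 := hedges' b y hvb hy
    rw [hw.eq_penultimate_of_mem_edges h1, hw.eq_penultimate_of_mem_edges h2]
  · intro u hu hu'
    obtain ⟨i, rfl, hi⟩ := Walk.mem_support_iff_exists_getVert.1 (hcov u hu)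
    rcases Nat.eq_zero_or_pos i with rfl | h0
    · left; simp
    rcases hi.eq_or_lt with rfl | hi
    · right; simp
    have := two_le_deg_interior hw h0 hi
    rw [IsEndpoint] at hu'
    omega
  · rintro rfl u hu
    have h1 := hcov u hu
    rw [(Walk.isPath_iff_nil.1 hw).eq_nil] at h1
    simpa using h1

end Paths

end NCPath

namespace NCPath

open SimpleGraph

/-! ### Inserting a vertex -/

/-- Insert a new vertex at position `k`, adjacent to the old vertex `o` if there is one. -/
def insertVertex {n : ℕ} (k : Fin (n + 1)) (G : SimpleGraph (Fin n)) (o : Option (Fin n)) :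
    SimpleGraph (Fin (n + 1)) where
  Adj x y := (∃ a b, x = k.succAbove a ∧ y = k.succAbove b ∧ G.Adj a b) ∨
    (x = k ∧ ∃ v, o = some v ∧ y = k.succAbove v) ∨ (y = k ∧ ∃ v, o = some v ∧ x = k.succAbove v)
  symm := ⟨by
    rintro x y (⟨a, b, rfl, rfl, h⟩ | h | h)
    · exact Or.inl ⟨b, a, rfl, rfl, h.symm⟩
    · exact Or.inr (Or.inr h)
    · exact Or.inr (Or.inl h)⟩
  loopless := ⟨by
    rintro x (⟨a, b, rfl, h', h⟩ | ⟨rfl, v, -, h⟩ | ⟨rfl, v, -, h⟩)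
    · rw [Fin.succAbove_right_injective.eq_iff] at h'
      exact h.ne h'
    · exact Fin.succAbove_ne _ _ h.symm
    · exact Fin.succAbove_ne _ _ h.symm⟩

theorem eq_or_exists_succAbove {n : ℕ} (k x : Fin (n + 1)) : k = x ∨ ∃ a, x = k.succAbove a := by
  by_cases h : k = x
  · exact Or.inl h
  · obtain ⟨a, ha⟩ := Fin.exists_succAbove_eq (Ne.symm h)
    exact Or.inr ⟨a, ha.symm⟩

theorem val_succAbove {n : ℕ} (k : Fin (n + 1)) (a : Fin n) :
    (k.succAbove a).val = if a.val < k.val then a.val else a.val + 1 := by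
  by_cases h : a.val < k.val
  · rw [Fin.succAbove_of_castSucc_lt _ _ (by simpa [Fin.lt_def] using h)]; simp [h]
  · rw [Fin.succAbove_of_le_castSucc _ _ (by simpa [Fin.le_def] using h)]; simp [h]

section

variable {n : ℕ} {k : Fin (n + 1)} {G : SimpleGraph (Fin n)} {o : Option (Fin n)}

@[simp] theorem insertVertex_adj_succAbove {a b : Fin n} :
    (insertVertex k G o).Adj (k.succAbove a) (k.succAbove b) ↔ G.Adj a b := by
  constructor
  · rintro (⟨a', b', h1, h2, h⟩ | ⟨h, -⟩ | ⟨h, -⟩)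
    · rw [Fin.succAbove_right_injective.eq_iff] at h1 h2
      subst h1 h2
      exact h
    · exact absurd h (Fin.succAbove_ne _ _)
    · exact absurd h (Fin.succAbove_ne _ _)
  · exact fun h => Or.inl ⟨a, b, rfl, rfl, h⟩

@[simp] theorem insertVertex_adj_left {b : Fin n} :
    (insertVertex k G o).Adj k (k.succAbove b) ↔ o = some b := by
  constructor
  · rintro (⟨a', b', h1, h2, h⟩ | ⟨-, v, rfl, h⟩ | ⟨h, -⟩)
    · exact absurd h1.symm (Fin.succAbove_ne _ _)
    · rw [Fin.succAbove_right_injective.eq_iff] at h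
      rw [h]
    · exact absurd h (Fin.succAbove_ne _ _)
  · exact fun h => Or.inr (Or.inl ⟨rfl, b, h, rfl⟩)

@[simp] theorem insertVertex_adj_right {b : Fin n} :
    (insertVertex k G o).Adj (k.succAbove b) k ↔ o = some b := by
  rw [SimpleGraph.adj_comm, insertVertex_adj_left]

theorem eq_insertVertex {G' : SimpleGraph (Fin (n + 1))}
    (h : ∀ b, G'.Adj k (k.succAbove b) ↔ o = some b) :
    G' = insertVertex k (G'.comap k.succAbove) o := by
  ext x y
  rcases eq_or_exists_succAbove k x with rfl | ⟨a, rfl⟩ <;>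
    rcases eq_or_exists_succAbove k y with rfl | ⟨b, rfl⟩
  · simp
  · rw [h, insertVertex_adj_left]
  · rw [G'.adj_comm, h, insertVertex_adj_right]
  · rw [insertVertex_adj_succAbove]; rfl

theorem comap_insertVertex : (insertVertex k G o).comap k.succAbove = G := by
  ext a b
  simp

theorem reachable_insertVertex_of_reachable {a b : Fin n} (h : G.Reachable a b) :
    (insertVertex k G o).Reachable (k.succAbove a) (k.succAbove b) := by
  obtain ⟨w⟩ := h
  induction w with
  | nil => exact Reachable.refl _
  | cons h _ ih => exact (Adj.reachable (insertVertex_adj_succAbove.2 h)).trans ih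

/-- The vertices reachable from `x` after an insertion. -/
theorem reachable_insertVertex_aux {x y : Fin (n + 1)} (h : (insertVertex k G o).Reachable x y) :
    (∀ a, x = k.succAbove a → (∀ b, y = k.succAbove b → G.Reachable a b) ∧
      (y = k → ∃ v, o = some v ∧ G.Reachable a v)) ∧
    (x = k → ∀ b, y = k.succAbove b → ∃ v, o = some v ∧ G.Reachable v b) := by
  obtain ⟨w⟩ := h
  induction w with
  | nil =>
    refine ⟨fun a ha => ⟨fun b hb => ?_, fun hk => ?_⟩, fun hk b hb => ?_⟩
    · rw [ha, Fin.succAbove_right_injective.eq_iff] at hb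
      rw [hb]
    · exact absurd (ha.symm.trans hk) (Fin.succAbove_ne _ _)
    · exact absurd (hb.symm.trans hk) (Fin.succAbove_ne _ _)
  | @cons x z y h _ ih =>
    refine ⟨?_, ?_⟩
    · rintro a rfl
      rcases eq_or_exists_succAbove k z with rfl | ⟨c, rfl⟩
      · rw [insertVertex_adj_right] at h
        refine ⟨fun b hb => ?_, fun _ => ⟨a, h, Reachable.refl _⟩⟩
        obtain ⟨v, hv, hvb⟩ := ih.2 rfl b hb
        rw [h, Option.some.injEq] at hv
        rwa [hv]
      · rw [insertVertex_adj_succAbove] at h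
        obtain ⟨h1, h2⟩ := ih.1 c rfl
        refine ⟨fun b hb => h.reachable.trans (h1 b hb), fun hk => ?_⟩
        obtain ⟨v, hv, hcv⟩ := h2 hk
        exact ⟨v, hv, h.reachable.trans hcv⟩
    · rintro rfl b hb
      rcases eq_or_exists_succAbove x z with rfl | ⟨c, rfl⟩
      · exact absurd h (SimpleGraph.irrefl _)
      · rw [insertVertex_adj_left] at h
        exact ⟨c, h, (ih.1 c rfl).1 b hb⟩

@[simp] theorem reachable_insertVertex_succAbove {a b : Fin n} :
    (insertVertex k G o).Reachable (k.succAbove a) (k.succAbove b) ↔ G.Reachable a b :=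
  ⟨fun h => ((reachable_insertVertex_aux h).1 a rfl).1 b rfl, reachable_insertVertex_of_reachable⟩

@[simp] theorem reachable_insertVertex_left {b : Fin n} :
    (insertVertex k G o).Reachable k (k.succAbove b) ↔ ∃ v, o = some v ∧ G.Reachable v b := by
  constructor
  · exact fun h => (reachable_insertVertex_aux h).2 rfl b rfl
  · rintro ⟨v, rfl, h⟩
    exact (Adj.reachable (insertVertex_adj_left.2 rfl)).trans
      (reachable_insertVertex_of_reachable h)

@[simp] theorem reachable_insertVertex_right {b : Fin n} :
    (insertVertex k G o).Reachable (k.succAbove b) k ↔ ∃ v, o = some v ∧ G.Reachable v b := by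
  rw [SimpleGraph.reachable_comm, reachable_insertVertex_left]

theorem deg_insertVertex_succAbove (a : Fin n) : deg (insertVertex k G o) (k.succAbove a) =
    deg G a + if o = some a then 1 else 0 := by
  have himg : (k.succAbove '' G.neighborSet a).ncard = (G.neighborSet a).ncard :=
    Set.ncard_image_of_injective _ Fin.succAbove_right_injective
  by_cases h : o = some a
  · have : (insertVertex k G o).neighborSet (k.succAbove a) =
        insert k (k.succAbove '' G.neighborSet a) := by
      ext y
      rcases eq_or_exists_succAbove k y with rfl | ⟨b, rfl⟩
      · simp [h]
      · simp [Fin.succAbove_ne, Fin.succAbove_right_injective.eq_iff]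
    rw [deg, this, Set.ncard_insert_of_notMem _ (Set.toFinite _), himg, if_pos h]
    · rfl
    · rintro ⟨b, -, hb⟩
      exact Fin.succAbove_ne _ _ hb
  · have : (insertVertex k G o).neighborSet (k.succAbove a) = k.succAbove '' G.neighborSet a := by
      ext y
      rcases eq_or_exists_succAbove k y with rfl | ⟨b, rfl⟩
      · simp [h, Fin.succAbove_ne]
      · simp [Fin.succAbove_right_injective.eq_iff]
    rw [deg, this, himg, if_neg h]
    rfl

theorem deg_insertVertex_none : deg (insertVertex k G none) k = 0 := by
  rw [deg_eq_zero]
  intro y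
  rcases eq_or_exists_succAbove k y with rfl | ⟨b, rfl⟩ <;> simp

theorem deg_insertVertex_some (v : Fin n) : deg (insertVertex k G (some v)) k = 1 := by
  rw [deg, Set.ncard_eq_one]
  refine ⟨k.succAbove v, ?_⟩
  ext y
  rcases eq_or_exists_succAbove k y with rfl | ⟨b, rfl⟩
  · simp [(Fin.succAbove_ne _ _).symm]
  · simp [Fin.succAbove_right_injective.eq_iff, eq_comm]

theorem isEndpoint_insertVertex_self : IsEndpoint (insertVertex k G o) k := by
  cases o with
  | none => exact deg_insertVertex_none.le.trans zero_le_one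
  | some v => exact (deg_insertVertex_some v).le

theorem isEndpoint_insertVertex_succAbove {a : Fin n} :
    IsEndpoint (insertVertex k G o) (k.succAbove a) ↔
      IsEndpoint G a ∧ (o = some a → deg G a = 0) := by
  rw [IsEndpoint, deg_insertVertex_succAbove, IsEndpoint]
  split_ifs with h
  · simp only [h, forall_const]; omega
  · simp [h]

theorem deleteEdges_insertVertex (a b : Fin n) :
    (insertVertex k G o).deleteEdges {s(k.succAbove a, k.succAbove b)} =
      insertVertex k (G.deleteEdges {s(a, b)}) o := by
  ext x y
  rcases eq_or_exists_succAbove k x with rfl | ⟨c, rfl⟩ <;>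
    rcases eq_or_exists_succAbove k y with rfl | ⟨d, rfl⟩
  · simp
  · simp [deleteEdges_adj, (Fin.succAbove_ne _ _).symm]
  · simp [deleteEdges_adj, (Fin.succAbove_ne _ _).symm]
  · simp [deleteEdges_adj, Fin.succAbove_right_injective.eq_iff]

theorem isAcyclic_insertVertex (h : G.IsAcyclic) : (insertVertex k G o).IsAcyclic := by
  have hleaf : ∀ v, o = some v → ¬ ((insertVertex k G o).deleteEdges
      {s(k, k.succAbove v)}).Reachable k (k.succAbove v) := by
    rintro v rfl
    have : (insertVertex k G (some v)).deleteEdges {s(k, k.succAbove v)} =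
        insertVertex k G none := by
      ext x y
      rcases eq_or_exists_succAbove k x with rfl | ⟨c, rfl⟩ <;>
        rcases eq_or_exists_succAbove k y with rfl | ⟨d, rfl⟩
      · simp
      · simp [deleteEdges_adj, Fin.succAbove_right_injective.eq_iff, eq_comm]
      · simp [deleteEdges_adj, Fin.succAbove_right_injective.eq_iff, eq_comm]
      · simp [deleteEdges_adj, Fin.succAbove_ne]
    rw [this]
    simp
  rw [isAcyclic_iff_forall_adj_isBridge]
  intro x y hxy
  rcases eq_or_exists_succAbove k x with rfl | ⟨c, rfl⟩ <;>
    rcases eq_or_exists_succAbove k y with rfl | ⟨d, rfl⟩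
  · exact absurd hxy (SimpleGraph.irrefl _)
  · rw [isBridge_iff]
    exact hleaf d (insertVertex_adj_left.1 hxy)
  · rw [Sym2.eq_swap, isBridge_iff]
    exact hleaf c (insertVertex_adj_right.1 hxy)
  · rw [insertVertex_adj_succAbove] at hxy
    have := isAcyclic_iff_forall_adj_isBridge.1 h hxy
    rw [isBridge_iff] at this ⊢
    rw [deleteEdges_insertVertex, reachable_insertVertex_succAbove]
    exact this

end

end NCPath

namespace NCPath

open SimpleGraph

/-! ### Structure of ordered partitions -/

section

variable {n : ℕ} {G : SimpleGraph (Fin n)}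

theorem NC.between_of_walk (hG : NC G) {u w x y : Fin n} (huw : G.Adj u w) (q : G.Walk x y)
    (hu : u ∉ q.support) (hw : w ∉ q.support) (h1 : u < x) (h2 : x < w) : u < y ∧ y < w := by
  by_contra hy
  obtain ⟨d, hd, hd1, hd2⟩ := q.exists_boundary_dart {z | u < z ∧ z < w} ⟨h1, h2⟩ hy
  have hne : d.snd ≠ u := fun h => hu (h ▸ q.dart_snd_mem_support_of_mem_darts hd)
  have hne' : d.snd ≠ w := fun h => hw (h ▸ q.dart_snd_mem_support_of_mem_darts hd)
  have hadj := d.adj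
  obtain ⟨h3, h4⟩ : u < d.fst ∧ d.fst < w := hd1
  have h5 : ¬ (u < d.snd ∧ d.snd < w) := hd2
  rcases lt_or_gt_of_ne hne with h | h
  · exact hG _ _ _ _ h h3 h4 hadj.symm huw
  · have h6 : w < d.snd := by
      rcases lt_or_gt_of_ne hne' with h' | h'
      · exact absurd ⟨h, h'⟩ h5
      · exact h'
    exact hG _ _ _ _ h3 h4 h6 huw hadj

theorem NC.between_of_reachable (hG : NC G) {u w x y : Fin n} (huw : G.Adj u w)
    (hxy : G.Reachable x y) (hux : ¬ G.Reachable u x) (h1 : u < x) (h2 : x < w) :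
    u < y ∧ y < w := by
  classical
  obtain ⟨q⟩ := hxy
  have key : ∀ z ∈ q.support, ¬ G.Reachable u z := fun z hz h =>
    hux (h.trans (q.takeUntil z hz).reachable.symm)
  exact hG.between_of_walk huw q (fun h => key u h (Reachable.refl _))
    (fun h => key w h huw.reachable) h1 h2

/-- The components of a graph without interleaved edges do not interleave. -/
theorem NC.reachable_of_interleaved (hG : NC G) {a b c d : Fin n} (hab : a < b) (hbc : b < c)
    (hcd : c < d) (hac : G.Reachable a c) (hbd : G.Reachable b d) : G.Reachable a b := by
  classical
  by_contra hn
  obtain ⟨q⟩ := hac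
  obtain ⟨e, he, he1, he2⟩ := q.exists_boundary_dart {z | ¬ (b < z ∧ z < d)}
    (fun h => absurd h.1 (not_lt.2 hab.le)) (fun h => h ⟨hbc, hcd⟩)
  have hau : G.Reachable a e.fst := (q.takeUntil _ (q.dart_fst_mem_support_of_mem_darts he)).reachable
  have hw : b < e.snd ∧ e.snd < d := not_not.1 he2
  have hu : ¬ (b < e.fst ∧ e.fst < d) := he1
  have hub : e.fst ≠ b := fun h => hn (h ▸ hau)
  have hud : e.fst ≠ d := fun h => hn ((h ▸ hau).trans hbd.symm)
  have hadj := e.adj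
  have hnb : ¬ G.Reachable e.fst b := fun h => hn (hau.trans h)
  rcases lt_or_gt_of_ne hub with h | h
  · have := hG.between_of_reachable hadj hbd hnb h hw.1
    omega
  · have h' : d < e.fst := by omega
    have := hG.between_of_reachable hadj.symm hbd.symm
      (fun h => hnb ((hadj.reachable.trans h).trans hbd.symm)) hw.2 h'
    omega

/-- A leaf and its neighbour do not separate the other vertices of a path. -/
theorem Ord.not_separated (hG : Ord G) {t z x y : Fin n} (ht : IsEndpoint G t) (htz : G.Adj t z)
    (hx : G.Reachable t x) (hy : G.Reachable t y) (hyt : y ≠ t) (hyz : y ≠ z)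
    (hx1 : min t z < x) (hx2 : x < max t z) : min t z < y ∧ y < max t z := by
  have hxt : x ≠ t := by rintro rfl; simp at hx1 hx2; omega
  have hxz : x ≠ z := by rintro rfl; simp at hx1 hx2; omega
  obtain ⟨q, hq⟩ := (hx.symm.trans hy).exists_isPath
  have htq : t ∉ q.support := by
    intro h
    obtain ⟨i, hi, hil⟩ := Walk.mem_support_iff_exists_getVert.1 h
    have h0 : 0 < i := by
      rw [Nat.pos_iff_ne_zero]; rintro rfl; exact hxt (by simpa using hi)
    have hl : i < q.length := by
      refine lt_of_le_of_ne hil ?_; rintro rfl; exact hyt (by simpa using hi)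
    have := two_le_deg_interior hq h0 hl
    rw [hi] at this
    rw [IsEndpoint] at ht
    omega
  have hzq : z ∉ q.support := by
    intro h
    obtain ⟨i, hi, hil⟩ := Walk.mem_support_iff_exists_getVert.1 h
    have h0 : 0 < i := by
      rw [Nat.pos_iff_ne_zero]; rintro rfl; exact hxz (by simpa using hi)
    have hl : i < q.length := by
      refine lt_of_le_of_ne hil ?_; rintro rfl; exact hyz (by simpa using hi)
    have := mem_edges_of_interior hq hG.deg_le_two h0 hl (y := t) (hi ▸ htz.symm)
    exact htq (q.snd_mem_support_of_mem_edges this)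
  rcases lt_or_gt_of_ne htz.ne with h | h
  · rw [min_eq_left h.le, max_eq_right h.le] at *
    exact hG.nc.between_of_walk htz q htq hzq hx1 hx2
  · rw [min_eq_right h.le, max_eq_left h.le] at *
    exact hG.nc.between_of_walk htz.symm q hzq htq hx1 hx2

theorem reachable_of_isEndpoint_adj {t z x : Fin n} (ht : IsEndpoint G t) (hz : IsEndpoint G z)
    (htz : G.Adj t z) (hx : G.Reachable t x) : x = t ∨ x = z := by
  obtain ⟨q⟩ := hx
  have : ∀ {a b : Fin n} (q : G.Walk a b), (a = t ∨ a = z) → (b = t ∨ b = z) := by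
    intro a b q
    induction q with
    | nil => exact id
    | cons h _ ih =>
      rintro (rfl | rfl)
      · exact ih (Or.inr (eq_of_deg_le_one ht h htz))
      · exact ih (Or.inl (eq_of_deg_le_one hz h htz.symm))
  exact this q (Or.inl rfl)

theorem eq_of_reachable_of_deg_eq_zero {V : Type*} [Finite V] {G : SimpleGraph V} {t x : V}
    (ht : deg G t = 0) (hx : G.Reachable t x) : x = t := by
  obtain ⟨q⟩ := hx
  cases q with
  | nil => rfl
  | cons h _ => exact absurd h (deg_eq_zero.1 ht _)

/-! ### Insertions preserve ordered partitions -/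

/-- The gap before vertex `g` is not inside the interval between the endpoints of a path. -/
def FreeGap (G : SimpleGraph (Fin n)) (g : ℕ) : Prop :=
  ∀ i j : Fin n, IsEndpoint G i → IsEndpoint G j → G.Reachable i j → i.val < g → ¬ g ≤ j.val

theorem succAbove_lt_succAbove {k : Fin (n + 1)} {a b : Fin n} :
    k.succAbove a < k.succAbove b ↔ a < b := (Fin.strictMono_succAbove k).lt_iff_lt

theorem Ord.insert_none (hG : Ord G) {k : Fin (n + 1)} (hk : FreeGap G k.val) :
    Ord (insertVertex k G none) where
  nc := by
    intro a b c d hab hbc hcd hac hbd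
    rcases eq_or_exists_succAbove k a with rfl | ⟨a, rfl⟩ <;>
    rcases eq_or_exists_succAbove k b with rfl | ⟨b, rfl⟩ <;>
    rcases eq_or_exists_succAbove k c with rfl | ⟨c, rfl⟩ <;>
    rcases eq_or_exists_succAbove k d with rfl | ⟨d, rfl⟩ <;> try simp at hac hbd
    rw [succAbove_lt_succAbove] at hab hbc hcd
    exact hG.nc a b c d hab hbc hcd hac hbd
  acyclic := isAcyclic_insertVertex hG.acyclic
  deg_le_two v := by
    rcases eq_or_exists_succAbove k v with rfl | ⟨a, rfl⟩
    · rw [deg_insertVertex_none]; omega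
    · rw [deg_insertVertex_succAbove]; simpa using hG.deg_le_two a
  ordered := by
    intro i j m hij hi hj hr him hmj hm
    rcases eq_or_exists_succAbove k i with rfl | ⟨a, rfl⟩
    · rcases eq_or_exists_succAbove k j with rfl | ⟨b, rfl⟩
      · omega
      · simp at hr
    rcases eq_or_exists_succAbove k j with rfl | ⟨b, rfl⟩
    · simp at hr
    rw [isEndpoint_insertVertex_succAbove] at hi hj
    rw [reachable_insertVertex_succAbove] at hr
    rcases eq_or_exists_succAbove k m with rfl | ⟨c, rfl⟩
    · rw [Fin.lt_def, val_succAbove] at him hmj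
      refine hk a b hi.1 hj.1 hr ?_ ?_
      · split_ifs at him <;> omega
      · split_ifs at hmj <;> omega
    · rw [isEndpoint_insertVertex_succAbove] at hm
      rw [succAbove_lt_succAbove] at him hmj
      exact hG.ordered a b c (him.trans hmj) hi.1 hj.1 hr him hmj hm.1

theorem Ord.insert_some (hG : Ord G) {k : Fin (n + 1)} {v : Fin n} (hv : IsEndpoint G v)
    (hk : k.val = v.val ∨ k.val = v.val + 1) : Ord (insertVertex k G (some v)) where
  nc := by
    have hadj : ∀ x b, (insertVertex k G (some v)).Adj k x → ¬ (k < b ∧ b < x) ∧ ¬ (x < b ∧ b < k) := by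
      intro x b hx
      rcases eq_or_exists_succAbove k x with rfl | ⟨x, rfl⟩
      · simp at hx
      rw [insertVertex_adj_left, Option.some.injEq] at hx
      subst hx
      rw [Fin.lt_def, Fin.lt_def, Fin.lt_def, Fin.lt_def, val_succAbove]
      split_ifs <;> omega
    intro a b c d hab hbc hcd hac hbd
    rcases eq_or_exists_succAbove k a with rfl | ⟨a, rfl⟩
    · exact (hadj _ b hac).1 ⟨hab, hbc⟩
    rcases eq_or_exists_succAbove k c with rfl | ⟨c, rfl⟩
    · exact (hadj _ b hac.symm).2 ⟨hab, hbc⟩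
    rcases eq_or_exists_succAbove k b with rfl | ⟨b, rfl⟩
    · exact (hadj _ _ hbd).1 ⟨hbc, hcd⟩
    rcases eq_or_exists_succAbove k d with rfl | ⟨d, rfl⟩
    · exact (hadj _ _ hbd.symm).2 ⟨hbc, hcd⟩
    rw [succAbove_lt_succAbove] at hab hbc hcd
    rw [insertVertex_adj_succAbove] at hac hbd
    exact hG.nc a b c d hab hbc hcd hac hbd
  acyclic := isAcyclic_insertVertex hG.acyclic
  deg_le_two x := by
    rcases eq_or_exists_succAbove k x with rfl | ⟨a, rfl⟩
    · rw [deg_insertVertex_some]; omega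
    · rw [deg_insertVertex_succAbove]
      split_ifs with h
      · rw [Option.some.injEq] at h
        subst h
        rw [IsEndpoint] at hv
        omega
      · exact hG.deg_le_two a
  ordered := by
    have hsingle : ∀ a b, IsEndpoint (insertVertex k G (some v)) (k.succAbove a) →
        G.Reachable a b → v = a → b = v := by
      rintro a b ha hr rfl
      rw [isEndpoint_insertVertex_succAbove] at ha
      exact eq_of_reachable_of_deg_eq_zero (ha.2 rfl) hr
    have hval : ∀ a, ((k.succAbove a).val = a.val ∧ a.val < k.val) ∨
        ((k.succAbove a).val = a.val + 1 ∧ k.val ≤ a.val) := by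
      intro a
      rw [val_succAbove]
      split_ifs <;> omega
    intro i j m hij hi hj hr him hmj hm
    rw [Fin.lt_def] at him hmj
    rcases eq_or_exists_succAbove k i with rfl | ⟨a, rfl⟩
    · rcases eq_or_exists_succAbove k j with rfl | ⟨b, rfl⟩
      · omega
      rcases eq_or_exists_succAbove k m with rfl | ⟨c, rfl⟩
      · omega
      simp only [reachable_insertVertex_left, Option.some.injEq, exists_eq_left'] at hr
      have hj' := (isEndpoint_insertVertex_succAbove.1 hj).1
      have hm' := (isEndpoint_insertVertex_succAbove.1 hm).1
      have h1 := hval b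
      have h2 := hval c
      by_cases hcv : v = c
      · have := hsingle c b hm (hcv ▸ hr) hcv
        rw [this, ← hcv] at hmj
        omega
      · rw [Fin.ext_iff] at hcv
        exact hG.ordered v b c (by omega) hv hj' hr (by omega) (by omega) hm'
    · have hi' := (isEndpoint_insertVertex_succAbove.1 hi).1
      rcases eq_or_exists_succAbove k j with rfl | ⟨b, rfl⟩
      · rcases eq_or_exists_succAbove k m with rfl | ⟨c, rfl⟩
        · omega
        simp only [reachable_insertVertex_right, Option.some.injEq, exists_eq_left'] at hr
        have hm' := (isEndpoint_insertVertex_succAbove.1 hm).1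
        have h1 := hval a
        have h2 := hval c
        by_cases hcv : v = c
        · have := hsingle c a hm (hcv ▸ hr) hcv
          rw [this, ← hcv] at him
          omega
        · rw [Fin.ext_iff] at hcv
          exact hG.ordered a v c (by omega) hi' hv hr.symm (by omega) (by omega) hm'
      · have hj' := (isEndpoint_insertVertex_succAbove.1 hj).1
        rw [reachable_insertVertex_succAbove] at hr
        have h1 := hval a
        have h2 := hval b
        rcases eq_or_exists_succAbove k m with rfl | ⟨c, rfl⟩
        · by_cases hav : v = a
          · have := hsingle a b hi hr hav
            rw [this, hav] at hij
            exact absurd hij (lt_irrefl _)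
          by_cases hbv : v = b
          · have := hsingle b a hj hr.symm hbv
            rw [this, hbv] at hij
            exact absurd hij (lt_irrefl _)
          rw [Fin.ext_iff] at hav hbv
          exact hG.ordered a b v (by omega) hi' hj' hr (by omega) (by omega) hv
        · have hm' := (isEndpoint_insertVertex_succAbove.1 hm).1
          have h3 := hval c
          exact hG.ordered a b c (by omega) hi' hj' hr (by omega) (by omega) hm'

theorem Ord.of_insert_none {k : Fin (n + 1)} (hG : Ord (insertVertex k G none)) :
    Ord G ∧ FreeGap G k.val := by
  have hend : ∀ a, IsEndpoint G a → IsEndpoint (insertVertex k G none) (k.succAbove a) := by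
    intro a ha
    rw [isEndpoint_insertVertex_succAbove]
    simpa using ha
  refine ⟨⟨?_, ?_, ?_, ?_⟩, ?_⟩
  · intro a b c d hab hbc hcd hac hbd
    exact hG.nc (k.succAbove a) (k.succAbove b) (k.succAbove c) (k.succAbove d)
      (succAbove_lt_succAbove.2 hab) (succAbove_lt_succAbove.2 hbc) (succAbove_lt_succAbove.2 hcd)
      (insertVertex_adj_succAbove.2 hac) (insertVertex_adj_succAbove.2 hbd)
  · rw [← comap_insertVertex (k := k) (G := G) (o := none)]
    exact hG.acyclic.of_comap k.succAboveEmb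
  · intro a
    have := hG.deg_le_two (k.succAbove a)
    rw [deg_insertVertex_succAbove] at this
    omega
  · intro i j m hij hi hj hr him hmj hm
    exact hG.ordered _ _ _ (succAbove_lt_succAbove.2 hij) (hend i hi) (hend j hj)
      (reachable_insertVertex_succAbove.2 hr) (succAbove_lt_succAbove.2 him)
      (succAbove_lt_succAbove.2 hmj) (hend m hm)
  · intro i j hi hj hr hik hkj
    refine hG.ordered (k.succAbove i) (k.succAbove j) k (succAbove_lt_succAbove.2 (by omega))
      (hend i hi) (hend j hj) (reachable_insertVertex_succAbove.2 hr) ?_ ?_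
      isEndpoint_insertVertex_self
    · rw [Fin.lt_def, val_succAbove, if_pos hik]; exact hik
    · rw [Fin.lt_def, val_succAbove, if_neg (by omega)]; omega

theorem Ord.of_insert_some {k : Fin (n + 1)} {v : Fin n} (hG : Ord (insertVertex k G (some v)))
    (hk : k.val = v.val ∨ k.val = v.val + 1) : Ord G ∧ IsEndpoint G v := by
  have hv : IsEndpoint G v := by
    have := hG.deg_le_two (k.succAbove v)
    rw [deg_insertVertex_succAbove, if_pos rfl] at this
    rw [IsEndpoint]
    omega
  have hend : ∀ a, IsEndpoint G a → v ≠ a →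
      IsEndpoint (insertVertex k G (some v)) (k.succAbove a) := by
    intro a ha hne
    rw [isEndpoint_insertVertex_succAbove]
    exact ⟨ha, fun h => absurd (Option.some.inj h) hne⟩
  refine ⟨⟨?_, ?_, ?_, ?_⟩, hv⟩
  · intro a b c d hab hbc hcd hac hbd
    exact hG.nc (k.succAbove a) (k.succAbove b) (k.succAbove c) (k.succAbove d)
      (succAbove_lt_succAbove.2 hab) (succAbove_lt_succAbove.2 hbc) (succAbove_lt_succAbove.2 hcd)
      (insertVertex_adj_succAbove.2 hac) (insertVertex_adj_succAbove.2 hbd)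
  · rw [← comap_insertVertex (k := k) (G := G) (o := some v)]
    exact hG.acyclic.of_comap k.succAboveEmb
  · intro a
    have := hG.deg_le_two (k.succAbove a)
    rw [deg_insertVertex_succAbove] at this
    omega
  · -- replace `v` by the new leaf wherever it occurs
    have hrep : ∀ a, IsEndpoint G a → ∃ x, IsEndpoint (insertVertex k G (some v)) x ∧
        (insertVertex k G (some v)).Reachable x (k.succAbove a) ∧
        (∀ b, a < b → ∀ y, (y = k.succAbove b ∨ (y = k ∧ b = v)) → x < y) ∧
        (∀ b, b < a → ∀ y, (y = k.succAbove b ∨ (y = k ∧ b = v)) → y < x) ∧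
        (x = k.succAbove a ∨ (x = k ∧ a = v)) := by
      intro a ha
      by_cases hav : v = a
      · subst hav
        refine ⟨k, isEndpoint_insertVertex_self, by simp, ?_, ?_, Or.inr ⟨rfl, rfl⟩⟩
        · rintro b hb y (rfl | ⟨rfl, rfl⟩)
          · rw [Fin.lt_def, val_succAbove]; split_ifs <;> omega
          · omega
        · rintro b hb y (rfl | ⟨rfl, rfl⟩)
          · rw [Fin.lt_def, val_succAbove]; split_ifs <;> omega
          · omega
      · refine ⟨k.succAbove a, hend a ha hav, Reachable.refl _, ?_, ?_, Or.inl rfl⟩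
        · rintro b hb y (rfl | ⟨rfl, rfl⟩)
          · exact succAbove_lt_succAbove.2 hb
          · rw [Fin.lt_def, val_succAbove]; split_ifs <;> omega
        · rintro b hb y (rfl | ⟨rfl, rfl⟩)
          · exact succAbove_lt_succAbove.2 hb
          · rw [Fin.lt_def, val_succAbove]; split_ifs <;> omega
    intro i j m hij hi hj hr him hmj hm
    obtain ⟨x, hx1, hx2, hx3, -, -⟩ := hrep i hi
    obtain ⟨y, hy1, hy2, -, hy4, -⟩ := hrep j hj
    obtain ⟨z, hz1, hz2, -, -, hz5⟩ := hrep m hm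
    exact hG.ordered x y z ((hx3 m him z hz5).trans (hy4 m hmj z hz5)) hx1 hy1
      ((hx2.trans (reachable_insertVertex_succAbove.2 hr)).trans hy2.symm) (hx3 m him z hz5)
      (hy4 m hmj z hz5) hz1

end

end NCPath

namespace NCPath

open SimpleGraph

/-! ### The last component -/

section

variable {n : ℕ} {G : SimpleGraph (Fin n)}

/-- The component whose smallest vertex `l` is as large as possible has the endpoints `i ≤ j`. -/
structure Tip (G : SimpleGraph (Fin n)) (l i j : Fin n) : Prop where
  opener : ∀ u, G.Reachable l u → l ≤ u
  late : ∀ v, l < v → ∃ u, u < v ∧ G.Reachable u v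
  reach_left : G.Reachable l i
  reach_right : G.Reachable l j
  le : i ≤ j
  end_left : IsEndpoint G i
  end_right : IsEndpoint G j
  only : ∀ u, G.Reachable l u → IsEndpoint G u → u = i ∨ u = j
  single : i = j → ∀ u, G.Reachable l u → u = i

theorem Ord.exists_tip (hG : Ord G) (hn : 0 < n) : ∃ l i j, Tip G l i j := by
  classical
  let S : Finset (Fin n) := Finset.univ.filter fun l => ∀ u, G.Reachable l u → l ≤ u
  have hS : S.Nonempty := ⟨⟨0, hn⟩, by
    simp only [S, Finset.mem_filter, Finset.mem_univ, true_and]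
    intro u _
    exact Fin.le_def.2 (Nat.zero_le _)⟩
  have hmem := S.max'_mem hS
  have hlate : ∀ v, S.max' hS < v → ∃ u, u < v ∧ G.Reachable u v := by
    intro v hv
    by_contra hcon
    push Not at hcon
    have : v ∈ S := by
      simp only [S, Finset.mem_filter, Finset.mem_univ, true_and]
      intro u hu
      by_contra h
      exact hcon u (not_le.1 h) hu.symm
    exact absurd (S.le_max' v this) (not_le.2 hv)
  have hop : ∀ u, G.Reachable (S.max' hS) u → S.max' hS ≤ u := by
    simpa only [S, Finset.mem_filter, Finset.mem_univ, true_and] using hmem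
  obtain ⟨a, b, ha, hb, ha', hb', honly, hsingle⟩ :=
    exists_endpoints hG.acyclic hG.deg_le_two (S.max' hS)
  rcases le_total a b with hab | hab
  · exact ⟨_, a, b, hop, hlate, ha, hb, hab, ha', hb', honly, hsingle⟩
  · exact ⟨_, b, a, hop, hlate, hb, ha, hab, hb', ha', fun u h h' => (honly u h h').symm,
      fun h u hu => (hsingle h.symm u hu).trans h.symm⟩

theorem Tip.unique {l i j l' i' j' : Fin n} (h : Tip G l i j) (h' : Tip G l' i' j') :
    l = l' ∧ i = i' ∧ j = j' := by
  have hl : l = l' := by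
    rcases lt_trichotomy l l' with hlt | heq | hlt
    · obtain ⟨u, hu, hr⟩ := h.late l' hlt
      exact absurd (h'.opener u hr.symm) (not_le.2 hu)
    · exact heq
    · obtain ⟨u, hu, hr⟩ := h'.late l hlt
      exact absurd (h.opener u hr.symm) (not_le.2 hu)
  subst hl
  have h1 := h.only i' h'.reach_left h'.end_left
  have h2 := h.only j' h'.reach_right h'.end_right
  have h3 := h'.only i h.reach_left h.end_left
  have h4 := h'.only j h.reach_right h.end_right
  have h5 := h.le
  have h6 := h'.le
  refine ⟨rfl, ?_, ?_⟩ <;> omega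

theorem Tip.le_left {l i j : Fin n} (h : Tip G l i j) : l ≤ i := h.opener i h.reach_left

theorem Tip.lt_of_lt {l i j : Fin n} (h : Tip G l i j) (hli : l < i) : i < j := by
  refine lt_of_le_of_ne h.le fun hij => ?_
  have := h.single hij l (Reachable.refl _)
  omega

theorem Tip.interval (hG : Ord G) {l i j : Fin n} (h : Tip G l i j) {u x : Fin n}
    (hu : G.Reachable l u) (hlx : l ≤ x) (hxu : x ≤ u) : G.Reachable l x := by
  classical
  by_contra hn
  have hlx' : l < x := lt_of_le_of_ne hlx (fun e => hn (e ▸ Reachable.refl _))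
  have hxu' : x < u := lt_of_le_of_ne hxu (fun e => hn (e ▸ hu))
  -- the smallest vertex of the component of `x`
  let S : Finset (Fin n) := Finset.univ.filter fun y => G.Reachable y x
  have hS : S.Nonempty := ⟨x, by simp [S]⟩
  have hm := S.min'_mem hS
  simp only [S, Finset.mem_filter, Finset.mem_univ, true_and] at hm
  have hmin : ∀ y, G.Reachable y x → S.min' hS ≤ y := fun y hy =>
    S.min'_le y (by simp only [S, Finset.mem_filter, Finset.mem_univ, true_and]; exact hy)
  have hle : S.min' hS ≤ l := by
    by_contra hlt
    obtain ⟨y, hy, hr⟩ := h.late _ (not_le.1 hlt)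
    exact absurd (hmin y (hr.trans hm)) (not_le.2 hy)
  have hne : S.min' hS ≠ l := fun e => hn (e ▸ hm)
  exact hn ((hG.nc.reachable_of_interleaved (lt_of_le_of_ne hle hne) hlx' hxu' hm hu).symm.trans hm)

/-! ### Sites -/

/-- All components have a vertex before the gap `g`. -/
def LateGap (G : SimpleGraph (Fin n)) (g : ℕ) : Prop :=
  ∀ v : Fin n, g ≤ v.val → ∃ u, u < v ∧ G.Reachable u v

open Classical in
/-- The gaps at which a new last component can be started. -/
noncomputable def sites (G : SimpleGraph (Fin n)) : Finset ℕ :=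
  (Finset.range (n + 1)).filter fun g => LateGap G g ∧ FreeGap G g

theorem mem_sites {g : ℕ} : g ∈ sites G ↔ g ≤ n ∧ LateGap G g ∧ FreeGap G g := by
  simp [sites]

/-- The gap `g` is not inside the interval of a path other than the last one. -/
def OtherFree (G : SimpleGraph (Fin n)) (l : Fin n) (g : ℕ) : Prop :=
  ∀ a b : Fin n, IsEndpoint G a → IsEndpoint G b → G.Reachable a b → ¬ G.Reachable l a →
    a.val < g → ¬ g ≤ b.val

theorem Tip.lateGap_iff {l i j : Fin n} (h : Tip G l i j) {g : ℕ} : LateGap G g ↔ l.val < g := by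
  constructor
  · intro hg
    by_contra hlt
    obtain ⟨u, hu, hr⟩ := hg l (not_lt.1 hlt)
    exact absurd (h.opener u hr.symm) (not_le.2 hu)
  · intro hg v hv
    exact h.late v (Fin.lt_def.2 (hg.trans_le hv))

theorem Tip.freeGap_iff {l i j : Fin n} (h : Tip G l i j) {g : ℕ} :
    FreeGap G g ↔ ¬ (i.val < g ∧ g ≤ j.val) ∧ OtherFree G l g := by
  constructor
  · intro hg
    exact ⟨fun h' => hg i j h.end_left h.end_right (h.reach_left.symm.trans h.reach_right) h'.1 h'.2,
      fun a b ha hb hr _ => hg a b ha hb hr⟩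
  · rintro ⟨h1, h2⟩ a b ha hb hr hag hgb
    by_cases hla : G.Reachable l a
    · have h3 := h.only a hla ha
      have h4 := h.only b (hla.trans hr) hb
      have h5 := h.le
      rcases h3 with rfl | rfl <;> rcases h4 with rfl | rfl <;> omega
    · exact h2 a b ha hb hr hla hag hgb

theorem Tip.mem_sites_iff {l i j : Fin n} (h : Tip G l i j) {g : ℕ} :
    g ∈ sites G ↔ g ≤ n ∧ l.val < g ∧ ¬ (i.val < g ∧ g ≤ j.val) ∧ OtherFree G l g := by
  rw [mem_sites, h.lateGap_iff, h.freeGap_iff]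

theorem Ord.otherFree_endpoint (hG : Ord G) {l v : Fin n} (hv : IsEndpoint G v)
    (hlv : G.Reachable l v) {g : ℕ} (hg : g = v.val ∨ g = v.val + 1) : OtherFree G l g := by
  intro a b ha hb hr hla hag hgb
  have hav : a ≠ v := fun e => hla (e ▸ hlv)
  have hbv : b ≠ v := fun e => hla ((e ▸ hlv).trans hr.symm)
  exact hG.ordered a b v (by omega) ha hb hr (by omega) (by omega) hv

theorem otherFree_insertVertex {k : Fin (n + 1)} {l v : Fin n} (hlv : G.Reachable l v) {g g' : ℕ}
    (hg : (g' = g ∧ g ≤ k.val) ∨ (g' = g + 1 ∧ k.val ≤ g)) :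
    OtherFree (insertVertex k G (some v)) (k.succAbove l) g' ↔ OtherFree G l g := by
  have hend : ∀ a, ¬ G.Reachable l a →
      (IsEndpoint (insertVertex k G (some v)) (k.succAbove a) ↔ IsEndpoint G a) := by
    intro a ha
    rw [isEndpoint_insertVertex_succAbove]
    refine ⟨And.left, fun h => ⟨h, fun e => ?_⟩⟩
    rw [Option.some.injEq] at e
    exact absurd (e ▸ hlv) ha
  have hlt : ∀ a : Fin n, (k.succAbove a).val < g' ↔ a.val < g := by
    intro a; rw [val_succAbove]; split_ifs <;> omega
  have hle : ∀ a : Fin n, g' ≤ (k.succAbove a).val ↔ g ≤ a.val := by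
    intro a; rw [val_succAbove]; split_ifs <;> omega
  constructor
  · intro h a b ha hb hr hla hag hgb
    have hlb : ¬ G.Reachable l b := fun h' => hla (h'.trans hr.symm)
    exact h (k.succAbove a) (k.succAbove b) ((hend a hla).2 ha) ((hend b hlb).2 hb)
      (reachable_insertVertex_succAbove.2 hr) (by rwa [reachable_insertVertex_succAbove])
      ((hlt a).2 hag) ((hle b).2 hgb)
  · intro h x y hx hy hr hlx hxg hgy
    rcases eq_or_exists_succAbove k x with rfl | ⟨a, rfl⟩
    · refine hlx ?_
      rw [reachable_insertVertex_right]
      exact ⟨v, rfl, hlv.symm⟩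
    rcases eq_or_exists_succAbove k y with rfl | ⟨b, rfl⟩
    · refine hlx (Reachable.trans ?_ hr.symm)
      rw [reachable_insertVertex_right]
      exact ⟨v, rfl, hlv.symm⟩
    rw [reachable_insertVertex_succAbove] at hr hlx
    have hlb : ¬ G.Reachable l b := fun h' => hlx (h'.trans hr.symm)
    exact h a b ((hend a hlx).1 hx) ((hend b hlb).1 hy) hr hlx ((hlt a).1 hxg) ((hle b).1 hgy)

/-! ### The last component after an insertion -/

theorem tip_insert_none {k : Fin (n + 1)} (hk : LateGap G k.val) :
    Tip (insertVertex k G none) k k k := by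
  have hiso : ∀ u, (insertVertex k G none).Reachable k u → u = k := fun u hu =>
    eq_of_reachable_of_deg_eq_zero deg_insertVertex_none hu
  refine ⟨fun u hu => (hiso u hu).ge, ?_, Reachable.refl _, Reachable.refl _, le_rfl,
    isEndpoint_insertVertex_self, isEndpoint_insertVertex_self, fun u hu _ => Or.inl (hiso u hu),
    fun _ => hiso⟩
  intro v hv
  rcases eq_or_exists_succAbove k v with rfl | ⟨a, rfl⟩
  · omega
  have hka : k.val ≤ a.val := by
    rw [Fin.lt_def, val_succAbove] at hv
    split_ifs at hv <;> omega
  obtain ⟨u, hu, hr⟩ := hk a hka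
  exact ⟨k.succAbove u, succAbove_lt_succAbove.2 hu, reachable_insertVertex_succAbove.2 hr⟩

theorem Tip.opener_late_insert {l i j : Fin n} (h : Tip G l i j) {k : Fin (n + 1)} {v : Fin n}
    (hlk : l.val < k.val) (hlv : G.Reachable l v) :
    (∀ u, (insertVertex k G (some v)).Reachable (k.succAbove l) u → k.succAbove l ≤ u) ∧
    (∀ w, k.succAbove l < w → ∃ u, u < w ∧ (insertVertex k G (some v)).Reachable u w) := by
  have hl : k.succAbove l < k := by rw [Fin.lt_def, val_succAbove, if_pos hlk]; exact hlk
  have hlk' : (insertVertex k G (some v)).Reachable (k.succAbove l) k := by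
    rw [reachable_insertVertex_right]; exact ⟨v, rfl, hlv.symm⟩
  constructor
  · intro u hu
    rcases eq_or_exists_succAbove k u with rfl | ⟨a, rfl⟩
    · exact hl.le
    · rw [reachable_insertVertex_succAbove] at hu
      exact (Fin.strictMono_succAbove k).monotone (h.opener a hu)
  · intro w hw
    rcases eq_or_exists_succAbove k w with rfl | ⟨a, rfl⟩
    · exact ⟨_, hl, hlk'⟩
    · rw [succAbove_lt_succAbove] at hw
      obtain ⟨u, hu, hr⟩ := h.late a hw
      exact ⟨_, succAbove_lt_succAbove.2 hu, reachable_insertVertex_succAbove.2 hr⟩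

theorem Tip.insert_right {l i j : Fin n} (h : Tip G l i j) {k : Fin (n + 1)}
    (hk : k.val = j.val + 1 ∨ (k.val = j.val ∧ i < j)) :
    Tip (insertVertex k G (some j)) (k.succAbove l) (k.succAbove i) k := by
  have hli := h.le_left
  have hij := h.le
  obtain ⟨h1, h2⟩ := h.opener_late_insert (k := k) (by omega) h.reach_right
  have hik : k.succAbove i < k := by
    rw [Fin.lt_def, val_succAbove, if_pos (by omega)]; omega
  refine ⟨h1, h2, reachable_insertVertex_succAbove.2 h.reach_left, ?_, hik.le, ?_,
    isEndpoint_insertVertex_self, ?_, fun e => absurd e hik.ne⟩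
  · rw [reachable_insertVertex_right]; exact ⟨j, rfl, h.reach_right.symm⟩
  · rw [isEndpoint_insertVertex_succAbove]
    refine ⟨h.end_left, fun e => ?_⟩
    rw [Option.some.injEq] at e
    rw [deg_eq_zero]
    intro x hx
    have := h.single e.symm x (h.reach_left.trans hx.reachable)
    exact hx.ne' this
  · intro u hu hu'
    rcases eq_or_exists_succAbove k u with rfl | ⟨a, rfl⟩
    · exact Or.inr rfl
    · left
      rw [reachable_insertVertex_succAbove] at hu
      rw [isEndpoint_insertVertex_succAbove] at hu'
      rcases h.only a hu hu'.1 with rfl | rfl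
      · rfl
      · rw [eq_of_reachable_of_deg_eq_zero (hu'.2 rfl) (h.reach_right.symm.trans h.reach_left)]

theorem Tip.insert_left {l i j : Fin n} (h : Tip G l i j) (hij : i < j) {k : Fin (n + 1)}
    (hk : k.val = i.val + 1 ∨ (k.val = i.val ∧ l < i)) :
    Tip (insertVertex k G (some i)) (k.succAbove l) k (k.succAbove j) := by
  have hli := h.le_left
  obtain ⟨h1, h2⟩ := h.opener_late_insert (k := k) (by omega) h.reach_left
  have hkj : k < k.succAbove j := by
    rw [Fin.lt_def, val_succAbove, if_neg (by omega)]; omega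
  refine ⟨h1, h2, ?_, reachable_insertVertex_succAbove.2 h.reach_right, hkj.le,
    isEndpoint_insertVertex_self, ?_, ?_, fun e => absurd e hkj.ne⟩
  · rw [reachable_insertVertex_right]; exact ⟨i, rfl, h.reach_left.symm⟩
  · rw [isEndpoint_insertVertex_succAbove]
    refine ⟨h.end_right, fun e => ?_⟩
    rw [Option.some.injEq] at e
    omega
  · intro u hu hu'
    rcases eq_or_exists_succAbove k u with rfl | ⟨a, rfl⟩
    · exact Or.inl rfl
    · right
      rw [reachable_insertVertex_succAbove] at hu
      rw [isEndpoint_insertVertex_succAbove] at hu'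
      rcases h.only a hu hu'.1 with rfl | rfl
      · rw [eq_of_reachable_of_deg_eq_zero (hu'.2 rfl) (h.reach_left.symm.trans h.reach_right)]
      · rfl

/-! ### Removing a vertex of the last component -/

theorem Tip.adjacent_right (hG : Ord G) {l j z : Fin n} (h : Tip G l l j) (hz : G.Adj j z) :
    z.val = j.val + 1 ∨ j.val = z.val + 1 := by
  by_contra hcon
  have hne := hz.ne
  have hlz := h.reach_right.trans hz.reachable
  have hmin := h.opener z hlz
  have hlj := h.le
  have hlj' : l ≠ j := fun e => hne ((h.single e j h.reach_right).trans (h.single e z hlz).symm)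
  have e1 : (min j z).val = min j.val z.val := Fin.val_strictMono.monotone.map_min
  have e2 : (max j z).val = max j.val z.val := Fin.val_strictMono.monotone.map_max
  obtain ⟨x, hx1, hx2⟩ : ∃ x : Fin n, min j z < x ∧ x < max j z :=
    ⟨⟨(min j z).val + 1, by omega⟩, by simp only [Fin.lt_def]; omega,
      by simp only [Fin.lt_def]; omega⟩
  have hlx : G.Reachable l x := by
    rcases le_total j z with hjz | hjz
    · exact h.interval hG hlz (by omega) (by omega)
    · exact h.interval hG h.reach_right (by omega) (by omega)
  by_cases hlz' : l = z
  · subst hlz'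
    rcases reachable_of_isEndpoint_adj h.end_right h.end_left hz (h.reach_right.symm.trans hlx) with
      rfl | rfl <;> omega
  · have := hG.not_separated h.end_right hz (h.reach_right.symm.trans hlx) h.reach_right.symm hlj'
      hlz' hx1 hx2
    omega

theorem Tip.adjacent_left (hG : Ord G) {l i j z : Fin n} (h : Tip G l i j) (hli : l < i)
    (hz : G.Adj i z) : z.val = i.val + 1 ∨ i.val = z.val + 1 := by
  by_contra hcon
  have hne := hz.ne
  have hlz := h.reach_left.trans hz.reachable
  have hmin := h.opener z hlz
  have hij := h.lt_of_lt hli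
  have e1 : (min i z).val = min i.val z.val := Fin.val_strictMono.monotone.map_min
  have e2 : (max i z).val = max i.val z.val := Fin.val_strictMono.monotone.map_max
  obtain ⟨x, hx1, hx2⟩ : ∃ x : Fin n, min i z < x ∧ x < max i z :=
    ⟨⟨(min i z).val + 1, by omega⟩, by simp only [Fin.lt_def]; omega,
      by simp only [Fin.lt_def]; omega⟩
  have hlx : G.Reachable l x := by
    rcases le_total i z with hiz | hiz
    · exact h.interval hG hlz (by omega) (by omega)
    · exact h.interval hG h.reach_left (by omega) (by omega)
  by_cases hlz' : l = z
  · have := hG.not_separated h.end_left hz (h.reach_left.symm.trans hlx)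
      (h.reach_left.symm.trans h.reach_right) hij.ne' (by omega) hx1 hx2
    omega
  · have := hG.not_separated h.end_left hz (h.reach_left.symm.trans hlx) h.reach_left.symm hli.ne
      hlz' hx1 hx2
    omega

theorem opener_late_of_insert {k : Fin (n + 1)} {l v : Fin n} {i' j' : Fin (n + 1)}
    (h : Tip (insertVertex k G (some v)) (k.succAbove l) i' j') (hlv : G.Reachable l v) :
    (∀ u, G.Reachable l u → l ≤ u) ∧ (∀ w, l < w → ∃ u, u < w ∧ G.Reachable u w) := by
  constructor
  · intro u hu
    exact (Fin.strictMono_succAbove k).le_iff_le.1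
      (h.opener _ (reachable_insertVertex_succAbove.2 hu))
  · intro w hw
    obtain ⟨u, hu, hr⟩ := h.late _ (succAbove_lt_succAbove.2 hw)
    rcases eq_or_exists_succAbove k u with rfl | ⟨a, rfl⟩
    · rw [reachable_insertVertex_left] at hr
      obtain ⟨v', hv', hr⟩ := hr
      rw [Option.some.injEq] at hv'
      subst hv'
      exact ⟨l, hw, hlv.trans hr⟩
    · exact ⟨a, succAbove_lt_succAbove.1 hu, reachable_insertVertex_succAbove.1 hr⟩

theorem isEndpoint_of_insert {k : Fin (n + 1)} {v : Fin n} (hG : Ord (insertVertex k G (some v))) :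
    IsEndpoint G v := by
  have := hG.deg_le_two (k.succAbove v)
  rw [deg_insertVertex_succAbove, if_pos rfl] at this
  rw [IsEndpoint]
  omega

theorem tip_of_insert_right {k : Fin (n + 1)} {l v : Fin n}
    (hG : Ord (insertVertex k G (some v)))
    (h : Tip (insertVertex k G (some v)) (k.succAbove l) (k.succAbove l) k) : Tip G l l v := by
  have hlv : G.Reachable l v := by
    have := h.reach_right
    rw [reachable_insertVertex_right] at this
    obtain ⟨v', hv', hr⟩ := this
    rw [Option.some.injEq] at hv'
    subst hv'
    exact hr.symm
  obtain ⟨h1, h2⟩ := opener_late_of_insert h hlv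
  refine ⟨h1, h2, Reachable.refl _, hlv, h1 v hlv,
    (isEndpoint_insertVertex_succAbove.1 h.end_left).1, isEndpoint_of_insert hG, ?_, ?_⟩
  · intro u hu hu'
    by_cases huv : v = u
    · exact Or.inr huv.symm
    · left
      have : IsEndpoint (insertVertex k G (some v)) (k.succAbove u) := by
        rw [isEndpoint_insertVertex_succAbove]
        exact ⟨hu', fun e => absurd (Option.some.inj e) huv⟩
      rcases h.only _ (reachable_insertVertex_succAbove.2 hu) this with e | e
      · exact Fin.succAbove_right_injective e
      · exact absurd e (Fin.succAbove_ne _ _)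
  · rintro rfl u hu
    exact eq_of_reachable_of_deg_eq_zero
      ((isEndpoint_insertVertex_succAbove.1 h.end_left).2 rfl) hu

theorem tip_of_insert_left {k : Fin (n + 1)} {l j v : Fin n}
    (hG : Ord (insertVertex k G (some v))) (hlk : k.succAbove l < k)
    (hk : k.val = v.val ∨ k.val = v.val + 1)
    (h : Tip (insertVertex k G (some v)) (k.succAbove l) k (k.succAbove j)) :
    Tip G l v j ∧ v < j := by
  have hlv : G.Reachable l v := by
    have := h.reach_left
    rw [reachable_insertVertex_right] at this
    obtain ⟨v', hv', hr⟩ := this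
    rw [Option.some.injEq] at hv'
    subst hv'
    exact hr.symm
  obtain ⟨h1, h2⟩ := opener_late_of_insert h hlv
  have hkj := h.lt_of_lt hlk
  have hlk' : l.val < k.val := by
    rw [Fin.lt_def, val_succAbove] at hlk
    split_ifs at hlk <;> omega
  have hkj' : k.val ≤ j.val := by
    rw [Fin.lt_def, val_succAbove] at hkj
    split_ifs at hkj <;> omega
  have hvj : v < j := by
    refine lt_of_le_of_ne (by omega) fun e => ?_
    subst e
    rcases reachable_of_isEndpoint_adj h.end_left h.end_right (insertVertex_adj_left.2 rfl)
      h.reach_left.symm with e | e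
    · exact Fin.succAbove_ne _ _ e
    · have := Fin.succAbove_right_injective e
      omega
  refine ⟨⟨h1, h2, hlv, reachable_insertVertex_succAbove.1 h.reach_right, hvj.le,
    isEndpoint_of_insert hG, (isEndpoint_insertVertex_succAbove.1 h.end_right).1, ?_,
    fun e => absurd e hvj.ne⟩, hvj⟩
  intro u hu hu'
  by_cases huv : v = u
  · exact Or.inl huv.symm
  · right
    have : IsEndpoint (insertVertex k G (some v)) (k.succAbove u) := by
      rw [isEndpoint_insertVertex_succAbove]
      exact ⟨hu', fun e => absurd (Option.some.inj e) huv⟩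
    rcases h.only _ (reachable_insertVertex_succAbove.2 hu) this with e | e
    · exact absurd e (Fin.succAbove_ne _ _)
    · exact Fin.succAbove_right_injective e

end

end NCPath

namespace NCPath

open SimpleGraph

/-! ### Counting ordered partitions with a generating tree -/

section

variable {n : ℕ} {G : SimpleGraph (Fin n)}

open Classical in
/-- The position of the endpoints of the last component: `0` for a singleton, `1` if the smallest
vertex is an endpoint of a longer path, `2` otherwise. -/
noncomputable def phase (G : SimpleGraph (Fin n)) : ℕ :=
  if ∃ l i j, Tip G l i j ∧ l < i then 2 else if ∃ l i j, Tip G l i j ∧ i < j then 1 else 0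

theorem Tip.phase_eq {l i j : Fin n} (h : Tip G l i j) :
    phase G = if l < i then 2 else if i < j then 1 else 0 := by
  have h1 : (∃ l i j, Tip G l i j ∧ l < i) ↔ l < i := by
    refine ⟨?_, fun h' => ⟨l, i, j, h, h'⟩⟩
    rintro ⟨l', i', j', h', hlt⟩
    obtain ⟨rfl, rfl, rfl⟩ := h.unique h'
    exact hlt
  have h2 : (∃ l i j, Tip G l i j ∧ i < j) ↔ i < j := by
    refine ⟨?_, fun h' => ⟨l, i, j, h, h'⟩⟩
    rintro ⟨l', i', j', h', hlt⟩
    obtain ⟨rfl, rfl, rfl⟩ := h.unique h'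
    exact hlt
  rw [phase]
  simp only [h1, h2]

/-- A leaf attached to `v` can be inserted at position `k`. -/
def ValidLeaf (G : SimpleGraph (Fin n)) (k : Fin (n + 1)) (v : Fin n) : Prop :=
  ∃ l i j, Tip G l i j ∧ ((v = j ∧ l = i ∧ k = j.succ) ∨ (v = j ∧ l = i ∧ i < j ∧ k = j.castSucc) ∨
    (v = i ∧ l < i ∧ k = i.castSucc) ∨ (v = i ∧ i < j ∧ k = i.succ))

/-- The insertion of a vertex that describes a child of `G` in the generating tree. -/
def ValidInsertion (G : SimpleGraph (Fin n)) : Fin (n + 1) × Option (Fin n) → Prop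
  | (k, none) => k.val ∈ sites G
  | (k, some v) => ValidLeaf G k v

/-- `k` is the vertex whose removal yields the parent of `G` in the generating tree. -/
def Removable (G : SimpleGraph (Fin n)) (k : Fin n) : Prop :=
  ∃ l i j, Tip G l i j ∧ ((l < i ∧ k = i) ∨ (l = i ∧ k = j))

theorem Removable.unique {k k' : Fin n} (h : Removable G k) (h' : Removable G k') : k = k' := by
  obtain ⟨l, i, j, ht, h⟩ := h
  obtain ⟨l', i', j', ht', h'⟩ := h'
  obtain ⟨rfl, rfl, rfl⟩ := ht.unique ht'
  rcases h with ⟨h1, rfl⟩ | ⟨h1, rfl⟩ <;> rcases h' with ⟨h2, rfl⟩ | ⟨h2, rfl⟩ <;> first | rfl | omega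

theorem ValidLeaf.ord (hG : Ord G) {k : Fin (n + 1)} {v : Fin n} (h : ValidLeaf G k v) :
    Ord (insertVertex k G (some v)) := by
  obtain ⟨l, i, j, ht, ⟨rfl, -, rfl⟩ | ⟨rfl, -, -, rfl⟩ | ⟨rfl, -, rfl⟩ | ⟨rfl, -, rfl⟩⟩ := h
  · exact hG.insert_some ht.end_right (by simp)
  · exact hG.insert_some ht.end_right (by simp)
  · exact hG.insert_some ht.end_left (by simp)
  · exact hG.insert_some ht.end_left (by simp)

theorem ValidInsertion.ord (hG : Ord G) {x : Fin (n + 1) × Option (Fin n)}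
    (h : ValidInsertion G x) : Ord (insertVertex x.1 G x.2) := by
  rcases x with ⟨k, _ | v⟩
  · exact hG.insert_none (mem_sites.1 h).2.2
  · exact ValidLeaf.ord hG h

theorem ValidInsertion.removable {x : Fin (n + 1) × Option (Fin n)}
    (h : ValidInsertion G x) : Removable (insertVertex x.1 G x.2) x.1 := by
  rcases x with ⟨k, _ | v⟩
  · exact ⟨k, k, k, tip_insert_none (mem_sites.1 h).2.1, Or.inr ⟨rfl, rfl⟩⟩
  · obtain ⟨l, i, j, ht, ⟨rfl, rfl, rfl⟩ | ⟨rfl, rfl, hij, rfl⟩ | ⟨rfl, hli, rfl⟩ | ⟨rfl, hij, rfl⟩⟩ := h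
    · exact ⟨_, _, _, ht.insert_right (Or.inl (by simp)), Or.inr ⟨rfl, rfl⟩⟩
    · exact ⟨_, _, _, ht.insert_right (Or.inr ⟨by simp, hij⟩), Or.inr ⟨rfl, rfl⟩⟩
    · refine ⟨_, _, _, ht.insert_left (ht.lt_of_lt hli) (Or.inr ⟨by simp, hli⟩), Or.inl ⟨?_, rfl⟩⟩
      rw [Fin.lt_def, val_succAbove]
      simp only [Fin.val_castSucc]
      split_ifs <;> omega
    · have := ht.le_left
      refine ⟨_, _, _, ht.insert_left hij (Or.inl (by simp)), Or.inl ⟨?_, rfl⟩⟩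
      rw [Fin.lt_def, val_succAbove]
      simp only [Fin.val_succ]
      split_ifs <;> omega

theorem insertVertex_injOn {G₁ G₂ : SimpleGraph (Fin n)} {x y : Fin (n + 1) × Option (Fin n)}
    (hx : ValidInsertion G₁ x) (hy : ValidInsertion G₂ y)
    (h : insertVertex x.1 G₁ x.2 = insertVertex y.1 G₂ y.2) : G₁ = G₂ ∧ x = y := by
  rcases x with ⟨k, o⟩
  rcases y with ⟨k', o'⟩
  have hk : k = k' := by
    have h1 := hx.removable
    have h2 := hy.removable
    rw [← h] at h2
    exact h1.unique h2
  subst hk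
  have hG : G₁ = G₂ := by
    rw [← comap_insertVertex (k := k) (G := G₁) (o := o), ← comap_insertVertex (k := k) (G := G₂)
      (o := o')]
    exact congrArg _ h
  refine ⟨hG, ?_⟩
  have ho : ∀ b, o = some b ↔ o' = some b := by
    intro b
    rw [← insertVertex_adj_left (k := k) (G := G₁), ← insertVertex_adj_left (k := k) (G := G₂)]
    exact iff_of_eq (congrArg (fun H : SimpleGraph _ => H.Adj k (k.succAbove b)) h)
  rw [Prod.mk.injEq]
  exact ⟨rfl, Option.ext fun b => ho b⟩

theorem exists_validInsertion {G' : SimpleGraph (Fin (n + 1))} (hG' : Ord G') :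
    ∃ (G : SimpleGraph (Fin n)) (x : Fin (n + 1) × Option (Fin n)), Ord G ∧ ValidInsertion G x ∧
      insertVertex x.1 G x.2 = G' := by
  obtain ⟨l, i, j, ht⟩ := hG'.exists_tip (Nat.succ_pos n)
  have hleaf : ∀ k v, IsEndpoint G' k → G'.Adj k (k.succAbove v) →
      G' = insertVertex k (G'.comap k.succAbove) (some v) := by
    intro k v hk hv
    refine eq_insertVertex fun b => ⟨fun hb => ?_, fun hb => ?_⟩
    · rw [Fin.succAbove_right_injective (eq_of_deg_le_one hk hv hb)]
    · rw [Option.some.injEq] at hb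
      rwa [← hb]
  by_cases hij : i = j
  · -- the last component is a singleton
    have hli : l = i := ht.single hij l (Reachable.refl _)
    subst hli hij
    have hnone : G' = insertVertex l (G'.comap l.succAbove) none := by
      refine eq_insertVertex fun b => ⟨fun hb => ?_, fun hb => by simp at hb⟩
      exact absurd (ht.single rfl _ hb.reachable) (Fin.succAbove_ne _ _)
    have hO := hG'
    rw [hnone] at hO
    obtain ⟨h1, h2⟩ := hO.of_insert_none
    refine ⟨_, (l, none), h1, ?_, hnone.symm⟩
    refine mem_sites.2 ⟨Nat.lt_succ_iff.1 l.isLt, ?_, h2⟩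
    intro v hv
    obtain ⟨u, hu, hr⟩ := ht.late (l.succAbove v)
      (by rw [Fin.lt_def, val_succAbove, if_neg (by omega)]; omega)
    rcases eq_or_exists_succAbove l u with rfl | ⟨a, rfl⟩
    · exact absurd (ht.single rfl _ hr) (Fin.succAbove_ne _ _)
    · refine ⟨a, succAbove_lt_succAbove.1 hu, ?_⟩
      rw [hnone, reachable_insertVertex_succAbove] at hr
      exact hr
  · have hij' : i < j := lt_of_le_of_ne ht.le hij
    have hnbr : ∀ k k', k ≠ k' → G'.Reachable k k' → ∃ v, G'.Adj k (k.succAbove v) := by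
      intro k k' hne hr
      obtain ⟨q⟩ := hr
      cases q with
      | nil => exact absurd rfl hne
      | @cons _ z _ h _ =>
        rcases eq_or_exists_succAbove k z with rfl | ⟨v, rfl⟩
        · exact absurd h (SimpleGraph.irrefl _)
        · exact ⟨v, h⟩
    by_cases hli : l < i
    · obtain ⟨v, hv⟩ := hnbr i j hij (ht.reach_left.symm.trans ht.reach_right)
      have hval := ht.adjacent_left hG' hli hv
      have hk : i.val = v.val ∨ i.val = v.val + 1 := by
        rw [val_succAbove] at hval
        split_ifs at hval <;> omega
      have heq := hleaf i v ht.end_left hv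
      obtain ⟨l₀, rfl⟩ := Fin.exists_succAbove_eq hli.ne
      obtain ⟨j₀, rfl⟩ := Fin.exists_succAbove_eq hij'.ne'
      have hO := hG'
      have ht' := ht
      rw [heq] at hO ht'
      obtain ⟨h1, h2⟩ := tip_of_insert_left hO hli hk ht'
      refine ⟨_, (i, some v), (hO.of_insert_some hk).1, ⟨l₀, v, j₀, h1, ?_⟩, heq.symm⟩
      have hlv : l₀.val < i.val := by
        rw [Fin.lt_def, val_succAbove] at hli
        split_ifs at hli <;> omega
      rcases hk with hk | hk
      · exact Or.inr (Or.inr (Or.inl ⟨rfl, by omega, Fin.ext hk⟩))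
      · exact Or.inr (Or.inr (Or.inr ⟨rfl, h2, Fin.ext hk⟩))
    · have hli' : l = i := le_antisymm ht.le_left (not_lt.1 hli)
      subst hli'
      obtain ⟨v, hv⟩ := hnbr j l (Ne.symm hij) ht.reach_right.symm
      have hval := ht.adjacent_right hG' hv
      have hk : j.val = v.val ∨ j.val = v.val + 1 := by
        rw [val_succAbove] at hval
        split_ifs at hval <;> omega
      have heq := hleaf j v ht.end_right hv
      obtain ⟨l₀, rfl⟩ := Fin.exists_succAbove_eq hij
      have hO := hG'
      have ht' := ht
      rw [heq] at hO ht'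
      have h1 := tip_of_insert_right hO ht'
      refine ⟨_, (j, some v), (hO.of_insert_some hk).1, ⟨l₀, l₀, v, h1, ?_⟩, heq.symm⟩
      rcases hk with hk | hk
      · refine Or.inr (Or.inl ⟨rfl, rfl, ?_, Fin.ext hk⟩)
        rw [Fin.lt_def, val_succAbove] at hij'
        split_ifs at hij' <;> omega
      · exact Or.inl ⟨rfl, rfl, Fin.ext hk⟩

/-! ### The state of a child -/

theorem card_sites_insert_none {k : Fin (n + 1)} (hk : k.val ∈ sites G) :
    (sites (insertVertex k G none)).card = ((sites G).filter fun g => k.val ≤ g).card := by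
  have ht := tip_insert_none (mem_sites.1 hk).2.1
  have hfree : ∀ g, k.val ≤ g → (FreeGap (insertVertex k G none) (g + 1) ↔ FreeGap G g) := by
    intro g hg
    constructor
    · intro h i j hi hj hr hig hgj
      refine h (k.succAbove i) (k.succAbove j) ?_ ?_ (reachable_insertVertex_succAbove.2 hr) ?_ ?_
      · rw [isEndpoint_insertVertex_succAbove]; simpa using hi
      · rw [isEndpoint_insertVertex_succAbove]; simpa using hj
      · rw [val_succAbove]; split_ifs <;> omega
      · rw [val_succAbove]; split_ifs <;> omega
    · intro h x y hx hy hr hxg hgy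
      rcases eq_or_exists_succAbove k x with rfl | ⟨a, rfl⟩ <;>
        rcases eq_or_exists_succAbove k y with rfl | ⟨b, rfl⟩
      · omega
      · simp at hr
      · simp at hr
      · rw [reachable_insertVertex_succAbove] at hr
        refine h a b (isEndpoint_insertVertex_succAbove.1 hx).1
          (isEndpoint_insertVertex_succAbove.1 hy).1 hr ?_ ?_
        · rw [val_succAbove] at hxg; split_ifs at hxg <;> omega
        · rw [val_succAbove] at hgy; split_ifs at hgy <;> omega
  have hlate : ∀ g, k.val ≤ g → LateGap G g := fun g hg v hv =>
    (mem_sites.1 hk).2.1 v (hg.trans hv)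
  have : sites (insertVertex k G none) =
      ((sites G).filter fun g => k.val ≤ g).image fun g => g + 1 := by
    ext g
    rw [mem_sites, ht.lateGap_iff, Finset.mem_image]
    constructor
    · rintro ⟨h1, h2, h3⟩
      obtain ⟨g, rfl⟩ : ∃ g₀, g = g₀ + 1 := ⟨g - 1, by omega⟩
      have hkg : k.val ≤ g := by omega
      exact ⟨g, Finset.mem_filter.2 ⟨mem_sites.2 ⟨by omega, hlate g hkg, (hfree g hkg).1 h3⟩, hkg⟩,
        rfl⟩
    · rintro ⟨g, hg, rfl⟩
      rw [Finset.mem_filter, mem_sites] at hg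
      exact ⟨by omega, by omega, (hfree g hg.2).2 hg.1.2.2⟩
  rw [this, Finset.card_image_of_injective _ (fun a b h => by simpa using h)]

theorem phase_insert_none {k : Fin (n + 1)} (hk : k.val ∈ sites G) :
    phase (insertVertex k G none) = 0 := by
  rw [(tip_insert_none (mem_sites.1 hk).2.1).phase_eq]
  simp

theorem shift_injective (i : ℕ) : Function.Injective fun g : ℕ => if g ≤ i then g else g + 1 := by
  intro a b h
  simp only at h
  split_ifs at h <;> omega

section State

variable {l i j : Fin n}

theorem state_right_succ (ht : Tip G i i j) :
    (sites (insertVertex j.succ G (some j))).card = (sites G).card ∧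
      phase (insertVertex j.succ G (some j)) = 1 := by
  have ht' := ht.insert_right (k := j.succ) (Or.inl (by simp))
  have hle := ht.le
  have hi : (j.succ.succAbove i).val = i.val := by
    rw [val_succAbove, if_pos]; simp only [Fin.val_succ]; omega
  constructor
  · have : sites (insertVertex j.succ G (some j)) = (sites G).image fun g => g + 1 := by
      ext g
      rw [ht'.mem_sites_iff, hi, Finset.mem_image]
      simp only [Fin.val_succ]
      constructor
      · rintro ⟨h1, h2, h3, h4⟩
        refine ⟨g - 1, ht.mem_sites_iff.2 ⟨by omega, by omega, by omega, ?_⟩, by omega⟩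
        exact (otherFree_insertVertex ht.reach_right
          (Or.inr ⟨by omega, by simp only [Fin.val_succ]; omega⟩)).1 h4
      · rintro ⟨g, hg, rfl⟩
        obtain ⟨h1, h2, h3, h4⟩ := ht.mem_sites_iff.1 hg
        refine ⟨by omega, by omega, by omega, ?_⟩
        exact (otherFree_insertVertex ht.reach_right
          (Or.inr ⟨rfl, by simp only [Fin.val_succ]; omega⟩)).2 h4
    rw [this, Finset.card_image_of_injective _ (fun a b h => by simpa using h)]
  · rw [ht'.phase_eq, if_neg (lt_irrefl _), if_pos]
    rw [Fin.lt_def, hi, Fin.val_succ]; omega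

theorem state_right_castSucc (hG : Ord G) (ht : Tip G i i j) (hij : i < j) :
    (sites (insertVertex j.castSucc G (some j))).card = (sites G).card + 1 ∧
      phase (insertVertex j.castSucc G (some j)) = 1 := by
  have ht' := ht.insert_right (k := j.castSucc) (Or.inr ⟨by simp, hij⟩)
  have hi : (j.castSucc.succAbove i).val = i.val := by
    rw [val_succAbove, if_pos]; simp only [Fin.val_castSucc]; omega
  constructor
  · have : sites (insertVertex j.castSucc G (some j)) =
        insert (j.val + 1) ((sites G).image fun g => g + 1) := by
      ext g
      rw [ht'.mem_sites_iff, hi, Finset.mem_insert, Finset.mem_image]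
      simp only [Fin.val_castSucc]
      constructor
      · rintro ⟨h1, h2, h3, h4⟩
        by_cases hg : g = j.val + 1
        · exact Or.inl hg
        refine Or.inr ⟨g - 1, ht.mem_sites_iff.2 ⟨by omega, by omega, by omega, ?_⟩, by omega⟩
        exact (otherFree_insertVertex ht.reach_right
          (Or.inr ⟨by omega, by simp only [Fin.val_castSucc]; omega⟩)).1 h4
      · rintro (rfl | ⟨g, hg, rfl⟩)
        · refine ⟨by omega, by omega, by omega, ?_⟩
          exact (otherFree_insertVertex ht.reach_right (g := j.val)
            (Or.inr ⟨rfl, by simp only [Fin.val_castSucc]; omega⟩)).2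
            (hG.otherFree_endpoint ht.end_right ht.reach_right (Or.inl rfl))
        · obtain ⟨h1, h2, h3, h4⟩ := ht.mem_sites_iff.1 hg
          refine ⟨by omega, by omega, by omega, ?_⟩
          exact (otherFree_insertVertex ht.reach_right
            (Or.inr ⟨rfl, by simp only [Fin.val_castSucc]; omega⟩)).2 h4
    rw [this, Finset.card_insert_of_notMem,
      Finset.card_image_of_injective _ (fun a b h => by simpa using h)]
    simp only [Finset.mem_image, Nat.add_right_cancel_iff, exists_eq_right, ht.mem_sites_iff]
    omega
  · rw [ht'.phase_eq, if_neg (lt_irrefl _), if_pos]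
    rw [Fin.lt_def, hi, Fin.val_castSucc]; omega

theorem state_left_castSucc (ht : Tip G l i j) (hli : l < i) :
    (sites (insertVertex i.castSucc G (some i))).card = (sites G).card ∧
      phase (insertVertex i.castSucc G (some i)) = 2 := by
  have hij := ht.lt_of_lt hli
  have ht' := ht.insert_left hij (k := i.castSucc) (Or.inr ⟨by simp, hli⟩)
  have hl : (i.castSucc.succAbove l).val = l.val := by
    rw [val_succAbove, if_pos]; simp only [Fin.val_castSucc]; omega
  have hj : (i.castSucc.succAbove j).val = j.val + 1 := by
    rw [val_succAbove, if_neg]; simp only [Fin.val_castSucc]; omega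
  constructor
  · have : sites (insertVertex i.castSucc G (some i)) =
        (sites G).image fun g => if g ≤ i.val then g else g + 1 := by
      ext g
      rw [ht'.mem_sites_iff, hl, hj, Finset.mem_image]
      simp only [Fin.val_castSucc]
      constructor
      · rintro ⟨h1, h2, h3, h4⟩
        by_cases hg : g ≤ i.val
        · refine ⟨g, ht.mem_sites_iff.2 ⟨by omega, by omega, by omega, ?_⟩, if_pos hg⟩
          exact (otherFree_insertVertex ht.reach_left
            (Or.inl ⟨rfl, by simp only [Fin.val_castSucc]; omega⟩)).1 h4
        · refine ⟨g - 1, ht.mem_sites_iff.2 ⟨by omega, by omega, by omega, ?_⟩, ?_⟩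
          · exact (otherFree_insertVertex ht.reach_left
              (Or.inr ⟨by omega, by simp only [Fin.val_castSucc]; omega⟩)).1 h4
          · rw [if_neg] <;> omega
      · rintro ⟨g, hg, rfl⟩
        obtain ⟨h1, h2, h3, h4⟩ := ht.mem_sites_iff.1 hg
        by_cases hg : g ≤ i.val
        · rw [if_pos hg]
          refine ⟨by omega, by omega, by omega, ?_⟩
          exact (otherFree_insertVertex ht.reach_left
            (Or.inl ⟨rfl, by simp only [Fin.val_castSucc]; omega⟩)).2 h4
        · rw [if_neg hg]
          refine ⟨by omega, by omega, by omega, ?_⟩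
          exact (otherFree_insertVertex ht.reach_left
            (Or.inr ⟨rfl, by simp only [Fin.val_castSucc]; omega⟩)).2 h4
    rw [this, Finset.card_image_of_injective _ (shift_injective _)]
  · rw [ht'.phase_eq, if_pos]
    rw [Fin.lt_def, hl, Fin.val_castSucc]; omega

theorem state_left_succ (hG : Ord G) (ht : Tip G l i j) (hij : i < j) :
    (sites (insertVertex i.succ G (some i))).card = (sites G).card + 1 ∧
      phase (insertVertex i.succ G (some i)) = 2 := by
  have hli := ht.le_left
  have ht' := ht.insert_left hij (k := i.succ) (Or.inl (by simp))
  have hl : (i.succ.succAbove l).val = l.val := by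
    rw [val_succAbove, if_pos]; simp only [Fin.val_succ]; omega
  have hj : (i.succ.succAbove j).val = j.val + 1 := by
    rw [val_succAbove, if_neg]; simp only [Fin.val_succ]; omega
  constructor
  · have : sites (insertVertex i.succ G (some i)) =
        insert (i.val + 1) ((sites G).image fun g => if g ≤ i.val then g else g + 1) := by
      ext g
      rw [ht'.mem_sites_iff, hl, hj, Finset.mem_insert, Finset.mem_image]
      simp only [Fin.val_succ]
      constructor
      · rintro ⟨h1, h2, h3, h4⟩
        by_cases hgi : g = i.val + 1
        · exact Or.inl hgi
        right
        by_cases hg : g ≤ i.val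
        · refine ⟨g, ht.mem_sites_iff.2 ⟨by omega, by omega, by omega, ?_⟩, if_pos hg⟩
          exact (otherFree_insertVertex ht.reach_left
            (Or.inl ⟨rfl, by simp only [Fin.val_succ]; omega⟩)).1 h4
        · refine ⟨g - 1, ht.mem_sites_iff.2 ⟨by omega, by omega, by omega, ?_⟩, ?_⟩
          · exact (otherFree_insertVertex ht.reach_left
              (Or.inr ⟨by omega, by simp only [Fin.val_succ]; omega⟩)).1 h4
          · rw [if_neg] <;> omega
      · rintro (rfl | ⟨g, hg, rfl⟩)
        · refine ⟨by omega, by omega, by omega, ?_⟩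
          exact (otherFree_insertVertex ht.reach_left
            (Or.inl ⟨rfl, by simp only [Fin.val_succ]; omega⟩)).2
            (hG.otherFree_endpoint ht.end_left ht.reach_left (Or.inr rfl))
        obtain ⟨h1, h2, h3, h4⟩ := ht.mem_sites_iff.1 hg
        by_cases hg : g ≤ i.val
        · rw [if_pos hg]
          refine ⟨by omega, by omega, by omega, ?_⟩
          exact (otherFree_insertVertex ht.reach_left
            (Or.inl ⟨rfl, by simp only [Fin.val_succ]; omega⟩)).2 h4
        · rw [if_neg hg]
          refine ⟨by omega, by omega, by omega, ?_⟩
          exact (otherFree_insertVertex ht.reach_left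
            (Or.inr ⟨rfl, by simp only [Fin.val_succ]; omega⟩)).2 h4
    rw [this, Finset.card_insert_of_notMem, Finset.card_image_of_injective _ (shift_injective _)]
    simp only [Finset.mem_image, not_exists, not_and]
    intro g _
    split_ifs <;> omega
  · rw [ht'.phase_eq, if_pos]
    rw [Fin.lt_def, hl, Fin.val_succ]; omega

end State

end

end NCPath

namespace NCPath

open SimpleGraph

section

open Classical in
/-- The ordered partitions of `n` points. -/
noncomputable def ordSet (n : ℕ) : Finset (SimpleGraph (Fin n)) := Finset.univ.filter Ord

theorem mem_ordSet {n : ℕ} {G : SimpleGraph (Fin n)} : G ∈ ordSet n ↔ Ord G := by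
  simp [ordSet]

/-- The sum of `f` over the states of the children of a node in state `(h, ph)`. -/
def nextSum {R : Type*} [AddCommMonoid R] (f : ℕ → ℕ → R) (h ph : ℕ) : R :=
  ∑ r ∈ Finset.Icc 1 h, f r 0 +
    if ph = 0 then f h 1
    else if ph = 1 then f h 1 + (f (h + 1) 1 + f (h + 1) 2)
    else f h 2 + f (h + 1) 2

/-- The number of nodes at depth `m` below a node in state `(h, ph)`. -/
def descendants : ℕ → ℕ → ℕ → ℕ
  | 0, _, _ => 1
  | m + 1, h, ph => nextSum (descendants m) h ph

theorem sum_card_filter_le (F : ℕ → ℕ) (s : Finset ℕ) :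
    ∑ k ∈ s, F (s.filter fun g => k ≤ g).card = ∑ r ∈ Finset.Icc 1 s.card, F r := by
  induction s using Finset.induction_on_min with
  | empty => simp
  | insert a s hlt ih =>
    have ha : a ∉ s := fun h => lt_irrefl _ (hlt a h)
    rw [Finset.sum_insert ha, Finset.card_insert_of_notMem ha,
      Finset.sum_Icc_succ_top (by omega), ← ih, add_comm]
    congr 1
    rotate_left
    · rw [Finset.filter_true_of_mem, Finset.card_insert_of_notMem ha]
      intro x hx
      rcases Finset.mem_insert.1 hx with rfl | hx
      · exact le_rfl
      · exact (hlt x hx).le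
    · refine Finset.sum_congr rfl fun k hk => ?_
      rw [Finset.filter_insert, if_neg (not_le.2 (hlt k hk))]

open Classical in
theorem sum_ordSet_succ {n : ℕ} (f : SimpleGraph (Fin (n + 1)) → ℕ) :
    ∑ G' ∈ ordSet (n + 1), f G' = ∑ G ∈ ordSet n,
      ∑ x ∈ Finset.univ.filter (ValidInsertion G), f (insertVertex x.1 G x.2) := by
  rw [Finset.sum_sigma']
  symm
  refine Finset.sum_bij (fun y _ => insertVertex y.2.1 y.1 y.2.2) ?_ ?_ ?_ ?_
  · rintro ⟨G, x⟩ h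
    simp only [Finset.mem_sigma, Finset.mem_filter, Finset.mem_univ, true_and] at h
    exact mem_ordSet.2 (h.2.ord (mem_ordSet.1 h.1))
  · rintro ⟨G, x⟩ h ⟨G₂, x₂⟩ h₂ heq
    simp only [Finset.mem_sigma, Finset.mem_filter, Finset.mem_univ, true_and] at h h₂
    obtain ⟨rfl, rfl⟩ := insertVertex_injOn h.2 h₂.2 heq
    rfl
  · intro G' hG'
    obtain ⟨G, x, h1, h2, h3⟩ := exists_validInsertion (mem_ordSet.1 hG')
    exact ⟨⟨G, x⟩, by simp [mem_ordSet, h1, h2], h3⟩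
  · intros; rfl

open Classical in
theorem sum_validInsertion {n : ℕ} (G : SimpleGraph (Fin n))
    (g : Fin (n + 1) × Option (Fin n) → ℕ) :
    ∑ x ∈ Finset.univ.filter (ValidInsertion G), g x =
      ∑ k ∈ Finset.univ.filter (fun k : Fin (n + 1) => k.val ∈ sites G), g (k, none) +
      ∑ x ∈ Finset.univ.filter (fun x : Fin (n + 1) × Fin n => ValidLeaf G x.1 x.2),
        g (x.1, some x.2) := by
  rw [Finset.sum_filter, Finset.sum_filter, Finset.sum_filter, Fintype.sum_prod_type,
    Fintype.sum_prod_type, ← Finset.sum_add_distrib]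
  refine Finset.sum_congr rfl fun k _ => ?_
  rw [Fintype.sum_option]
  congr 1
  exact if_congr Iff.rfl rfl rfl

theorem sum_isolated {n : ℕ} (G : SimpleGraph (Fin n)) (f : ℕ → ℕ → ℕ) :
    ∑ k ∈ Finset.univ.filter (fun k : Fin (n + 1) => k.val ∈ sites G),
      f (sites (insertVertex k G none)).card (phase (insertVertex k G none)) =
      ∑ r ∈ Finset.Icc 1 (sites G).card, f r 0 := by
  rw [← sum_card_filter_le (fun r => f r 0)]
  refine Finset.sum_bij (fun k _ => k.val) ?_ ?_ ?_ ?_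
  · intro k hk
    exact (Finset.mem_filter.1 hk).2
  · intro k _ k' _ h
    exact Fin.ext h
  · intro g hg
    exact ⟨⟨g, Nat.lt_succ_iff.2 (mem_sites.1 hg).1⟩, Finset.mem_filter.2 ⟨Finset.mem_univ _, hg⟩, rfl⟩
  · intro k hk
    have hk := (Finset.mem_filter.1 hk).2
    rw [card_sites_insert_none hk, phase_insert_none hk]

open Classical in
theorem sum_validLeaf {n : ℕ} {G : SimpleGraph (Fin n)} (hG : Ord G) {l i j : Fin n}
    (ht : Tip G l i j) (f : ℕ → ℕ → ℕ) :
    ∑ x ∈ Finset.univ.filter (fun x : Fin (n + 1) × Fin n => ValidLeaf G x.1 x.2),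
      f (sites (insertVertex x.1 G (some x.2))).card (phase (insertVertex x.1 G (some x.2))) =
    if phase G = 0 then f (sites G).card 1
    else if phase G = 1 then f (sites G).card 1 +
      (f ((sites G).card + 1) 1 + f ((sites G).card + 1) 2)
    else f (sites G).card 2 + f ((sites G).card + 1) 2 := by
  have hv : ∀ x : Fin (n + 1) × Fin n, ValidLeaf G x.1 x.2 ↔
      (x.2 = j ∧ l = i ∧ x.1 = j.succ) ∨ (x.2 = j ∧ l = i ∧ i < j ∧ x.1 = j.castSucc) ∨
      (x.2 = i ∧ l < i ∧ x.1 = i.castSucc) ∨ (x.2 = i ∧ i < j ∧ x.1 = i.succ) := by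
    intro x
    refine ⟨?_, fun h => ⟨l, i, j, ht, h⟩⟩
    rintro ⟨l', i', j', ht', h⟩
    obtain ⟨rfl, rfl, rfl⟩ := ht.unique ht'
    exact h
  simp only [hv]
  have hle := ht.le
  have hli := ht.le_left
  rw [ht.phase_eq]
  by_cases h2 : l < i
  · have hij := ht.lt_of_lt h2
    have hset : (Finset.univ.filter fun x : Fin (n + 1) × Fin n =>
        (x.2 = j ∧ l = i ∧ x.1 = j.succ) ∨ (x.2 = j ∧ l = i ∧ i < j ∧ x.1 = j.castSucc) ∨
        (x.2 = i ∧ l < i ∧ x.1 = i.castSucc) ∨ (x.2 = i ∧ i < j ∧ x.1 = i.succ)) =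
        {(i.castSucc, i), (i.succ, i)} := by
      ext ⟨k, v⟩
      simp only [Finset.mem_filter, Finset.mem_univ, true_and, Finset.mem_insert,
        Finset.mem_singleton, Prod.mk.injEq, h2.ne, h2, hij, false_and, and_false, false_or]
      tauto
    rw [hset, Finset.sum_pair (by simp [Fin.ext_iff])]
    simp only [h2, if_true, state_left_castSucc ht h2, state_left_succ hG ht hij]
    simp
  · obtain rfl : l = i := le_antisymm hli (not_lt.1 h2)
    by_cases h1 : l < j
    · have hset : (Finset.univ.filter fun x : Fin (n + 1) × Fin n =>
          (x.2 = j ∧ l = l ∧ x.1 = j.succ) ∨ (x.2 = j ∧ l = l ∧ l < j ∧ x.1 = j.castSucc) ∨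
          (x.2 = l ∧ l < l ∧ x.1 = l.castSucc) ∨ (x.2 = l ∧ l < j ∧ x.1 = l.succ)) =
          {(j.succ, j), (j.castSucc, j), (l.succ, l)} := by
        ext ⟨k, v⟩
        simp only [Finset.mem_filter, Finset.mem_univ, true_and, Finset.mem_insert,
          Finset.mem_singleton, Prod.mk.injEq, h1, lt_irrefl, false_and, and_false, false_or]
        tauto
      rw [hset, Finset.sum_insert (by simp [Fin.ext_iff]; omega),
        Finset.sum_pair (by simp [Fin.ext_iff]; omega)]
      simp only [h1, if_true, lt_irrefl, if_false, state_right_succ ht,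
        state_right_castSucc hG ht h1, state_left_succ hG ht h1]
      simp
    · obtain rfl : l = j := le_antisymm hle (not_lt.1 h1)
      have hset : (Finset.univ.filter fun x : Fin (n + 1) × Fin n =>
          (x.2 = l ∧ l = l ∧ x.1 = l.succ) ∨ (x.2 = l ∧ l = l ∧ l < l ∧ x.1 = l.castSucc) ∨
          (x.2 = l ∧ l < l ∧ x.1 = l.castSucc) ∨ (x.2 = l ∧ l < l ∧ x.1 = l.succ)) =
          {(l.succ, l)} := by
        ext ⟨k, v⟩
        simp only [Finset.mem_filter, Finset.mem_univ, true_and,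
          Finset.mem_singleton, Prod.mk.injEq, lt_irrefl, false_and, and_false, or_false]
        tauto
      rw [hset, Finset.sum_singleton]
      simp only [lt_irrefl, if_false, state_right_succ ht, if_true]

theorem sum_children {n : ℕ} (hn : 0 < n) (f : ℕ → ℕ → ℕ) :
    ∑ G' ∈ ordSet (n + 1), f (sites G').card (phase G') =
      ∑ G ∈ ordSet n, nextSum f (sites G).card (phase G) := by
  classical
  rw [sum_ordSet_succ fun G' => f (sites G').card (phase G')]
  refine Finset.sum_congr rfl fun G hG => ?_
  obtain ⟨l, i, j, ht⟩ := (mem_ordSet.1 hG).exists_tip hn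
  rw [sum_validInsertion G
      fun x => f (sites (insertVertex x.1 G x.2)).card (phase (insertVertex x.1 G x.2)),
    sum_isolated, sum_validLeaf (mem_ordSet.1 hG) ht]
  rfl

theorem sum_ordSet_one (f : ℕ → ℕ → ℕ) :
    ∑ G ∈ ordSet 1, f (sites G).card (phase G) = f 1 0 := by
  classical
  have h0 : ordSet 0 = {⊥} := by
    ext G
    have : G = ⊥ := Subsingleton.elim _ _
    subst this
    simp only [mem_ordSet, Finset.mem_singleton, iff_true]
    exact ⟨fun a => a.elim0, SimpleGraph.isAcyclic_bot, fun v => v.elim0, fun i => i.elim0⟩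
  have hs : (sites (⊥ : SimpleGraph (Fin 0))) = {0} := by
    ext g
    rw [mem_sites, Finset.mem_singleton]
    exact ⟨fun h => by omega, fun h => ⟨by omega, fun v => v.elim0, fun v => v.elim0⟩⟩
  rw [sum_ordSet_succ fun G' => f (sites G').card (phase G'), h0, Finset.sum_singleton,
    sum_validInsertion _
      fun x => f (sites (insertVertex x.1 ⊥ x.2)).card (phase (insertVertex x.1 ⊥ x.2)),
    sum_isolated, hs]
  simp

theorem sum_ordSet_eq (m : ℕ) : ∀ n, 0 < n → ∑ G ∈ ordSet n,
    descendants m (sites G).card (phase G) = (ordSet (n + m)).card := by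
  induction m with
  | zero => intro n _; simp [descendants]
  | succ m ih =>
    intro n hn
    have := sum_children hn (descendants m)
    rw [ih (n + 1) (by omega)] at this
    rw [show n + (m + 1) = n + 1 + m by omega, this]
    rfl

theorem card_ordSet (m : ℕ) : (ordSet (m + 1)).card = descendants m 1 0 := by
  rw [add_comm, ← sum_ordSet_eq m 1 one_pos, sum_ordSet_one (descendants m)]

theorem numPaths_pos {n : ℕ} (hn : 1 ≤ n) (G : SimpleGraph (Fin n)) : 1 ≤ numPaths G := by
  have : Nonempty (Fin n) := ⟨⟨0, hn⟩⟩
  have : Nonempty G.ConnectedComponent := ⟨G.connectedComponentMk ⟨0, hn⟩⟩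
  exact Nat.card_pos

theorem numPaths_le {n : ℕ} (G : SimpleGraph (Fin n)) : numPaths G ≤ n := by
  have := Nat.card_le_card_of_surjective (G.connectedComponentMk) fun c => by
    induction c using SimpleGraph.ConnectedComponent.ind with
    | _ v => exact ⟨v, rfl⟩
  simpa [numPaths] using this

open Classical in
theorem ordCount_eq_card (n k : ℕ) :
    ordCount n k = ((ordSet n).filter fun G => numPaths G = k).card := by
  rw [ordCount, ← Set.ncard_coe_finset]
  congr 1
  ext G
  simp [mem_ordSet]

theorem sum_ordCount {n : ℕ} (hn : 1 ≤ n) :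
    ∑ k ∈ Finset.Icc 1 n, ordCount n k = (ordSet n).card := by
  classical
  rw [Finset.card_eq_sum_card_fiberwise (f := numPaths) (t := Finset.Icc 1 n)]
  · exact Finset.sum_congr rfl fun k _ => ordCount_eq_card n k
  · intro G _
    exact Finset.mem_coe.2 (Finset.mem_Icc.2 ⟨numPaths_pos hn G, numPaths_le G⟩)

/-- There is a number of paths for which the ordered partitions are at least average. -/
theorem exists_ordCount (n : ℕ) : ∃ k, 1 ≤ n → 1 ≤ k ∧ k ≤ n ∧ ordCount n k ≤ (ordSet n).card ∧
    (ordSet n).card ≤ n * ordCount n k := by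
  by_cases hn : 1 ≤ n
  · obtain ⟨k, hk, hmax⟩ := Finset.exists_max_image (Finset.Icc 1 n) (ordCount n)
      ⟨1, Finset.mem_Icc.2 ⟨le_rfl, hn⟩⟩
    refine ⟨k, fun _ => ⟨(Finset.mem_Icc.1 hk).1, (Finset.mem_Icc.1 hk).2, ?_, ?_⟩⟩
    · rw [← sum_ordCount hn]
      exact Finset.single_le_sum (fun _ _ => Nat.zero_le _) hk
    · rw [← sum_ordCount hn]
      calc _ ≤ ∑ _k ∈ Finset.Icc 1 n, ordCount n k := Finset.sum_le_sum hmax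
        _ = _ := by simp
  · exact ⟨0, fun h => absurd h hn⟩

end

end NCPath

namespace NCPath

/-! ### The growth rate -/

/-- The numbers that describe the critical point of the generating tree: `1 / x` is its growth
rate, and the number of descendants of a node in a state `(h, ph)` grows like `F ^ h`. -/
structure Critical (x y F : ℝ) : Prop where
  x_pos : 0 < x
  x_lt : x < 1
  y_pos : 0 < y
  y_lt : y < 1
  F_gt : 1 < F
  mul_F : x * F = (1 - x) * y
  balance : F - 1 = (1 - x) * y + x * y / (1 - y) ^ 2
  critical : 2 * x * y ^ 2 = (1 - y) ^ 3

theorem exists_critical : ∃ x y F : ℝ, Critical x y F ∧ |1 / x - 4.6421263038| < 1 / 10 ^ 10 ∧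
    4 * (1 / x) ^ 5 - 36 * (1 / x) ^ 4 + 112 * (1 / x) ^ 3 - 168 * (1 / x) ^ 2 + 117 * (1 / x) - 32
      = 0 := by
  obtain ⟨u, ⟨hu1, hu2⟩, hu⟩ : (0 : ℝ) ∈ (fun u : ℝ => u ^ 5 - 3 * u ^ 4 + 10 * u ^ 3 - 12 * u ^ 2
      + 12 * u - 4) '' Set.Icc 0.48516060471176 0.48516060471177 := by
    refine intermediate_value_Icc (by norm_num) (by fun_prop) ⟨by norm_num, by norm_num⟩
  simp only at hu
  have hu0 : 0 < u := lt_of_lt_of_le (by norm_num) hu1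
  have hy0 : 0 < 1 - u := by linarith [hu2, show (0.48516060471177 : ℝ) < 1 by norm_num]
  have h3l : (0.48516060471176 : ℝ) ^ 3 ≤ u ^ 3 := by gcongr
  have h3u : u ^ 3 ≤ (0.48516060471177 : ℝ) ^ 3 := by gcongr
  have h2l : (1 - 0.48516060471177 : ℝ) ^ 2 ≤ (1 - u) ^ 2 :=
    pow_le_pow_left₀ (by norm_num) (by linarith) 2
  have h2u : (1 - u) ^ 2 ≤ (1 - 0.48516060471176 : ℝ) ^ 2 :=
    pow_le_pow_left₀ hy0.le (by linarith) 2
  norm_num at h3l h3u h2l h2u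
  have hx0 : 0 < u ^ 3 / (2 * (1 - u) ^ 2) := by positivity
  have hx1 : u ^ 3 / (2 * (1 - u) ^ 2) < 1 / 4 := by
    rw [div_lt_iff₀ (by positivity)]
    linarith
  have hF : 1 < (1 - u ^ 3 / (2 * (1 - u) ^ 2)) * (1 - u) / (u ^ 3 / (2 * (1 - u) ^ 2)) := by
    rw [lt_div_iff₀ hx0]
    have : 1 / 2 < 1 - u := by linarith [hu2, show (0.48516060471177 : ℝ) < 1 / 2 by norm_num]
    nlinarith
  refine ⟨u ^ 3 / (2 * (1 - u) ^ 2), 1 - u,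
    (1 - u ^ 3 / (2 * (1 - u) ^ 2)) * (1 - u) / (u ^ 3 / (2 * (1 - u) ^ 2)),
    ⟨hx0, by linarith, hy0, by linarith, hF, ?_, ?_, ?_⟩, ?_, ?_⟩
  · field_simp
  · rw [sub_sub_cancel]
    field_simp
    linear_combination (u - 1) * hu
  · field_simp
    ring
  · rw [abs_sub_lt_iff, one_div_div]
    constructor
    · rw [sub_lt_iff_lt_add, div_lt_iff₀ (by positivity)]
      norm_num
      linarith
    · rw [sub_lt_comm, lt_div_iff₀ (by positivity)]
      norm_num
      linarith
  · rw [one_div_div]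
    have hu3 : u ≠ 0 := hu0.ne'
    field_simp
    linear_combination (-32 + 224 * u - 672 * u ^ 2 + 1216 * u ^ 3 - 1624 * u ^ 4 + 1720 * u ^ 5
      - 1376 * u ^ 6 + 836 * u ^ 7 - 406 * u ^ 8 + 138 * u ^ 9 - 32 * u ^ 10) * hu

theorem Critical.descendants_le {x y F : ℝ} (hc : Critical x y F) :
    ∃ C : ℝ, 0 < C ∧ ∀ m, (descendants m 1 0 : ℝ) ≤ C * (1 / x) ^ m := by
  have hx := hc.x_pos
  have hx1 : 0 < 1 - x := by linarith [hc.x_lt]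
  have hy := hc.y_pos
  have hy1 : 0 < 1 - y := by linarith [hc.y_lt]
  have hF1 : 0 < F - 1 := by linarith [hc.F_gt]
  have hF := hc.F_gt
  have hm := hc.mul_F
  have hb := hc.balance
  obtain ⟨a, ha⟩ : ∃ a, a = F / (F - 1) := ⟨_, rfl⟩
  obtain ⟨v2, hv2⟩ : ∃ v, v = a * x / ((1 - x) * (1 - y)) := ⟨_, rfl⟩
  obtain ⟨v1, hv1⟩ : ∃ v, v = v2 / (1 - y) := ⟨_, rfl⟩
  have ha0 : 0 < a := by rw [ha]; positivity
  have h20 : 0 < v2 := by rw [hv2]; positivity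
  have h10 : 0 < v1 := by rw [hv1]; positivity
  have e0 : x * a + x * v1 = 1 := by
    have h1 : x * a * (F - 1) = (1 - x) * y := by rw [ha, ← hm]; field_simp
    have h2 : x * v1 * (F - 1) = x * y / (1 - y) ^ 2 := by
      rw [hv1, hv2, show x * (a * x / ((1 - x) * (1 - y)) / (1 - y)) * (F - 1) =
        x * a * (F - 1) * (x / ((1 - x) * (1 - y) ^ 2)) by field_simp, h1]
      field_simp
    refine mul_right_cancel₀ hF1.ne' ?_
    linear_combination h1 + h2 - hb
  have e2 : x * a + x * v2 + x * F * v2 = v2 := by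
    have : v2 * ((1 - x) * (1 - y)) = a * x := by rw [hv2]; field_simp
    linear_combination v2 * hm - this
  have e1 : x * a + x * v1 + x * F * v1 + x * F * v2 = v1 := by
    have : v1 * (1 - y) = v2 := by rw [hv1]; field_simp
    linear_combination v1 * hm + e2 - this * (1 - x)
  obtain ⟨v, hv⟩ : ∃ v : ℕ → ℝ, v = fun ph => if ph = 0 then 1 else if ph = 1 then v1 else v2 :=
    ⟨_, rfl⟩
  have hgeo : ∀ h : ℕ, ∑ r ∈ Finset.Icc 1 h, F ^ r ≤ a * F ^ h := by
    intro h
    induction h with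
    | zero => simpa using ha0.le
    | succ h ih =>
      rw [Finset.sum_Icc_succ_top (by omega), pow_succ]
      have : a * (F - 1) = F := by rw [ha]; field_simp
      have : a * (F ^ h * F) = a * F ^ h + F ^ h * F := by linear_combination F ^ h * this
      linarith
  obtain ⟨K, hK⟩ : ∃ K, K = 1 + 1 / v1 + 1 / v2 := ⟨_, rfl⟩
  have hK0 : 0 < K := by rw [hK]; positivity
  have key : ∀ m h ph, (descendants m h ph : ℝ) * x ^ m ≤ K * (F ^ h * v ph) := by
    intro m
    induction m with
    | zero =>
      intro h ph
      have h1 : 1 ≤ K * v ph := by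
        rw [hK, hv]
        simp only
        have h3 : 1 / v1 * v1 = 1 := by field_simp
        have h4 : 1 / v2 * v2 = 1 := by field_simp
        have h5 : 0 < 1 / v1 := by positivity
        have h6 : 0 < 1 / v2 := by positivity
        split_ifs <;> nlinarith
      have h2 : 1 ≤ F ^ h := one_le_pow₀ hF.le
      simp only [descendants, Nat.cast_one, pow_zero, mul_one]
      nlinarith
    | succ m ih =>
      intro h ph
      have hsum : (∑ r ∈ Finset.Icc 1 h, (descendants m r 0 : ℝ)) * x ^ m ≤ K * (a * F ^ h) := by
        rw [Finset.sum_mul]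
        calc _ ≤ ∑ r ∈ Finset.Icc 1 h, K * F ^ r := by
              refine Finset.sum_le_sum fun r _ => ?_
              simpa [hv] using ih r 0
          _ ≤ _ := by
              rw [← Finset.mul_sum]
              exact mul_le_mul_of_nonneg_left (hgeo h) hK0.le
      have i1 := ih h 1
      have i2 := ih h 2
      have i3 := ih (h + 1) 1
      have i4 := ih (h + 1) 2
      have w1 : v 1 = v1 := by simp [hv]
      have w2 : v 2 = v2 := by simp [hv]
      rw [w1] at i1 i3
      rw [w2] at i2 i4
      rw [descendants, nextSum]
      push_cast
      rw [pow_succ, ← mul_assoc, add_mul]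
      rw [pow_succ] at i3 i4
      have hKF : 0 < K * F ^ h := by positivity
      by_cases p0 : ph = 0
      · simp only [p0, if_true, hv]
        calc _ ≤ (K * (a * F ^ h) + K * (F ^ h * v1)) * x := by gcongr
          _ = _ := by linear_combination K * F ^ h * e0
      by_cases p1 : ph = 1
      · simp only [p1, if_true, hv, one_ne_zero, if_false, add_mul _ _ (x ^ m)]
        calc _ ≤ (K * (a * F ^ h) + (K * (F ^ h * v1) + (K * (F ^ h * F * v1) +
                K * (F ^ h * F * v2)))) * x := by gcongr
          _ = _ := by linear_combination K * F ^ h * e1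
      · simp only [p0, p1, if_false, hv, add_mul _ _ (x ^ m)]
        calc _ ≤ (K * (a * F ^ h) + (K * (F ^ h * v2) + K * (F ^ h * F * v2))) * x := by gcongr
          _ = _ := by linear_combination K * F ^ h * e2
  refine ⟨K * F, by positivity, fun m => ?_⟩
  rw [one_div, inv_pow, ← div_eq_mul_inv, le_div_iff₀ (by positivity)]
  simpa [hv] using key m 1 0

end NCPath

namespace NCPath

/-! ### Segments of the generating tree -/

theorem multichoose_add (a b n : ℕ) : (a + b).multichoose n =
    ∑ p ∈ Finset.HasAntidiagonal.antidiagonal n, a.multichoose p.1 * b.multichoose p.2 := by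
  induction a generalizing n with
  | zero =>
    rw [Finset.sum_eq_single (0, n)]
    · simp
    · rintro ⟨i, j⟩ hp hne
      rcases i with _ | i
      · have := Finset.HasAntidiagonal.mem_antidiagonal.1 hp
        simp only [zero_add] at this
        exact absurd (by rw [this]) hne
      · simp
    · intro h
      simp at h
  | succ a iha =>
    induction n with
    | zero => simp
    | succ n ihn =>
      rw [Finset.Nat.sum_antidiagonal_succ]
      simp only [Nat.multichoose_succ_succ a, add_mul, Finset.sum_add_distrib]
      rw [← ihn, show a + 1 + b = a + b + 1 by ring, Nat.multichoose_succ_succ, iha,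
        Finset.Nat.sum_antidiagonal_succ]
      simp only [Nat.multichoose_zero_right]
      ring

theorem sum_piAntidiag_prod {ι : Type*} [DecidableEq ι] (f : ℕ → ℕ → ℕ)
    (hz : ∀ n, f 0 n = if n = 0 then 1 else 0)
    (hf : ∀ a b n, f (a + b) n = ∑ p ∈ Finset.HasAntidiagonal.antidiagonal n, f a p.1 * f b p.2)
    (s : Finset ι) (a : ι → ℕ) (n : ℕ) :
    ∑ u ∈ s.piAntidiag n, ∏ i ∈ s, f (a i) (u i) = f (∑ i ∈ s, a i) n := by
  induction s using Finset.cons_induction generalizing n with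
  | empty =>
    rw [Finset.piAntidiag_empty, Finset.sum_empty, hz]
    split_ifs <;> simp
  | cons i s hi ih =>
    rw [Finset.piAntidiag_cons, Finset.sum_disjiUnion, Finset.sum_cons, hf]
    refine Finset.sum_congr rfl fun p _ => ?_
    rw [Finset.sum_map, ← ih p.2, Finset.mul_sum]
    refine Finset.sum_congr rfl fun u hu => ?_
    have hu0 : u i = 0 := by
      by_contra h
      exact hi ((Finset.mem_piAntidiag.1 hu).2 i h)
    rw [Finset.prod_cons]
    congr 1
    · simp [hu0]
    · refine Finset.prod_congr rfl fun j hj => ?_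
      have : j ≠ i := fun h => hi (h ▸ hj)
      simp [this]

theorem sum_choose_succ_mul (l : ℕ) (f : ℕ → ℕ) :
    ∑ g ∈ Finset.range (l + 2), (l + 1).choose g * f g =
      ∑ g ∈ Finset.range (l + 1), l.choose g * f g +
      ∑ g ∈ Finset.range (l + 1), l.choose g * f (g + 1) := by
  rw [Finset.sum_range_succ']
  simp only [Nat.choose_succ_succ, add_mul, Finset.sum_add_distrib]
  have : ∑ g ∈ Finset.range (l + 2), l.choose g * f g = ∑ g ∈ Finset.range (l + 1), l.choose g * f g
      := by
    rw [Finset.sum_range_succ, Nat.choose_succ_self]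
    simp
  rw [← this, Finset.sum_range_succ' _ (l + 1)]
  simp only [Nat.choose_zero_right, Nat.succ_eq_add_one]
  ring

/-- The number of descendants reached through an isolated vertex. -/
def isolatedSum (n h : ℕ) : ℕ := ∑ r ∈ Finset.Icc 1 h, descendants n r 0

theorem le_descendants_two (n h : ℕ) :
    ∑ l ∈ Finset.range n, ∑ g ∈ Finset.range (l + 1), l.choose g * isolatedSum (n - 1 - l) (h + g)
      ≤ descendants n h 2 := by
  induction n generalizing h with
  | zero => simp
  | succ n ih =>
    have hd : descendants (n + 1) h 2 =
        isolatedSum n h + (descendants n h 2 + descendants n (h + 1) 2) := rfl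
    rw [hd, Finset.sum_range_succ', add_comm]
    refine add_le_add (by simp) ?_
    refine le_trans (le_of_eq ?_) (add_le_add (ih h) (ih (h + 1)))
    rw [← Finset.sum_add_distrib]
    refine Finset.sum_congr rfl fun l _ => ?_
    rw [sum_choose_succ_mul l fun g => isolatedSum (n + 1 - 1 - (l + 1)) (h + g)]
    simp only [show n + 1 - 1 - (l + 1) = n - 1 - l by omega, show ∀ g, h + 1 + g = h + (g + 1) by
      intro g; ring]

theorem le_descendants_one (n h : ℕ) :
    ∑ l ∈ Finset.range n, ∑ g ∈ Finset.range (l + 1),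
      l.choose g * ((g + 1) * isolatedSum (n - 1 - l) (h + g)) ≤ descendants n h 1 := by
  induction n generalizing h with
  | zero => simp
  | succ n ih =>
    have hd : descendants (n + 1) h 1 = isolatedSum n h +
        (descendants n h 1 + (descendants n (h + 1) 1 + descendants n (h + 1) 2)) := rfl
    rw [hd, Finset.sum_range_succ', add_comm]
    refine add_le_add (by simp) ?_
    refine le_trans (le_of_eq ?_) (add_le_add (ih h) (add_le_add (ih (h + 1))
      (le_descendants_two n (h + 1))))
    rw [← Finset.sum_add_distrib, ← Finset.sum_add_distrib]
    refine Finset.sum_congr rfl fun l _ => ?_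
    rw [sum_choose_succ_mul l fun g => (g + 1) * isolatedSum (n + 1 - 1 - (l + 1)) (h + g)]
    simp only [show n + 1 - 1 - (l + 1) = n - 1 - l by omega, show ∀ g, h + 1 + g = h + (g + 1) by
      intro g; ring]
    congr 1
    rw [← Finset.sum_add_distrib]
    refine Finset.sum_congr rfl fun g _ => ?_
    ring

/-- A segment `(t, g, u, e)`: a path component if `t = 1`, with `g` insertions that create a site
and `u` further ones, followed by an isolated vertex that closes `e` sites. -/
abbrev Segment := ℕ × ℕ × ℕ × ℕ

/-- The number of vertices that a segment adds. -/
def Segment.size (a : Segment) : ℕ := 1 + a.1 + a.2.1 + a.2.2.1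

/-- The number of ways to realize a segment. -/
def Segment.weight (a : Segment) : ℕ :=
  Nat.choose 1 a.1 * (2 * a.1).multichoose a.2.1 * (a.2.1 + a.1).multichoose a.2.2.1

theorem Segment.weight_eq (a : Segment) : (a.1 = 0 ∧ a.2.1 = 0 ∧ a.2.2.1 = 0 ∧ a.weight = 1) ∨
    (a.1 = 1 ∧ a.weight = (a.2.2.1 + a.2.1).choose a.2.1 * (a.2.1 + 1)) ∨ a.weight = 0 := by
  rcases a with ⟨t, g, u, e⟩
  rcases t with _ | _ | t
  · rcases g with _ | g
    · rcases u with _ | u <;> simp [Segment.weight]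
    · simp [Segment.weight]
  · right; left
    refine ⟨rfl, ?_⟩
    simp only [Segment.weight, Nat.multichoose_eq]
    rw [show g + (0 + 1) + u - 1 = u + g by omega, Nat.choose_symm_add,
      show 2 * (0 + 1) + g - 1 = g + 1 by omega, Nat.choose_succ_self_right]
    simp only [zero_add, Nat.choose_self, one_mul]
    ring
  · simp [Segment.weight, Nat.choose_eq_zero_of_lt]

theorem sum_le_sum_of_injOn {α β : Type*} {s : Finset α} {t : Finset β} {f : α → ℕ} {g : β → ℕ}
    (i : α → β) (hi : ∀ a ∈ s, i a ∈ t) (hinj : ∀ a ∈ s, ∀ b ∈ s, i a = i b → a = b)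
    (h : ∀ a ∈ s, f a ≤ g (i a)) : ∑ a ∈ s, f a ≤ ∑ b ∈ t, g b := by
  classical
  calc _ ≤ ∑ a ∈ s, g (i a) := Finset.sum_le_sum h
    _ = ∑ b ∈ s.image i, g b := (Finset.sum_image fun a ha b hb => hinj a ha b hb).symm
    _ ≤ _ := Finset.sum_le_sum_of_subset (Finset.image_subset_iff.2 hi)

theorem sum_segment_le (n h : ℕ) (A : Finset Segment)
    (hA : ∀ a ∈ A, a.size ≤ n ∧ a.2.2.2 < h + a.2.1) :
    ∑ a ∈ A, a.weight * descendants (n - a.size) (h + a.2.1 - a.2.2.2) 0 ≤ descendants n h 0 := by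
  classical
  rcases n with _ | n
  · rw [Finset.sum_eq_zero]
    · exact Nat.zero_le _
    · intro a ha
      have := (hA a ha).1
      simp [Segment.size] at this
  have hsplit : ∀ a ∈ A, a.weight * descendants (n + 1 - a.size) (h + a.2.1 - a.2.2.2) 0 ≤
      (if a.1 = 0 ∧ a.2.1 = 0 ∧ a.2.2.1 = 0 then descendants n (h - a.2.2.2) 0 else 0) +
      (if a.1 = 1 then (a.2.2.1 + a.2.1).choose a.2.1 * ((a.2.1 + 1) *
        descendants (n - 1 - (a.2.2.1 + a.2.1)) (h + a.2.1 - a.2.2.2) 0) else 0) := by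
    intro a _
    rcases a.weight_eq with ⟨h1, h2, h3, h4⟩ | ⟨h1, h2⟩ | h0
    · rw [if_pos ⟨h1, h2, h3⟩, h4, Segment.size, h1, h2, h3]
      simp
    · rw [if_pos h1, h2, Segment.size, h1, mul_assoc,
        show n + 1 - (1 + 1 + a.2.1 + a.2.2.1) = n - 1 - (a.2.2.1 + a.2.1) by omega]
      exact Nat.le_add_left _ _
    · simp [h0]
  refine (Finset.sum_le_sum hsplit).trans ?_
  have hd : descendants (n + 1) h 0 = isolatedSum n h + descendants n h 1 := rfl
  rw [Finset.sum_add_distrib, hd]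
  refine add_le_add ?_ (le_trans ?_ (le_descendants_one n h))
  · rw [← Finset.sum_filter, isolatedSum]
    refine sum_le_sum_of_injOn (fun a : Segment => h - a.2.2.2) ?_ ?_ fun a _ => le_rfl
    · intro a ha
      obtain ⟨ha, h1, h2, h3⟩ := Finset.mem_filter.1 ha
      have := (hA a ha).2
      exact Finset.mem_Icc.2 ⟨by omega, by omega⟩
    · rintro ⟨t, g, u, e⟩ ha ⟨t', g', u', e'⟩ hb heq
      obtain ⟨ha, h1, h2, h3⟩ := Finset.mem_filter.1 ha
      obtain ⟨hb, i1, i2, i3⟩ := Finset.mem_filter.1 hb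
      have := (hA _ ha).2
      have := (hA _ hb).2
      simp only [Prod.mk.injEq] at *
      omega
  · simp only [isolatedSum, Finset.mul_sum]
    rw [← Finset.sum_filter]
    simp only [Finset.sum_sigma']
    refine sum_le_sum_of_injOn (fun a : Segment =>
      (⟨a.2.2.1 + a.2.1, a.2.1, h + a.2.1 - a.2.2.2⟩ : (_ : ℕ) × (_ : ℕ) × ℕ)) ?_ ?_
      fun a _ => le_rfl
    · intro a ha
      obtain ⟨ha, h1⟩ := Finset.mem_filter.1 ha
      obtain ⟨h2, h3⟩ := hA a ha
      rw [Segment.size] at h2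
      simp only [Finset.mem_sigma, Finset.mem_range, Finset.mem_Icc]
      omega
    · rintro ⟨t, g, u, e⟩ ha ⟨t', g', u', e'⟩ hb heq
      obtain ⟨ha, h1⟩ := Finset.mem_filter.1 ha
      obtain ⟨hb, i1⟩ := Finset.mem_filter.1 hb
      have := (hA _ ha).2
      have := (hA _ hb).2
      simp only [Sigma.mk.injEq, heq_eq_eq] at heq
      simp only [Prod.mk.injEq] at *
      omega

/-- A list of segments that can be realized starting from `h` sites. -/
def Realizable : ℕ → List Segment → Prop
  | _, [] => True
  | h, a :: l => a.2.2.2 < h + a.2.1 ∧ Realizable (h + a.2.1 - a.2.2.2) l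

theorem one_le_descendants (n h ph : ℕ) : 1 ≤ descendants n h ph := by
  induction n generalizing h ph with
  | zero => exact le_rfl
  | succ n ih =>
    rw [descendants, nextSum]
    refine le_trans ?_ (Nat.le_add_left _ _)
    split_ifs
    · exact ih _ _
    · exact (ih _ _).trans (Nat.le_add_right _ _)
    · exact (ih _ _).trans (Nat.le_add_right _ _)

theorem sum_list_le (B : ℕ) : ∀ (n h : ℕ) (S : Finset (List Segment)),
    (∀ l ∈ S, l.length = B ∧ Realizable h l ∧ (l.map Segment.size).sum = n) →
    ∑ l ∈ S, (l.map Segment.weight).prod ≤ descendants n h 0 := by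
  classical
  induction B with
  | zero =>
    intro n h S hS
    have hsub : S ⊆ {[]} := fun l hl =>
      Finset.mem_singleton.2 (List.eq_nil_of_length_eq_zero (hS l hl).1)
    refine (Finset.sum_le_sum_of_subset hsub).trans ?_
    simpa using one_le_descendants n h 0
  | succ B ih =>
    intro n h S hS
    have hcons : ∀ l ∈ S, ∃ a l', l = a :: l' := fun l hl =>
      List.exists_cons_of_length_eq_add_one (hS l hl).1
    have hmaps : ∀ l ∈ S, l.headD (0, 0, 0, 0) ∈ S.image fun l => l.headD (0, 0, 0, 0) :=
      fun l hl => Finset.mem_image_of_mem _ hl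
    rw [← Finset.sum_fiberwise_of_maps_to hmaps]
    refine le_trans (Finset.sum_le_sum fun a ha => ?_)
      (sum_segment_le n h (S.image fun l => l.headD (0, 0, 0, 0)) ?_)
    · calc _ = ∑ l ∈ S.filter (fun l => l.headD (0, 0, 0, 0) = a),
            a.weight * (l.tail.map Segment.weight).prod := by
            refine Finset.sum_congr rfl fun l hl => ?_
            obtain ⟨hl, hla⟩ := Finset.mem_filter.1 hl
            obtain ⟨b, l', rfl⟩ := hcons l hl
            simp only [List.headD_cons] at hla
            simp [hla]
        _ = a.weight * ∑ l ∈ (S.filter (fun l => l.headD (0, 0, 0, 0) = a)).image List.tail,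
            (l.map Segment.weight).prod := by
            rw [Finset.mul_sum, Finset.sum_image]
            intro l hl l' hl' heq
            obtain ⟨hl, hla⟩ := Finset.mem_filter.1 hl
            obtain ⟨hl', hla'⟩ := Finset.mem_filter.1 hl'
            obtain ⟨b, m, rfl⟩ := hcons l hl
            obtain ⟨b', m', rfl⟩ := hcons l' hl'
            simp only [List.headD_cons] at hla hla'
            simp only [List.tail_cons] at heq
            rw [hla, hla', heq]
        _ ≤ _ := by
            refine Nat.mul_le_mul_left _ (ih _ _ _ ?_)
            intro m hm
            obtain ⟨l, hl, rfl⟩ := Finset.mem_image.1 hm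
            obtain ⟨hlS, hla⟩ := Finset.mem_filter.1 hl
            obtain ⟨b, m, rfl⟩ := hcons l hlS
            simp only [List.headD_cons] at hla
            subst hla
            obtain ⟨h1, h2, h3⟩ := hS _ hlS
            refine ⟨by simpa using h1, h2.2, ?_⟩
            simp only [List.map_cons, List.sum_cons] at h3
            simp only [List.tail_cons]
            omega
    · intro a ha
      obtain ⟨l, hl, rfl⟩ := Finset.mem_image.1 ha
      obtain ⟨b, m, rfl⟩ := hcons l hl
      obtain ⟨h1, h2, h3⟩ := hS _ hl
      simp only [List.map_cons, List.sum_cons] at h3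
      exact ⟨by simp only [List.headD_cons]; omega, h2.1⟩

theorem realizable_of_take (l : List Segment) : ∀ h : ℕ,
    (∀ j, 0 < j → j ≤ l.length → ((l.take j).map fun a => a.2.2.2).sum <
      h + ((l.take j).map fun a => a.2.1).sum) → Realizable h l := by
  induction l with
  | nil => intro _ _; trivial
  | cons a l ih =>
    intro h hj
    have h1 := hj 1 one_pos (by simp)
    simp only [List.take_succ_cons, List.take_zero, List.map_cons, List.map_nil, List.sum_cons,
      List.sum_nil, add_zero] at h1
    refine ⟨h1, ih _ fun j hj0 hjl => ?_⟩
    have h2 := hj (j + 1) (Nat.succ_pos _) (by simpa using hjl)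
    simp only [List.take_succ_cons, List.map_cons, List.sum_cons] at h2
    omega

end NCPath

namespace NCPath

/-- The cyclic rotation of a sequence of segments. -/
def rotation {b : ℕ} (c : Fin (b + 1) → Segment) (r : Fin (b + 1)) : List Segment :=
  List.ofFn fun i => c (i + r)

theorem sum_take_rotation {b : ℕ} (c : Fin (b + 1) → Segment) (r : Fin (b + 1)) (φ : Segment → ℕ)
    {j : ℕ} (hj : j ≤ b + 1) : (((rotation c r).take j).map φ).sum =
      ∑ i ∈ Finset.range j, φ (c (Fin.ofNat (b + 1) (r.val + i))) := by
  rw [rotation, List.map_take, List.map_ofFn, List.sum_take_ofFn]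
  refine Finset.sum_bij (fun x _ => x.val) ?_ ?_ ?_ ?_
  · intro x hx
    exact Finset.mem_range.2 (Finset.mem_filter.1 hx).2
  · intro x _ y _ h
    exact Fin.ext h
  · intro i hi
    have hi := Finset.mem_range.1 hi
    exact ⟨⟨i, by omega⟩, by simpa using hi, rfl⟩
  · intro x _
    simp only [Function.comp]
    congr 2
    apply Fin.ext
    simp [Fin.val_add, add_comm]

theorem exists_realizable_rotation {b : ℕ} (c : Fin (b + 1) → Segment)
    (hc : ∑ i, (c i).2.1 = ∑ i, (c i).2.2.2) : ∃ r, Realizable 1 (rotation c r) := by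
  let D : ℕ → ℤ := fun j => ∑ i ∈ Finset.range j,
    (((c (Fin.ofNat (b + 1) i)).2.1 : ℤ) - (c (Fin.ofNat (b + 1) i)).2.2.2)
  have hper : ∀ j, D (j + (b + 1)) = D j := by
    intro j
    induction j with
    | zero =>
      simp only [D, zero_add, Finset.range_zero, Finset.sum_empty]
      rw [Finset.sum_range]
      simp only [Fin.ofNat_eq_cast, Fin.cast_val_eq_self, Finset.sum_sub_distrib]
      exact_mod_cast sub_eq_zero.2 (congrArg (Nat.cast : ℕ → ℤ) hc)
    | succ j ih =>
      have h1 : D (j + 1 + (b + 1)) = D (j + (b + 1)) + (((c (Fin.ofNat (b + 1) (j + (b + 1)))).2.1 : ℤ)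
          - (c (Fin.ofNat (b + 1) (j + (b + 1)))).2.2.2) := by
        rw [show j + 1 + (b + 1) = j + (b + 1) + 1 by ring]
        exact Finset.sum_range_succ _ _
      have h2 : D (j + 1) = D j + (((c (Fin.ofNat (b + 1) j)).2.1 : ℤ)
          - (c (Fin.ofNat (b + 1) j)).2.2.2) := Finset.sum_range_succ _ _
      have h3 : Fin.ofNat (b + 1) (j + (b + 1)) = Fin.ofNat (b + 1) j := by
        apply Fin.ext
        simp
      rw [h1, h2, ih, h3]
  obtain ⟨r, _, hr⟩ := Finset.exists_min_image (Finset.univ : Finset (Fin (b + 1)))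
    (fun r => D r.val) ⟨0, Finset.mem_univ _⟩
  have hmin : ∀ j, D r.val ≤ D j := by
    intro j
    induction j using Nat.strong_induction_on with
    | _ j ih =>
      by_cases hj : j < b + 1
      · exact hr ⟨j, hj⟩ (Finset.mem_univ _)
      · have := ih (j - (b + 1)) (by omega)
        rwa [← hper (j - (b + 1)), Nat.sub_add_cancel (by omega)] at this
  refine ⟨r, realizable_of_take _ _ fun j _ hj => ?_⟩
  have hj' : j ≤ b + 1 := by simpa [rotation] using hj
  rw [sum_take_rotation c r (fun a => a.2.2.2) hj', sum_take_rotation c r (fun a => a.2.1) hj']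
  have h := hmin (r.val + j)
  simp only [D, Finset.sum_range_add, Finset.sum_sub_distrib] at h
  have h' : ((∑ i ∈ Finset.range j, (c (Fin.ofNat (b + 1) (r.val + i))).2.2.2 : ℕ) : ℤ) ≤
      ((∑ i ∈ Finset.range j, (c (Fin.ofNat (b + 1) (r.val + i))).2.1 : ℕ) : ℤ) := by
    push_cast
    linarith
  have := Int.ofNat_le.1 h'
  omega

theorem rotation_injective {b : ℕ} (r : Fin (b + 1)) :
    Function.Injective fun c : Fin (b + 1) → Segment => rotation c r := by
  intro c c' h
  have h := List.ofFn_injective h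
  funext i
  simpa using congrFun h (i - r)

theorem prod_rotation {b : ℕ} (c : Fin (b + 1) → Segment) (r : Fin (b + 1)) :
    ((rotation c r).map Segment.weight).prod = ∏ i, (c i).weight := by
  rw [rotation, List.map_ofFn, List.prod_ofFn]
  exact Fintype.prod_equiv (Equiv.addRight r) _ _ fun i => rfl

theorem sum_size_rotation {b : ℕ} (c : Fin (b + 1) → Segment) (r : Fin (b + 1)) :
    ((rotation c r).map Segment.size).sum = ∑ i, (c i).size := by
  rw [rotation, List.map_ofFn, List.sum_ofFn]
  exact Fintype.sum_equiv (Equiv.addRight r) _ _ fun i => rfl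

/-- The cycle lemma. -/
theorem sum_closed_le (b n : ℕ) (S : Finset (Fin (b + 1) → Segment))
    (hS : ∀ c ∈ S, ∑ i, (c i).2.1 = ∑ i, (c i).2.2.2 ∧ ∑ i, (c i).size = n) :
    ∑ c ∈ S, ∏ i, (c i).weight ≤ (b + 1) * descendants n 1 0 := by
  classical
  have h1 : ∀ r : Fin (b + 1), ∑ c ∈ S.filter (fun c => Realizable 1 (rotation c r)),
      ∏ i, (c i).weight ≤ descendants n 1 0 := by
    intro r
    have := sum_list_le (b + 1) n 1
      ((S.filter fun c => Realizable 1 (rotation c r)).image fun c => rotation c r) ?_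
    · rw [Finset.sum_image fun c _ c' _ h => rotation_injective r h] at this
      simpa only [prod_rotation] using this
    · intro l hl
      obtain ⟨c, hc, rfl⟩ := Finset.mem_image.1 hl
      obtain ⟨hc, hr⟩ := Finset.mem_filter.1 hc
      exact ⟨by simp [rotation], hr, by rw [sum_size_rotation]; exact (hS c hc).2⟩
  calc _ ≤ ∑ c ∈ S, ∑ r : Fin (b + 1),
          if Realizable 1 (rotation c r) then ∏ i, (c i).weight else 0 := by
        refine Finset.sum_le_sum fun c hc => ?_
        obtain ⟨r, hr⟩ := exists_realizable_rotation c (hS c hc).1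
        refine le_trans ?_ (Finset.single_le_sum (fun _ _ => Nat.zero_le _) (Finset.mem_univ r))
        rw [if_pos hr]
    _ = ∑ r : Fin (b + 1), ∑ c ∈ S.filter (fun c => Realizable 1 (rotation c r)),
          ∏ i, (c i).weight := by
        rw [Finset.sum_comm]
        exact Finset.sum_congr rfl fun r _ => (Finset.sum_filter _ _).symm
    _ ≤ ∑ _r : Fin (b + 1), descendants n 1 0 := Finset.sum_le_sum fun r _ => h1 r
    _ = _ := by simp

theorem multichoose_zero (n : ℕ) : Nat.multichoose 0 n = if n = 0 then 1 else 0 := by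
  cases n <;> simp

theorem sum_closed_eq (B k E U : ℕ) :
    ∑ x ∈ (Finset.univ : Finset (Fin B)).piAntidiag k ×ˢ Finset.univ.piAntidiag E ×ˢ
      Finset.univ.piAntidiag U ×ˢ Finset.univ.piAntidiag E,
      ∏ i, Segment.weight (x.1 i, x.2.1 i, x.2.2.1 i, x.2.2.2 i) =
    B.choose k * (2 * k).multichoose E * (E + k).multichoose U * B.multichoose E := by
  have hm := sum_piAntidiag_prod (ι := Fin B) Nat.multichoose multichoose_zero multichoose_add
    Finset.univ
  have hch := sum_piAntidiag_prod (ι := Fin B) Nat.choose (fun n => by cases n <;> simp)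
    Nat.add_choose_eq Finset.univ (fun _ => 1) k
  have he := hm (fun _ => 1) E
  simp only [Nat.multichoose_one, Finset.prod_const_one, Finset.sum_const, Finset.card_univ,
    Fintype.card_fin, smul_eq_mul, mul_one] at he hch
  simp only [Finset.sum_product, Segment.weight, Finset.prod_mul_distrib]
  simp only [Finset.sum_const, he, smul_eq_mul]
  rw [← hch, Finset.sum_mul, Finset.sum_mul, Finset.sum_mul]
  refine Finset.sum_congr rfl fun t ht => ?_
  have ht := (Finset.mem_piAntidiag.1 ht).1
  have hg := hm (fun i => 2 * t i) E
  rw [← Finset.mul_sum, ht] at hg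
  rw [← hg, Finset.mul_sum, Finset.sum_mul, Finset.sum_mul]
  refine Finset.sum_congr rfl fun g hg => ?_
  have hg := (Finset.mem_piAntidiag.1 hg).1
  have hu := hm (fun i => g i + t i) U
  rw [Finset.sum_add_distrib, hg, ht] at hu
  rw [← hu, Finset.mul_sum, Finset.sum_mul]
  refine Finset.sum_congr rfl fun u _ => ?_
  ring

theorem closed_le_descendants (b k E U : ℕ) :
    (b + 1).choose k * (2 * k).multichoose E * (E + k).multichoose U * (b + 1).multichoose E ≤
      (b + 1) * descendants (b + 1 + k + E + U) 1 0 := by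
  classical
  rw [← sum_closed_eq]
  let f : (Fin (b + 1) → ℕ) × (Fin (b + 1) → ℕ) × (Fin (b + 1) → ℕ) × (Fin (b + 1) → ℕ) →
      Fin (b + 1) → Segment := fun x i => (x.1 i, x.2.1 i, x.2.2.1 i, x.2.2.2 i)
  have hf : Function.Injective f := by
    rintro ⟨t, g, u, e⟩ ⟨t', g', u', e'⟩ h
    have h := fun i => congrFun h i
    simp only [f, Prod.mk.injEq] at h ⊢
    exact ⟨funext fun i => (h i).1, funext fun i => (h i).2.1, funext fun i => (h i).2.2.1,
      funext fun i => (h i).2.2.2⟩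
  have := sum_closed_le b (b + 1 + k + E + U) (((Finset.univ : Finset (Fin (b + 1))).piAntidiag k ×ˢ
    Finset.univ.piAntidiag E ×ˢ Finset.univ.piAntidiag U ×ˢ Finset.univ.piAntidiag E).image f) ?_
  · rwa [Finset.sum_image fun x _ y _ h => hf h] at this
  · intro c hc
    obtain ⟨⟨t, g, u, e⟩, hx, rfl⟩ := Finset.mem_image.1 hc
    simp only [Finset.mem_product, Finset.mem_piAntidiag] at hx
    obtain ⟨⟨ht, -⟩, ⟨hg, -⟩, ⟨hu, -⟩, he, -⟩ := hx
    simp only [f, Segment.size, Finset.sum_add_distrib, hg, he, ht, hu, Finset.sum_const,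
      Finset.card_univ, Fintype.card_fin, smul_eq_mul, mul_one, and_self]

end NCPath

namespace NCPath

/-! ### Binomial coefficients near the mode -/

theorem choose_near_mode {z : ℝ} (hz : 0 < z) (hz1 : z < 1) {N s D : ℕ} (hs : s ≤ N)
    (h1 : (s : ℝ) ≤ N * z + D) (h2 : N * z ≤ (s : ℝ) + D) :
    (z * (1 - z) / (N + 1)) ^ (D + 2) ≤ (N.choose s : ℝ) * z ^ s * (1 - z) ^ (N - s) := by
  obtain ⟨f, hf⟩ : ∃ f : ℕ → ℝ, f = fun s => (N.choose s : ℝ) * z ^ s * (1 - z) ^ (N - s) := ⟨_, rfl⟩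
  obtain ⟨q, hq⟩ : ∃ q, q = z * (1 - z) / (N + 1) := ⟨_, rfl⟩
  have hz2 : 0 < 1 - z := by linarith
  have hN : (0 : ℝ) < N + 1 := by positivity
  have hq0 : 0 < q := by rw [hq]; positivity
  have hzz : z * (1 - z) ≤ 1 := by nlinarith
  have hq1 : q ≤ 1 / (N + 1) := by rw [hq]; gcongr
  have hq2 : q ≤ 1 := hq1.trans (by rw [div_le_one hN]; linarith [(Nat.cast_nonneg N : (0 : ℝ) ≤ N)])
  have hf0 : ∀ s, 0 ≤ f s := fun s => by rw [hf]; positivity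
  have hstep : ∀ s, s < N → f (s + 1) * ((s + 1) * (1 - z)) = f s * ((N - s) * z) := by
    intro s hs
    have h := Nat.choose_succ_right_eq N s
    have h' : (N.choose (s + 1) : ℝ) * (s + 1) = N.choose s * (N - s) := by
      rw [← Nat.cast_sub hs.le]
      exact_mod_cast h
    rw [hf]
    simp only
    rw [show N - s = N - (s + 1) + 1 by omega, pow_succ, pow_succ]
    linear_combination z ^ s * z * (1 - z) ^ (N - (s + 1)) * (1 - z) * h'
  have hup : ∀ s, s < N → q * f s ≤ f (s + 1) := by
    intro s hs
    have h := hstep s hs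
    have hsN : (s : ℝ) + 1 ≤ N := by exact_mod_cast hs
    have hs0 : (0 : ℝ) ≤ s := Nat.cast_nonneg s
    rw [hq, div_mul_eq_mul_div, div_le_iff₀ hN]
    have i1 : f (s + 1) * ((s + 1) * (1 - z)) ≤ f (s + 1) * (N + 1) :=
      mul_le_mul_of_nonneg_left (by nlinarith) (hf0 _)
    have i2 : f s * (z * (1 - z)) ≤ f s * ((N - s) * z) :=
      mul_le_mul_of_nonneg_left (by nlinarith) (hf0 _)
    linarith
  have hdown : ∀ s, s < N → q * f (s + 1) ≤ f s := by
    intro s hs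
    have h := hstep s hs
    have hsN : (s : ℝ) + 1 ≤ N := by exact_mod_cast hs
    have hs0 : (0 : ℝ) ≤ s := Nat.cast_nonneg s
    rw [hq, div_mul_eq_mul_div, div_le_iff₀ hN]
    have i1 : f (s + 1) * (z * (1 - z)) ≤ f (s + 1) * ((s + 1) * (1 - z)) :=
      mul_le_mul_of_nonneg_left (by nlinarith) (hf0 _)
    have i2 : f s * ((N - s) * z) ≤ f s * (N + 1) :=
      mul_le_mul_of_nonneg_left (by nlinarith) (hf0 _)
    linarith
  have hup' : ∀ d s, s + d ≤ N → q ^ d * f s ≤ f (s + d) := by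
    intro d
    induction d with
    | zero => intro s _; simp
    | succ d ih =>
      intro s hs
      calc q ^ (d + 1) * f s = q * (q ^ d * f s) := by ring
        _ ≤ q * f (s + d) := mul_le_mul_of_nonneg_left (ih s (by omega)) hq0.le
        _ ≤ _ := hup _ (by omega)
  have hdown' : ∀ d s, s + d ≤ N → q ^ d * f (s + d) ≤ f s := by
    intro d
    induction d with
    | zero => intro s _; simp
    | succ d ih =>
      intro s hs
      calc q ^ (d + 1) * f (s + (d + 1)) = q ^ d * (q * f (s + d + 1)) := by
            rw [← add_assoc]; ring
        _ ≤ q ^ d * f (s + d) := mul_le_mul_of_nonneg_left (hdown _ (by omega)) (by positivity)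
        _ ≤ _ := ih s (by omega)
  obtain ⟨j, hj, hmax⟩ := Finset.exists_max_image (Finset.range (N + 1)) f ⟨0, by simp⟩
  have hjN : j ≤ N := Nat.lt_succ_iff.1 (Finset.mem_range.1 hj)
  have hsum : ∑ s ∈ Finset.range (N + 1), f s = 1 := by
    have := add_pow z (1 - z) N
    rw [add_sub_cancel, one_pow] at this
    rw [this, hf]
    exact Finset.sum_congr rfl fun s _ => by ring
  have hfj : q ≤ f j := by
    refine hq1.trans ?_
    rw [div_le_iff₀ hN]
    calc 1 = ∑ s ∈ Finset.range (N + 1), f s := hsum.symm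
      _ ≤ ∑ _s ∈ Finset.range (N + 1), f j := Finset.sum_le_sum hmax
      _ = _ := by simp [mul_comm]
  have hfj0 : 0 < f j := hq0.trans_le hfj
  have hj1 : (j : ℝ) ≤ N * z + 1 := by
    rcases j with _ | j
    · simp; positivity
    · have h := hstep j (by omega)
      have hm := hmax j (Finset.mem_range.2 (by omega))
      have hjN' : (j : ℝ) + 1 ≤ N := by exact_mod_cast hjN
      have : f j * ((N - j) * z) ≤ f (j + 1) * ((N - j) * z) :=
        mul_le_mul_of_nonneg_right hm (by nlinarith)
      rw [← h] at this
      have := le_of_mul_le_mul_left this hfj0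
      push_cast
      nlinarith
  have hj2 : N * z ≤ (j : ℝ) + 1 := by
    by_cases hlt : j < N
    · have h := hstep j hlt
      have hm := hmax (j + 1) (Finset.mem_range.2 (by omega))
      have : f (j + 1) * ((j + 1) * (1 - z)) ≤ f j * ((j + 1) * (1 - z)) :=
        mul_le_mul_of_nonneg_right hm (by positivity)
      rw [h] at this
      have := le_of_mul_le_mul_left this hfj0
      nlinarith
    · obtain rfl : j = N := by omega
      nlinarith [(Nat.cast_nonneg j : (0 : ℝ) ≤ j)]
  have key : ∀ d, d ≤ D + 1 → q ^ d * f j ≤ f s → q ^ (D + 2) ≤ f s := by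
    intro d hd h
    calc q ^ (D + 2) ≤ q ^ (d + 1) := pow_le_pow_of_le_one hq0.le hq2 (by omega)
      _ = q ^ d * q := pow_succ _ _
      _ ≤ q ^ d * f j := mul_le_mul_of_nonneg_left hfj (by positivity)
      _ ≤ _ := h
  have goal : q ^ (D + 2) ≤ f s := by
    rcases le_total j s with hjs | hjs
    · obtain ⟨d, rfl⟩ := Nat.exists_eq_add_of_le hjs
      refine key d ?_ (hup' d j hs)
      have : (d : ℝ) ≤ ((D + 1 : ℕ) : ℝ) := by push_cast at h1 ⊢; linarith
      exact_mod_cast this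
    · obtain ⟨d, rfl⟩ := Nat.exists_eq_add_of_le hjs
      refine key d ?_ (hdown' d s hjN)
      have : (d : ℝ) ≤ ((D + 1 : ℕ) : ℝ) := by push_cast at hj1 ⊢; linarith
      exact_mod_cast this
  rw [hf] at goal
  rw [← hq]
  exact goal

theorem multichoose_near_mode {z : ℝ} (hz : 0 < z) (hz1 : z < 1) {m s D : ℕ} (hm : 1 ≤ m)
    (h1 : (s : ℝ) ≤ (m + s) * z + D) (h2 : (m + s) * z ≤ (s : ℝ) + D) :
    (z * (1 - z) / (m + s + 1)) ^ (D + 3) ≤ (m.multichoose s : ℝ) * z ^ s * (1 - z) ^ m := by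
  have h := choose_near_mode hz hz1 (N := m + s) (s := s) (D := D) (by omega)
    (by push_cast; exact h1) (by push_cast; exact h2)
  rw [Nat.add_sub_cancel] at h
  push_cast at h
  have hz2 : 0 < 1 - z := by linarith
  have hN : (0 : ℝ) < m + s + 1 := by positivity
  have hch : ((m + s).choose s : ℝ) ≤ (m + s + 1) * m.multichoose s := by
    have : (m + s).choose s ≤ (m + s) * m.multichoose s := by
      rw [Nat.multichoose_eq]
      have h3 := Nat.choose_mul_succ_eq (m + s - 1) s
      rw [show m + s - 1 + 1 = m + s by omega, show m + s - s = m by omega] at h3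
      calc (m + s).choose s ≤ (m + s).choose s * m := Nat.le_mul_of_pos_right _ hm
        _ = _ := by rw [← h3]; ring
    have : ((m + s).choose s : ℝ) ≤ (m + s) * m.multichoose s := by exact_mod_cast this
    have h4 : (0 : ℝ) ≤ m.multichoose s := Nat.cast_nonneg _
    linarith
  have hzz : z * (1 - z) ≤ 1 := by nlinarith
  calc (z * (1 - z) / (m + s + 1)) ^ (D + 3)
      = (z * (1 - z) / (m + s + 1)) ^ (D + 2) * (z * (1 - z) / (m + s + 1)) := pow_succ _ _
    _ ≤ ((m + s).choose s * z ^ s * (1 - z) ^ m) * (1 / (m + s + 1)) := by gcongr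
    _ ≤ ((m + s + 1) * m.multichoose s * z ^ s * (1 - z) ^ m) * (1 / (m + s + 1)) := by gcongr
    _ = _ := by field_simp

end NCPath

namespace NCPath

set_option maxHeartbeats 2000000 in
theorem Critical.le_descendants {x y F : ℝ} (hc : Critical x y F) :
    ∃ (c : ℝ) (d : ℕ), 0 < c ∧
      ∀ m : ℕ, c * (1 / x) ^ m / (m + 1) ^ d ≤ (descendants m 1 0 : ℝ) := by
  have hx := hc.x_pos
  have hx1 : 0 < 1 - x := by linarith [hc.x_lt]
  have hy := hc.y_pos
  have hy1 : 0 < 1 - y := by linarith [hc.y_lt]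
  have hF1 : 0 < F - 1 := by linarith [hc.F_gt]
  have hF : 0 < F := by linarith [hc.F_gt]
  have hm := hc.mul_F
  have hcr := hc.critical
  obtain ⟨θ, hθ⟩ : ∃ θ, θ = x * y / ((F - 1) * (1 - y) ^ 2) := ⟨_, rfl⟩
  obtain ⟨φ, hφ⟩ : ∃ φ, φ = 1 / (F - 1) := ⟨_, rfl⟩
  have hφ0 : 0 < φ := by rw [hφ]; positivity
  have hφF : φ * (F - 1) = 1 := by rw [hφ]; field_simp
  have hθ0 : 0 < θ := by rw [hθ]; positivity
  have hθF : θ * (F - 1) * (1 - y) ^ 2 = x * y := by rw [hθ]; field_simp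
  have hθ' : (1 - θ) * (F - 1) = (1 - x) * y := by
    rw [hθ, sub_mul, div_mul_eq_mul_div, hc.balance]
    have := hc.balance
    field_simp
    ring
  have hθ1 : 0 < 1 - θ := by
    have : 0 < (1 - θ) * (F - 1) := by rw [hθ']; positivity
    exact (mul_pos_iff_of_pos_right hF1).1 this
  have hθy : 2 * θ * y = φ * (1 - y) := by
    have h1 : 2 * θ * y * ((F - 1) * (1 - y) ^ 2) = φ * (1 - y) * ((F - 1) * (1 - y) ^ 2) := by
      linear_combination 2 * y * hθF + hcr - (1 - y) ^ 3 * hφF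
    exact mul_right_cancel₀ (by positivity) h1
  obtain ⟨κ, hκ⟩ : ∃ κ, κ = 1 + θ + φ + (θ + φ) * (x / (1 - x)) := ⟨_, rfl⟩
  have hκ1 : 1 + θ + φ ≤ κ := by
    rw [hκ]
    have : 0 ≤ (θ + φ) * (x / (1 - x)) := by positivity
    linarith
  have hκ0 : 0 < κ := by linarith
  have hκx : (1 - x) * κ = 1 - x + θ + φ := by rw [hκ]; field_simp; ring
  obtain ⟨z, hz⟩ : ∃ z, z = 1 / F := ⟨_, rfl⟩
  have hz0 : 0 < z := by rw [hz]; positivity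
  have hzF : z * F = 1 := by rw [hz]; field_simp
  have hz1 : 0 < 1 - z := by
    have : 0 < (1 - z) * F := by linarith
    exact (mul_pos_iff_of_pos_right hF).1 this
  have hxz : x = (1 - x) * y * z := by linear_combination z * hm - x * hzF
  have hφz : φ * (1 - z) = z := by linear_combination z * hφF - φ * hzF
  obtain ⟨q, hq⟩ : ∃ q, q = θ * (1 - θ) * (y * (1 - y)) * (x * (1 - x)) * (z * (1 - z)) := ⟨_, rfl⟩
  have hle1 : ∀ w : ℝ, 0 < w → 0 < 1 - w → w * (1 - w) ≤ 1 := fun w h1 h2 => by nlinarith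
  have l1 := hle1 θ hθ0 hθ1
  have l2 := hle1 y hy hy1
  have l3 := hle1 x hx hx1
  have l4 := hle1 z hz0 hz1
  have hq0 : 0 < q := by rw [hq]; positivity
  have hqθ : q ≤ θ * (1 - θ) := by
    rw [hq, mul_assoc, mul_assoc]
    refine mul_le_of_le_one_right (by positivity) ?_
    exact mul_le_one₀ l2 (by positivity) (mul_le_one₀ l3 (by positivity) l4)
  have hqy : q ≤ y * (1 - y) := by
    rw [hq, mul_assoc, mul_comm (θ * (1 - θ)), mul_assoc]
    refine mul_le_of_le_one_right (by positivity) ?_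
    exact mul_le_one₀ l1 (by positivity) (mul_le_one₀ l3 (by positivity) l4)
  have hqx : q ≤ x * (1 - x) := by
    rw [hq, mul_comm _ (x * (1 - x)), mul_assoc]
    refine mul_le_of_le_one_right (by positivity) ?_
    exact mul_le_one₀ (mul_le_one₀ l1 (by positivity) l2) (by positivity) l4
  have hqz : q ≤ z * (1 - z) := by
    rw [hq, mul_comm _ (z * (1 - z))]
    refine mul_le_of_le_one_right (by positivity) ?_
    exact mul_le_one₀ (mul_le_one₀ l1 (by positivity) l2) (by positivity) l3
  have hq1 : q ≤ 1 := hqθ.trans l1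
  obtain ⟨D, hD⟩ : ∃ D : ℕ, κ + 2 ≤ D := exists_nat_ge _
  have hD2 : 2 ≤ D := by
    have : ((2 : ℕ) : ℝ) ≤ D := by push_cast; linarith
    exact_mod_cast this
  obtain ⟨n₀, hn₀⟩ : ∃ n₀ : ℕ, κ * (1 / θ + 2) ≤ n₀ := exists_nat_ge _
  have hweak : ∀ (m N e : ℕ) (w : ℝ), q ≤ w → N ≤ m → e ≤ D + 3 →
      (q / (m + 1)) ^ (D + 3) ≤ (w / (N + 1)) ^ e := by
    intro m N e w hw hN he
    have hm0 : (0 : ℝ) < m + 1 := by positivity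
    have h1 : q / (m + 1) ≤ 1 := by
      rw [div_le_one hm0]
      linarith [(Nat.cast_nonneg m : (0 : ℝ) ≤ m)]
    refine (pow_le_pow_of_le_one (by positivity) h1 he).trans ?_
    have : (N : ℝ) ≤ m := Nat.cast_le.2 hN
    have : 0 < w := hq0.trans_le hw
    gcongr
  have hlarge : ∀ m : ℕ, n₀ ≤ m →
      (q / (m + 1)) ^ (4 * (D + 3)) ≤ (m + 1) * (descendants m 1 0 : ℝ) * x ^ m := by
    intro m hmn
    have hmn' : κ * (1 / θ + 2) ≤ m := hn₀.trans (Nat.cast_le.2 hmn)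
    obtain ⟨B, hB⟩ : ∃ B, B = ⌊(m : ℝ) / κ⌋₊ := ⟨_, rfl⟩
    obtain ⟨k, hk⟩ : ∃ k, k = ⌊θ * B⌋₊ := ⟨_, rfl⟩
    obtain ⟨E, hE⟩ : ∃ E, E = ⌊φ * B⌋₊ := ⟨_, rfl⟩
    have hB1 : (B : ℝ) ≤ m / κ := by rw [hB]; exact Nat.floor_le (by positivity)
    have hB2 : (m : ℝ) / κ < B + 1 := by rw [hB]; exact Nat.lt_floor_add_one _
    have hk1 : (k : ℝ) ≤ θ * B := by rw [hk]; exact Nat.floor_le (by positivity)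
    have hk2 : θ * B < k + 1 := by rw [hk]; exact Nat.lt_floor_add_one _
    have hE1 : (E : ℝ) ≤ φ * B := by rw [hE]; exact Nat.floor_le (by positivity)
    have hE2 : φ * B < E + 1 := by rw [hE]; exact Nat.lt_floor_add_one _
    rw [le_div_iff₀ hκ0] at hB1
    rw [div_lt_iff₀ hκ0] at hB2
    have hBB : 1 / θ + 1 < B := by
      have : κ * (1 / θ + 2) < κ * (B + 1) := by linarith
      linarith [lt_of_mul_lt_mul_left this hκ0.le]
    have hB0 : 1 ≤ B := by
      have h0 : 0 < 1 / θ := by positivity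
      have : ((1 : ℕ) : ℝ) ≤ B := by push_cast; linarith
      exact_mod_cast this
    have hB0' : (1 : ℝ) ≤ B := by exact_mod_cast hB0
    have hk0 : 1 ≤ k := by
      have h1 : θ * (1 / θ) = 1 := by field_simp
      have h2 : θ * (1 / θ + 1) < θ * B := mul_lt_mul_of_pos_left hBB hθ0
      have : ((0 : ℕ) : ℝ) < k := by push_cast; linarith
      exact_mod_cast this
    have hkB : k ≤ B := by
      have : (k : ℝ) ≤ B := hk1.trans (mul_le_of_le_one_left (by linarith) (by linarith))
      exact_mod_cast this
    have hsum : B + k + E ≤ m := by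
      have h1 : (B : ℝ) * (1 + θ + φ) ≤ B * κ := mul_le_mul_of_nonneg_left hκ1 (by linarith)
      have : ((B + k + E : ℕ) : ℝ) ≤ m := by push_cast; linarith
      exact_mod_cast this
    obtain ⟨U, rfl⟩ := Nat.exists_eq_add_of_le hsum
    obtain ⟨r, rfl⟩ := Nat.exists_eq_add_of_le hkB
    obtain ⟨b, hb⟩ : ∃ b, k + r = b + 1 := ⟨k + r - 1, by omega⟩
    push_cast at hB1 hB2 hk1 hk2 hE1 hE2 hB0'
    have hclosed := closed_le_descendants b k E U
    rw [← hb] at hclosed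
    have hD' : (2 : ℝ) ≤ D := by exact_mod_cast hD2
    have c1 := choose_near_mode hθ0 (by linarith) (N := k + r) (s := k) (D := D) (by omega)
      (by push_cast; linarith) (by push_cast; linarith)
    have a1 := mul_le_mul_of_nonneg_right hE1 hy1.le
    have a2 := mul_lt_mul_of_pos_left hk2 hy
    have a3 := mul_le_mul_of_nonneg_left hk1 hy.le
    have a4 := mul_lt_mul_of_pos_right hE2 hy1
    have a5 : 2 * θ * y * (k + r) = φ * (1 - y) * (k + r) := by rw [hθy]
    have c2 := multichoose_near_mode hy (by linarith) (m := 2 * k) (s := E) (D := D) (by omega)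
      (by push_cast; linarith) (by push_cast; linarith)
    have b1 := mul_lt_mul_of_pos_left hB2 hx1
    have b2 := mul_le_mul_of_nonneg_left hB1 hx1.le
    have b3 : (1 - x) * κ * (k + r) = (1 - x + θ + φ) * (k + r) := by rw [hκx]
    have b4 : 0 ≤ x * κ := by positivity
    have c3 := multichoose_near_mode hx (by linarith) (m := E + k) (s := U) (D := D) (by omega)
      (by push_cast; linarith) (by push_cast; linarith)
    have d1 := mul_le_mul_of_nonneg_right hE1 hz1.le
    have d2 := mul_lt_mul_of_pos_right hE2 hz1
    have d3 : φ * (1 - z) * (k + r) = z * (k + r) := by rw [hφz]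
    have c4 := multichoose_near_mode hz0 (by linarith) (m := k + r) (s := E) (D := D) (by omega)
      (by push_cast; linarith) (by push_cast; linarith)
    have w1 := (hweak (k + r + k + E + U) (k + r) _ _ hqθ (by omega) (by omega)).trans c1
    have w2 := (hweak (k + r + k + E + U) (2 * k + E) (D + 3) _ hqy (by omega) le_rfl).trans
      (by push_cast at c2 ⊢; exact c2)
    have w3 := (hweak (k + r + k + E + U) (E + k + U) (D + 3) _ hqx (by omega) le_rfl).trans
      (by push_cast at c3 ⊢; exact c3)
    have w4 := (hweak (k + r + k + E + U) (k + r + E) (D + 3) _ hqz (by omega) le_rfl).trans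
      (by push_cast at c4 ⊢; exact c4)
    have hpow : θ ^ k * (1 - θ) ^ (k + r - k) * (y ^ E * (1 - y) ^ (2 * k)) *
        (x ^ U * (1 - x) ^ (E + k)) * (z ^ E * (1 - z) ^ (k + r)) = x ^ (k + r + k + E + U) := by
      have e1 : θ * (1 - y) ^ 2 * (1 - x) * (1 - z) = x ^ 2 := by
        linear_combination (1 - x) * z * hθF + x * hxz * (-1) - θ * (1 - y) ^ 2 * (1 - x) * hzF
      have e2 : (1 - θ) * (1 - z) = x := by
        linear_combination z * hθ' - hxz - (1 - θ) * hzF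
      have e3 : y * (1 - x) * z = x := by linear_combination -hxz
      rw [Nat.add_sub_cancel_left]
      calc _ = (θ * (1 - y) ^ 2 * (1 - x) * (1 - z)) ^ k * ((1 - θ) * (1 - z)) ^ r *
            (y * (1 - x) * z) ^ E * x ^ U := by
            simp only [mul_pow, ← pow_mul]
            ring
        _ = _ := by rw [e1, e2, e3]; ring
    have hp0 : 0 ≤ (q / ((k + r + k + E + U : ℕ) + 1)) ^ (D + 3) := by positivity
    calc (q / ((k + r + k + E + U : ℕ) + 1)) ^ (4 * (D + 3))
        = (q / ((k + r + k + E + U : ℕ) + 1)) ^ (D + 3) *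
          (q / ((k + r + k + E + U : ℕ) + 1)) ^ (D + 3) *
          (q / ((k + r + k + E + U : ℕ) + 1)) ^ (D + 3) *
          (q / ((k + r + k + E + U : ℕ) + 1)) ^ (D + 3) := by ring
      _ ≤ (((k + r).choose k : ℝ) * θ ^ k * (1 - θ) ^ (k + r - k)) *
          (((2 * k).multichoose E : ℝ) * y ^ E * (1 - y) ^ (2 * k)) *
          (((E + k).multichoose U : ℝ) * x ^ U * (1 - x) ^ (E + k)) *
          (((k + r).multichoose E : ℝ) * z ^ E * (1 - z) ^ (k + r)) := by gcongr
      _ = (((k + r).choose k * (2 * k).multichoose E * (E + k).multichoose U *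
          (k + r).multichoose E : ℕ) : ℝ) * x ^ (k + r + k + E + U) := by
          rw [← hpow]; push_cast; ring
      _ ≤ (((k + r) * descendants (k + r + k + E + U) 1 0 : ℕ) : ℝ) *
          x ^ (k + r + k + E + U) := by gcongr
      _ ≤ _ := by
          push_cast
          refine mul_le_mul_of_nonneg_right (mul_le_mul_of_nonneg_right ?_ (Nat.cast_nonneg _))
            (by positivity)
          have h0 : (0 : ℝ) ≤ k := Nat.cast_nonneg k
          have h1 : (0 : ℝ) ≤ E := Nat.cast_nonneg E
          have h2 : (0 : ℝ) ≤ U := Nat.cast_nonneg U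
          linarith
  refine ⟨min (q ^ (4 * (D + 3))) (x ^ n₀), 4 * (D + 3) + 1, by positivity, fun m => ?_⟩
  have hm0 : (0 : ℝ) < m + 1 := by positivity
  have hm1 : (1 : ℝ) ≤ m + 1 := by linarith [(Nat.cast_nonneg m : (0 : ℝ) ≤ m)]
  rw [one_div, inv_pow, div_le_iff₀ (by positivity), ← div_eq_mul_inv, div_le_iff₀ (by positivity)]
  by_cases hmn : n₀ ≤ m
  · refine (min_le_left _ _).trans ?_
    have := hlarge m hmn
    rw [div_pow, div_le_iff₀ (by positivity)] at this
    calc _ ≤ _ := this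
      _ = _ := by ring
  · refine (min_le_right _ _).trans ?_
    have h1 : (1 : ℝ) ≤ descendants m 1 0 := by exact_mod_cast one_le_descendants m 1 0
    have h2 : x ^ n₀ ≤ x ^ m := pow_le_pow_of_le_one hx.le (by linarith) (by omega)
    calc x ^ n₀ ≤ 1 * 1 * x ^ m := by simpa using h2
      _ ≤ _ := by gcongr; exact one_le_pow₀ hm1

end NCPath

namespace NCPath

open SimpleGraph

/-! ### The list of endpoints -/

/-- Consecutive entries of the list form pairs that lie in distinct components of `G`. -/
def Paired {V : Type*} (G : SimpleGraph V) : List V → Prop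
  | [] => True
  | [_] => False
  | a :: b :: l => G.Reachable a b ∧ (∀ x ∈ l, ¬ G.Reachable a x) ∧ Paired G l

section

variable {n : ℕ} {G : SimpleGraph (Fin n)}

theorem count_endpointList (G : SimpleGraph (Fin n)) (v : Fin n) :
    (endpointList G).count v = 2 - deg G v := by
  rw [endpointList, List.count_flatMap]
  simp only [Function.comp_def, List.count_replicate, beq_iff_eq]
  rw [← List.sum_toFinset _ (List.nodup_finRange n), List.toFinset_finRange,
    Finset.sum_ite_eq' Finset.univ v, if_pos (Finset.mem_univ v)]

theorem mem_endpointList {v : Fin n} : v ∈ endpointList G ↔ IsEndpoint G v := by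
  rw [← List.count_pos_iff, count_endpointList, IsEndpoint]
  omega

theorem pairwise_endpointList (G : SimpleGraph (Fin n)) : (endpointList G).Pairwise (· ≤ ·) := by
  rw [endpointList, List.pairwise_flatMap]
  refine ⟨fun a _ => List.pairwise_replicate.2 (Or.inr le_rfl), ?_⟩
  refine (List.pairwise_lt_finRange n).imp ?_
  intro a b hab x hx y hy
  rw [List.eq_of_mem_replicate hx, List.eq_of_mem_replicate hy]
  exact hab.le

theorem Ord.paired_of_closed (hG : Ord G) (m : ℕ) : ∀ l : List (Fin n), l.length ≤ m →
    l.Pairwise (· ≤ ·) → (∀ v ∈ l, IsEndpoint G v) →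
    (∀ v ∈ l, ∀ u, G.Reachable v u → IsEndpoint G u → l.count u = 2 - deg G u) → Paired G l := by
  induction m with
  | zero =>
    intro l hl _ _ _
    rw [List.eq_nil_of_length_eq_zero (Nat.le_zero.1 hl)]
    trivial
  | succ m ih =>
    intro l hl hs he hc
    rcases l with _ | ⟨a, l⟩
    · trivial
    have hea := he a (by simp)
    have hca := hc a (by simp) a (Reachable.refl _) hea
    obtain ⟨p, q, hp, hq, hp', hq', honly, hsingle⟩ := exists_endpoints hG.acyclic hG.deg_le_two a
    -- the other endpoint of the path of `a`
    obtain ⟨b, hb, hb', honly, hsingle⟩ : ∃ b, G.Reachable a b ∧ IsEndpoint G b ∧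
        (∀ u, G.Reachable a u → IsEndpoint G u → u = a ∨ u = b) ∧
        (a = b → ∀ u, G.Reachable a u → u = a) := by
      rcases honly a (Reachable.refl _) hea with rfl | rfl
      · exact ⟨q, hq, hq', honly, hsingle⟩
      · exact ⟨p, hp, hp', fun u h1 h2 => (honly u h1 h2).symm,
          fun h u hu => (hsingle h.symm u hu).trans h.symm⟩
    have hcb := hc a (by simp) b hb hb'
    have hda : a ≠ b → deg G a = 1 ∧ deg G b = 1 := by
      intro hne
      have h1 : deg G a ≠ 0 := fun h0 =>
        hne (eq_of_reachable_of_deg_eq_zero h0 hb).symm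
      have h2 : deg G b ≠ 0 := fun h0 => hne (eq_of_reachable_of_deg_eq_zero h0 hb.symm)
      unfold IsEndpoint at hea hb'
      omega
    have hda' : a = b → deg G a = 0 := fun h => deg_eq_zero.2 fun x hx =>
      hx.ne (hsingle h x hx.reachable).symm
    have hbl : b ∈ l := by
      by_cases hab : a = b
      · rw [hda' hab] at hca
        rw [List.count_cons_self] at hca
        rw [← hab, ← List.count_pos_iff]
        omega
      · rw [(hda hab).2, List.count_cons_of_ne hab] at hcb
        rw [← List.count_pos_iff]
        omega
    rcases l with _ | ⟨c, l⟩
    · simp at hbl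
    have hac : a ≤ c := List.rel_of_pairwise_cons hs (by simp)
    have hcle : ∀ x ∈ c :: l, c ≤ x := by
      intro x hx
      rcases List.mem_cons.1 hx with rfl | hx
      · exact le_rfl
      · exact List.rel_of_pairwise_cons hs.of_cons hx
    have hcb' : c ≤ b := hcle b hbl
    obtain rfl : b = c := by
      by_contra hne
      by_cases hab : a = b
      · exact hne (le_antisymm (hab ▸ hac) hcb')
      by_cases hac' : a = c
      · rw [(hda hab).1, ← hac', List.count_cons_self, List.count_cons_self] at hca
        omega
      · exact hG.ordered a b c (lt_of_lt_of_le (lt_of_le_of_ne hac hac') hcb') hea hb' hb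
          (lt_of_le_of_ne hac hac') (lt_of_le_of_ne hcb' (Ne.symm hne)) (he c (by simp))
    have hal : a ∉ l ∧ b ∉ l := by
      rw [← List.count_eq_zero, ← List.count_eq_zero]
      by_cases hab : a = b
      · subst hab
        rw [hda' rfl, List.count_cons_self, List.count_cons_self] at hca
        omega
      · rw [(hda hab).1, List.count_cons_self, List.count_cons_of_ne (Ne.symm hab)] at hca
        rw [(hda hab).2, List.count_cons_of_ne hab, List.count_cons_self] at hcb
        omega
    have hsep : ∀ x ∈ l, ¬ G.Reachable a x := by
      intro x hx hr
      rcases honly x hr (he x (by simp [hx])) with rfl | rfl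
      · exact hal.1 hx
      · exact hal.2 hx
    refine ⟨hb, hsep, ih l (by simp at hl; omega) hs.of_cons.of_cons
      (fun v hv => he v (by simp [hv])) fun v hv u hvu hu => ?_⟩
    rw [← hc v (by simp [hv]) u hvu hu, List.count_cons_of_ne, List.count_cons_of_ne]
    · rintro rfl
      exact hsep v hv (hb.trans hvu.symm)
    · rintro rfl
      exact hsep v hv hvu.symm

theorem Ord.paired (hG : Ord G) : Paired G (endpointList G) :=
  hG.paired_of_closed _ _ le_rfl (pairwise_endpointList G) (fun _ => mem_endpointList.1)
    fun _ _ u _ _ => count_endpointList G u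

end

theorem Paired.card_components {V : Type*} {G : SimpleGraph V} [DecidableEq G.ConnectedComponent]
    (m : ℕ) : ∀ l : List V, l.length ≤ m → Paired G l →
    2 * (l.map G.connectedComponentMk).toFinset.card = l.length := by
  induction m with
  | zero =>
    intro l hl _
    rw [List.eq_nil_of_length_eq_zero (Nat.le_zero.1 hl)]
    simp
  | succ m ih =>
    intro l hl hp
    rcases l with _ | ⟨a, _ | ⟨b, l⟩⟩
    · simp
    · exact hp.elim
    · obtain ⟨hab, hsep, hp⟩ := hp
      have hab' : G.connectedComponentMk a = G.connectedComponentMk b :=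
        ConnectedComponent.eq.2 hab
      have hna : G.connectedComponentMk b ∉ (l.map G.connectedComponentMk).toFinset := by
        rw [List.mem_toFinset, List.mem_map]
        rintro ⟨x, hx, h⟩
        exact hsep x hx (hab.trans (ConnectedComponent.eq.1 h).symm)
      rw [List.map_cons, List.map_cons, hab', List.toFinset_cons, List.toFinset_cons,
        Finset.insert_eq_of_mem (Finset.mem_insert_self _ _), Finset.card_insert_of_notMem hna,
        mul_add, ih l (by simp at hl; omega) hp]
      simp

theorem Ord.exists_endpoint {n : ℕ} {G : SimpleGraph (Fin n)} (hG : Ord G) (v : Fin n) :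
    ∃ u ∈ endpointList G, G.Reachable v u := by
  obtain ⟨a, _, ha, -, ha', -⟩ := exists_endpoints hG.acyclic hG.deg_le_two v
  exact ⟨a, mem_endpointList.2 ha', ha⟩

theorem Ord.length_endpointList {n : ℕ} {G : SimpleGraph (Fin n)} (hG : Ord G) :
    (endpointList G).length = 2 * numPaths G := by
  classical
  have : Fintype G.ConnectedComponent := Fintype.ofFinite _
  rw [← Paired.card_components _ _ le_rfl hG.paired, numPaths, Nat.card_eq_fintype_card,
    ← Finset.card_univ]
  congr 2
  rw [Finset.eq_univ_iff_forall]
  intro c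
  induction c using ConnectedComponent.ind with
  | _ v =>
    obtain ⟨u, hu, hr⟩ := hG.exists_endpoint v
    rw [List.mem_toFinset, List.mem_map]
    exact ⟨u, hu, ConnectedComponent.eq.2 hr.symm⟩

/-! ### Degrees of graphs with links -/

theorem ncard_setOf_mem {α β : Type*} [DecidableEq α] {M : List (α × β)} (hM : M.Nodup) (i : α) :
    {j | (i, j) ∈ M}.ncard = (M.map Prod.fst).count i := by
  classical
  have : {j | (i, j) ∈ M} = ((((M.filter fun x => x.1 = i).map Prod.snd).toFinset : Finset β) : Set β)
      := by
    ext j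
    simp
  rw [this, Set.ncard_coe_finset, List.toFinset_card_of_nodup, List.length_map,
    ← List.countP_eq_length_filter, List.count, List.countP_map]
  · exact List.countP_congr fun x _ => by simp
  · refine (hM.filter _).map_on ?_
    intro x hx y hy h
    have h1 : x.1 = i := by simpa using (List.mem_filter.1 hx).2
    have h2 : y.1 = i := by simpa using (List.mem_filter.1 hy).2
    exact Prod.ext (h1.trans h2.symm) h

theorem deg_linkGraph_inl {m n : ℕ} (G : SimpleGraph (Fin m)) (H : SimpleGraph (Fin n))
    {M : List (Fin m × Fin n)} (hM : M.Nodup) (i : Fin m) :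
    deg (linkGraph G H M) (.inl i) = deg G i + (M.map Prod.fst).count i := by
  rw [← ncard_setOf_mem hM, deg, deg]
  have : (linkGraph G H M).neighborSet (.inl i) =
      Sum.inl '' G.neighborSet i ∪ Sum.inr '' {j | (i, j) ∈ M} := by
    ext (x | x) <;> simp [linkGraph]
  rw [this, Set.ncard_union_eq, Set.ncard_image_of_injective _ Sum.inl_injective,
    Set.ncard_image_of_injective _ Sum.inr_injective]
  rw [Set.disjoint_left]
  rintro _ ⟨x, _, rfl⟩ ⟨y, _, h⟩
  simp at h

theorem deg_linkGraph_inr {m n : ℕ} (G : SimpleGraph (Fin m)) (H : SimpleGraph (Fin n))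
    {M : List (Fin m × Fin n)} (hM : M.Nodup) (j : Fin n) :
    deg (linkGraph G H M) (.inr j) = deg H j + (M.map Prod.snd).count j := by
  have h1 := ncard_setOf_mem (hM.map Prod.swap_injective) j
  rw [List.map_map] at h1
  have : (linkGraph G H M).neighborSet (.inr j) =
      Sum.inr '' H.neighborSet j ∪ Sum.inl '' {i | (j, i) ∈ M.map Prod.swap} := by
    ext (x | x) <;> simp [linkGraph]
  rw [deg, this, Set.ncard_union_eq, Set.ncard_image_of_injective _ Sum.inr_injective,
    Set.ncard_image_of_injective _ Sum.inl_injective, h1]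
  · rfl
  rw [Set.disjoint_left]
  rintro _ ⟨x, _, rfl⟩ ⟨y, _, h⟩
  simp at h

/-- The embedding of the upper graph. -/
def linkInl {m n : ℕ} (G : SimpleGraph (Fin m)) (H : SimpleGraph (Fin n))
    (M : List (Fin m × Fin n)) : G →g linkGraph G H M := ⟨Sum.inl, fun h => h⟩

/-- The embedding of the lower graph. -/
def linkInr {m n : ℕ} (G : SimpleGraph (Fin m)) (H : SimpleGraph (Fin n))
    (M : List (Fin m × Fin n)) : H →g linkGraph G H M := ⟨Sum.inr, fun h => h⟩

/-! ### Alternating between two paired lists -/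

section

variable {m n : ℕ} {G : SimpleGraph (Fin m)} {H : SimpleGraph (Fin n)}

theorem Paired.nodup_zip (l : ℕ) : ∀ (e : List (Fin m)) (f : List (Fin n)), e.length ≤ l →
    Paired G e → Paired H f → e.length = f.length → (e.tail.zip f.dropLast).Nodup := by
  induction l with
  | zero =>
    intro e f he _ _ _
    rw [List.eq_nil_of_length_eq_zero (Nat.le_zero.1 he)]
    simp
  | succ l ih =>
    intro e f he hG hH hl
    rcases e with _ | ⟨a, _ | ⟨b, e⟩⟩
    · simp
    · simp
    rcases f with _ | ⟨c, _ | ⟨d, f⟩⟩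
    · simp
    · simp
    rcases e with _ | ⟨a', e⟩
    · rcases f with _ | ⟨c', f⟩
      · simp
      · simp at hl
    rcases f with _ | ⟨c', f⟩
    · simp at hl
    obtain ⟨hab, hsep, hG⟩ := hG
    obtain ⟨hcd, hsep', hH⟩ := hH
    have := ih (a' :: e) (c' :: f) (by simp at he ⊢; omega) hG hH (by simpa using hl)
    simp only [List.tail_cons, List.dropLast_cons_cons, List.zip_cons_cons, List.nodup_cons] at this ⊢
    refine ⟨?_, ?_, this⟩
    · rw [List.mem_cons, not_or]
      constructor
      · intro h
        rw [Prod.mk.injEq] at h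
        exact hsep a' (by simp) (h.1 ▸ hab)
      · intro h
        exact hsep b (List.mem_cons_of_mem _ (List.of_mem_zip h).1) hab
    · intro h
      exact hsep' d (List.dropLast_subset _ (List.of_mem_zip h).2) hcd

theorem Paired.reachable (M : List (Fin m × Fin n)) (l : ℕ) :
    ∀ (e : List (Fin m)) (f : List (Fin n)), e.length ≤ l → Paired G e → Paired H f →
    e.length = f.length → (∀ x ∈ e.tail.zip f.dropLast, x ∈ M) → ∀ v ∈ e.head?,
    (∀ x ∈ e, (linkGraph G H M).Reachable (.inl v) (.inl x)) ∧
    ∀ x ∈ f, (linkGraph G H M).Reachable (.inl v) (.inr x) := by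
  induction l with
  | zero =>
    intro e f he _ _ _ _ v hv
    rw [List.eq_nil_of_length_eq_zero (Nat.le_zero.1 he)] at hv
    simp at hv
  | succ l ih =>
    intro e f he hG hH hl hM v hv
    rcases e with _ | ⟨a, _ | ⟨b, e⟩⟩
    · simp at hv
    · exact hG.elim
    rcases f with _ | ⟨c, _ | ⟨d, f⟩⟩
    · simp at hl
    · exact hH.elim
    obtain rfl : a = v := by simpa using hv
    obtain ⟨hab, hsep, hG⟩ := hG
    obtain ⟨hcd, hsep', hH⟩ := hH
    have r1 := hab.map (linkInl G H M)
    have r2 := hcd.map (linkInr G H M)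
    have hbc : (linkGraph G H M).Adj (.inl b) (.inr c) := hM (b, c) (by simp)
    have r3 : (linkGraph G H M).Reachable (.inl a) (.inl b) := r1
    have r4 : (linkGraph G H M).Reachable (.inl a) (.inr c) := r3.trans hbc.reachable
    have r5 : (linkGraph G H M).Reachable (.inl a) (.inr d) := r4.trans r2
    rcases e with _ | ⟨a', e⟩
    · rcases f with _ | ⟨c', f⟩
      · constructor
        · intro x hx
          simp only [List.mem_cons, List.not_mem_nil, or_false] at hx
          rcases hx with rfl | rfl
          · exact Reachable.refl _
          · exact r3
        · intro x hx
          simp only [List.mem_cons, List.not_mem_nil, or_false] at hx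
          rcases hx with rfl | rfl
          · exact r4
          · exact r5
      · simp at hl
    rcases f with _ | ⟨c', f⟩
    · simp at hl
    have hda : (linkGraph G H M).Adj (.inl a') (.inr d) := hM (a', d) (by simp)
    have r6 : (linkGraph G H M).Reachable (.inl a) (.inl a') := r5.trans hda.symm.reachable
    obtain ⟨i1, i2⟩ := ih (a' :: e) (c' :: f) (by simp at he ⊢; omega) hG hH (by simpa using hl)
      (fun x hx => hM x (by
        simp only [List.tail_cons, List.dropLast_cons_cons, List.zip_cons_cons] at hx ⊢
        simp [hx])) a' (by simp)
    constructor
    · intro x hx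
      rcases List.mem_cons.1 hx with rfl | hx
      · exact Reachable.refl _
      rcases List.mem_cons.1 hx with rfl | hx
      · exact r3
      · exact r6.trans (i1 x hx)
    · intro x hx
      rcases List.mem_cons.1 hx with rfl | hx
      · exact r4
      rcases List.mem_cons.1 hx with rfl | hx
      · exact r5
      · exact r6.trans (i2 x hx)

end

end NCPath

namespace NCPath

open SimpleGraph

theorem pairwise_le_of_map {m n : ℕ} {M : List (Fin m × Fin n)}
    (h1 : (M.map Prod.fst).Pairwise (· ≤ ·)) (h2 : (M.map Prod.snd).Pairwise (· ≤ ·)) :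
    M.Pairwise fun x y => x.1 ≤ y.1 ∧ x.2 ≤ y.2 :=
  (List.pairwise_map.1 h1).and (List.pairwise_map.1 h2)

/-! ### The Hamiltonian path -/

section Join

variable {n : ℕ} {G H : SimpleGraph (Fin n)}

theorem map_fst_alternatingEdges (hl : (endpointList G).length = (endpointList H).length) :
    (alternatingEdges G H).map Prod.fst = (endpointList G).tail :=
  List.map_fst_zip (by simp [hl])

theorem map_snd_alternatingEdges (hl : (endpointList G).length = (endpointList H).length) :
    (alternatingEdges G H).map Prod.snd = (endpointList H).dropLast :=
  List.map_snd_zip (by simp [hl])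

theorem Ord.length_eq (hG : Ord G) (hH : Ord H) (hk : numPaths G = numPaths H) :
    (endpointList G).length = (endpointList H).length := by
  rw [hG.length_endpointList, hH.length_endpointList, hk]

theorem Ord.endpointList_ne_nil (hG : Ord G) (hn : 1 ≤ n) : endpointList G ≠ [] := by
  obtain ⟨u, hu, -⟩ := hG.exists_endpoint ⟨0, hn⟩
  exact List.ne_nil_of_mem hu

theorem Ord.nodup_alternatingEdges (hG : Ord G) (hH : Ord H) (hk : numPaths G = numPaths H) :
    (alternatingEdges G H).Nodup :=
  Paired.nodup_zip _ _ _ le_rfl hG.paired hH.paired (hG.length_eq hH hk)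

theorem Ord.connected_joinGraph (hG : Ord G) (hH : Ord H) (hn : 1 ≤ n)
    (hk : numPaths G = numPaths H) : (joinGraph G H).Connected := by
  rw [joinGraph_eq]
  obtain ⟨v, l, hv⟩ := List.exists_cons_of_ne_nil (hG.endpointList_ne_nil hn)
  obtain ⟨h1, h2⟩ := Paired.reachable (alternatingEdges G H) _ _ _ le_rfl hG.paired hH.paired
    (hG.length_eq hH hk) (fun _ h => h) v (by simp [hv])
  have h3 : ∀ x, (linkGraph G H (alternatingEdges G H)).Reachable (.inl v) x := by
    rintro (x | x)
    · obtain ⟨u, hu, hr⟩ := hG.exists_endpoint x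
      exact (h1 u hu).trans (hr.symm.map (linkInl G H _))
    · obtain ⟨u, hu, hr⟩ := hH.exists_endpoint x
      exact (h2 u hu).trans (hr.symm.map (linkInr G H _))
  have : Nonempty (Fin n ⊕ Fin n) := ⟨.inl v⟩
  exact ⟨fun x y => (h3 x).symm.trans (h3 y)⟩

theorem Ord.isHamiltonianPath_joinGraph (hG : Ord G) (hH : Ord H) (hn : 1 ≤ n)
    (hk : numPaths G = numPaths H) : IsHamiltonianPath (joinGraph G H) := by
  have hl := hG.length_eq hH hk
  have hM := hG.nodup_alternatingEdges hH hk
  have hconn := hG.connected_joinGraph hH hn hk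
  obtain ⟨v, l, hv⟩ := List.exists_cons_of_ne_nil (hG.endpointList_ne_nil hn)
  rw [joinGraph_eq] at hconn ⊢
  refine isHamiltonianPath_of_connected hconn ?_ ⟨.inl v, ?_⟩
  · rintro (i | i)
    · rw [deg_linkGraph_inl G H hM, map_fst_alternatingEdges hl]
      have h1 := (List.tail_sublist (endpointList G)).count_le i
      rw [count_endpointList] at h1
      have := hG.deg_le_two i
      omega
    · rw [deg_linkGraph_inr G H hM, map_snd_alternatingEdges hl]
      have h1 := (List.dropLast_sublist (endpointList H)).count_le i
      rw [count_endpointList] at h1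
      have := hH.deg_le_two i
      omega
  · rw [deg_linkGraph_inl G H hM, map_fst_alternatingEdges hl]
    have h1 := count_endpointList G v
    rw [hv, List.count_cons_self] at h1
    rw [hv, List.tail_cons]
    omega

theorem Ord.pairwise_alternatingEdges (hG : Ord G) (hH : Ord H) (hk : numPaths G = numPaths H) :
    (alternatingEdges G H).Pairwise fun x y => x.1 ≤ y.1 ∧ x.2 ≤ y.2 := by
  have hl := hG.length_eq hH hk
  refine pairwise_le_of_map ?_ ?_
  · rw [map_fst_alternatingEdges hl]
    exact (pairwise_endpointList G).sublist (List.tail_sublist _)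
  · rw [map_snd_alternatingEdges hl]
    exact (pairwise_endpointList H).sublist (List.dropLast_sublist _)

end Join

section Chains

variable {n : ℕ} {U L : Fin n → ℝ × ℝ}

theorem IsDoubleChain.upper_iff (h : IsDoubleChain U L) (G : SimpleGraph (Fin n)) :
    IsOrderedNCPPartition U G ↔ Ord G :=
  isOrderedNCPPartition_iff 1 (fun i j k hij hjk => by simpa using h.upper_convex i j k hij hjk) G

theorem IsDoubleChain.lower_iff (h : IsDoubleChain U L) (H : SimpleGraph (Fin n)) :
    IsOrderedNCPPartition L H ↔ Ord H :=
  isOrderedNCPPartition_iff (-1)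
    (fun i j k hij hjk => by simpa using h.lower_concave i j k hij hjk) H

theorem IsDoubleChain.upper_nonCrossing_iff (h : IsDoubleChain U L) (G : SimpleGraph (Fin n)) :
    NonCrossing U G ↔ NC G :=
  nonCrossing_iff_nc 1 (fun i j k hij hjk => by simpa using h.upper_convex i j k hij hjk) G

theorem IsDoubleChain.lower_nonCrossing_iff (h : IsDoubleChain U L) (H : SimpleGraph (Fin n)) :
    NonCrossing L H ↔ NC H :=
  nonCrossing_iff_nc (-1)
    (fun i j k hij hjk => by simpa using h.lower_concave i j k hij hjk) H

theorem IsDoubleChain.nonCrossing_of_nc (h : IsDoubleChain U L) (hn : 2 ≤ n)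
    {G H : SimpleGraph (Fin n)} (hG : NC G) (hH : NC H) {M : List (Fin n × Fin n)}
    (hM : M.Pairwise fun x y => x.1 ≤ y.1 ∧ x.2 ≤ y.2) :
    NonCrossing (points U L) (linkGraph G H M) :=
  h.nonCrossing_linkGraph hn ((h.upper_nonCrossing_iff G).2 hG) ((h.lower_nonCrossing_iff H).2 hH)
    hM

end Chains

/-! ### The polygon -/

/-- The graph `G` on the vertices `f i`, with the additional edge `p q`. -/
def adjoinEdge {n m : ℕ} (f : Fin n ↪ Fin m) (p q : Fin m) (G : SimpleGraph (Fin n)) :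
    SimpleGraph (Fin m) := G.map f ⊔ SimpleGraph.edge p q

section Adjoin

variable {n m : ℕ} {f : Fin n ↪ Fin m} {p q : Fin m} {G : SimpleGraph (Fin n)}

theorem adjoinEdge_adj {x y : Fin m} : (adjoinEdge f p q G).Adj x y ↔
    (∃ i j, G.Adj i j ∧ f i = x ∧ f j = y) ∨ (x = p ∧ y = q ∨ x = q ∧ y = p) ∧ x ≠ y := by
  rw [adjoinEdge, SimpleGraph.sup_adj, SimpleGraph.map_adj, SimpleGraph.edge_adj]

theorem adjoinEdge_adj_apply (hp : ∀ i, f i ≠ p) (hq : ∀ i, f i ≠ q) {i j : Fin n} :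
    (adjoinEdge f p q G).Adj (f i) (f j) ↔ G.Adj i j := by
  rw [adjoinEdge_adj]
  constructor
  · rintro (⟨i', j', h, hi, hj⟩ | ⟨⟨h, -⟩ | ⟨h, -⟩, -⟩)
    · rwa [← f.injective hi, ← f.injective hj]
    · exact absurd h (hp i)
    · exact absurd h (hq i)
  · intro h
    exact Or.inl ⟨i, j, h, rfl, rfl⟩

theorem deg_adjoinEdge_apply (hp : ∀ i, f i ≠ p) (hq : ∀ i, f i ≠ q) (i : Fin n) :
    deg (adjoinEdge f p q G) (f i) = deg G i := by
  rw [deg, deg, ← Set.ncard_image_of_injective (G.neighborSet i) f.injective]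
  congr 1
  ext x
  rw [SimpleGraph.mem_neighborSet, Set.mem_image]
  constructor
  · intro h
    rcases adjoinEdge_adj.1 h with ⟨i', j', h, hi, hj⟩ | ⟨⟨h, -⟩ | ⟨h, -⟩, -⟩
    · exact ⟨j', by rwa [← f.injective hi], hj⟩
    · exact absurd h (hp i)
    · exact absurd h (hq i)
  · rintro ⟨j, hj, rfl⟩
    exact (adjoinEdge_adj_apply hp hq).2 hj

theorem deg_adjoinEdge_left (hp : ∀ i, f i ≠ p) (hpq : p ≠ q) : deg (adjoinEdge f p q G) p = 1 := by
  rw [deg, Set.ncard_eq_one]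
  refine ⟨q, Set.eq_singleton_iff_unique_mem.2
    ⟨adjoinEdge_adj.2 (Or.inr ⟨Or.inl ⟨rfl, rfl⟩, hpq⟩), fun x hx => ?_⟩⟩
  rcases adjoinEdge_adj.1 hx with ⟨i', j', h, hi, hj⟩ | ⟨⟨-, h⟩ | ⟨h, -⟩, -⟩
  · exact absurd hi (hp i')
  · exact h
  · exact absurd h hpq

theorem adjoinEdge_comm : adjoinEdge f p q G = adjoinEdge f q p G := by
  rw [adjoinEdge, adjoinEdge, SimpleGraph.edge_comm]

theorem deg_adjoinEdge_right (hq : ∀ i, f i ≠ q) (hpq : p ≠ q) :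
    deg (adjoinEdge f p q G) q = 1 := by
  rw [adjoinEdge_comm]
  exact deg_adjoinEdge_left hq hpq.symm

theorem NC.adjoinEdge (hG : NC G) (hf : StrictMono f) (hpq : p < q)
    (h : ∀ x y, p < x → x < q → q < y → ¬ ∃ i j, f i = x ∧ f j = y)
    (h' : ∀ x y, x < p → p < y → y < q → ¬ ∃ i j, f i = x ∧ f j = y) :
    NC (adjoinEdge f p q G) := by
  intro a b c d hab hbc hcd hac hbd
  rcases adjoinEdge_adj.1 hac with ⟨i, k, hik, rfl, rfl⟩ | ⟨⟨rfl, rfl⟩ | ⟨rfl, rfl⟩, -⟩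
  · rcases adjoinEdge_adj.1 hbd with ⟨j, l, hjl, rfl, rfl⟩ | ⟨⟨rfl, rfl⟩ | ⟨rfl, rfl⟩, -⟩
    · exact hG i j k l (hf.lt_iff_lt.1 hab) (hf.lt_iff_lt.1 hbc) (hf.lt_iff_lt.1 hcd) hik hjl
    · exact h' _ _ hab hbc hcd ⟨i, k, rfl, rfl⟩
    · exact absurd (hbc.trans hcd) (not_lt.2 hpq.le)
  · rcases adjoinEdge_adj.1 hbd with ⟨j, l, hjl, rfl, rfl⟩ | ⟨⟨rfl, rfl⟩ | ⟨rfl, rfl⟩, -⟩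
    · exact h _ _ hab hbc hcd ⟨j, l, rfl, rfl⟩
    · exact absurd hab (lt_irrefl _)
    · exact absurd hbc (lt_irrefl _)
  · exact absurd (hab.trans hbc) (not_lt.2 hpq.le)

end Adjoin

/-- The position of the upper points among the points of the enlarged chain. -/
def upperEmb (n : ℕ) : Fin n ↪ Fin (n + 2) := ⟨fun i => i.succ.castSucc, fun i j h => by simpa using h⟩

/-- The position of the lower points among the points of the enlarged chain. -/
def lowerEmb (n : ℕ) : Fin n ↪ Fin (n + 2) := ⟨fun i => i.succ.succ, fun i j h => by simpa using h⟩

@[simp] theorem val_upperEmb {n : ℕ} (i : Fin n) : (upperEmb n i).val = i.val + 1 := rfl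

@[simp] theorem val_lowerEmb {n : ℕ} (i : Fin n) : (lowerEmb n i).val = i.val + 2 := rfl

theorem strictMono_upperEmb (n : ℕ) : StrictMono (upperEmb n) := fun i j h => by
  rw [Fin.lt_def, val_upperEmb, val_upperEmb]; omega

theorem strictMono_lowerEmb (n : ℕ) : StrictMono (lowerEmb n) := fun i j h => by
  rw [Fin.lt_def, val_lowerEmb, val_lowerEmb]; omega

/-- The edges between the chains of the polygon. -/
noncomputable def polygonLinks {n : ℕ} (G H : SimpleGraph (Fin n)) :
    List (Fin (n + 2) × Fin (n + 2)) :=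
  (0 :: ((endpointList G).map (upperEmb n) ++ [Fin.last (n + 1)])).zip
    (0 :: 1 :: (endpointList H).map (lowerEmb n))

/-- The polygon that contains the Hamiltonian path of `G` and `H`. -/
noncomputable def polygon {n : ℕ} (G H : SimpleGraph (Fin n)) :
    SimpleGraph (Fin (n + 2) ⊕ Fin (n + 2)) :=
  linkGraph (adjoinEdge (upperEmb n) 0 (Fin.last (n + 1)) G) (adjoinEdge (lowerEmb n) 0 1 H)
    (polygonLinks G H)

section Polygon

variable {n : ℕ} {G H : SimpleGraph (Fin n)}

theorem upperEmb_ne_zero (i : Fin n) : upperEmb n i ≠ 0 := fun h => by simpa using congrArg Fin.val h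

theorem upperEmb_ne_last (i : Fin n) : upperEmb n i ≠ Fin.last (n + 1) := fun h => by
  have := congrArg Fin.val h
  simp at this
  omega

theorem lowerEmb_ne_zero (i : Fin n) : lowerEmb n i ≠ 0 := fun h => by simpa using congrArg Fin.val h

theorem lowerEmb_ne_one (i : Fin n) : lowerEmb n i ≠ 1 := fun h => by simpa using congrArg Fin.val h

theorem eq_upperEmb (x : Fin (n + 2)) : x = 0 ∨ x = Fin.last (n + 1) ∨ ∃ i, x = upperEmb n i := by
  rcases Nat.eq_zero_or_pos x.val with h | h
  · exact Or.inl (Fin.ext h)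
  by_cases h' : x.val = n + 1
  · exact Or.inr (Or.inl (Fin.ext h'))
  · refine Or.inr (Or.inr ⟨⟨x.val - 1, by omega⟩, Fin.ext ?_⟩)
    rw [val_upperEmb]
    simp only
    omega

theorem eq_lowerEmb (x : Fin (n + 2)) : x = 0 ∨ x = 1 ∨ ∃ i, x = lowerEmb n i := by
  rcases Nat.lt_or_ge x.val 2 with h | h
  · rcases Nat.lt_or_ge x.val 1 with h | h
    · exact Or.inl (Fin.ext (Nat.lt_one_iff.1 h))
    · exact Or.inr (Or.inl (Fin.ext (by simp; omega)))
  · refine Or.inr (Or.inr ⟨⟨x.val - 2, by omega⟩, Fin.ext ?_⟩)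
    rw [val_lowerEmb]
    simp only
    omega

theorem polygon_adj_inl {i j : Fin n} :
    (polygon G H).Adj (.inl (upperEmb n i)) (.inl (upperEmb n j)) ↔ G.Adj i j :=
  adjoinEdge_adj_apply upperEmb_ne_zero upperEmb_ne_last

theorem polygon_adj_inr {i j : Fin n} :
    (polygon G H).Adj (.inr (lowerEmb n i)) (.inr (lowerEmb n j)) ↔ H.Adj i j :=
  adjoinEdge_adj_apply lowerEmb_ne_zero lowerEmb_ne_one

theorem polygon_injective {G' H' : SimpleGraph (Fin n)} (h : polygon G H = polygon G' H') :
    G = G' ∧ H = H' := by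
  constructor
  · ext i j
    rw [← polygon_adj_inl (G := G) (H := H), h, polygon_adj_inl]
  · ext i j
    rw [← polygon_adj_inr (G := G) (H := H), h, polygon_adj_inr]

theorem polygonLinks_eq (hl : (endpointList G).length = (endpointList H).length)
    (hG : endpointList G ≠ []) : ∃ v ∈ endpointList G, ∃ w, polygonLinks G H =
      (0, 0) :: (upperEmb n v, 1) :: ((alternatingEdges G H).map (Prod.map (upperEmb n) (lowerEmb n)) ++
        [(Fin.last (n + 1), lowerEmb n w)]) := by
  have hH : endpointList H ≠ [] := by
    rw [← List.length_pos_iff] at hG ⊢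
    omega
  rw [polygonLinks, alternatingEdges]
  obtain ⟨v, e, he⟩ := List.exists_cons_of_ne_nil hG
  have hf := List.dropLast_append_getLast hH
  refine ⟨v, by simp [he], (endpointList H).getLast hH, ?_⟩
  generalize (endpointList H).getLast hH = w at hf
  generalize (endpointList H).dropLast = f at hf
  have hlen : e.length = f.length := by
    rw [← hf, he] at hl
    simpa using hl
  rw [← hf, he, List.map_append, List.map_cons, List.cons_append, List.zip_cons_cons,
    List.zip_cons_cons, List.zip_append (by simpa using hlen), List.zip_map]
  simp

theorem map_fst_polygonLinks (hl : (endpointList G).length = (endpointList H).length) :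
    (polygonLinks G H).map Prod.fst =
      0 :: ((endpointList G).map (upperEmb n) ++ [Fin.last (n + 1)]) :=
  List.map_fst_zip (by simp [hl])

theorem map_snd_polygonLinks (hl : (endpointList G).length = (endpointList H).length) :
    (polygonLinks G H).map Prod.snd = 0 :: 1 :: (endpointList H).map (lowerEmb n) :=
  List.map_snd_zip (by simp [hl])

theorem Ord.nodup_polygonLinks (hG : Ord G) (hH : Ord H) (hn : 1 ≤ n)
    (hk : numPaths G = numPaths H) : (polygonLinks G H).Nodup := by
  obtain ⟨v, -, w, h⟩ := polygonLinks_eq (hG.length_eq hH hk) (hG.endpointList_ne_nil hn)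
  rw [h]
  have hM := (hG.nodup_alternatingEdges hH hk).map
    ((upperEmb n).injective.prodMap (lowerEmb n).injective)
  have hlast : (Fin.last (n + 1)) ≠ 0 := (Fin.last_pos).ne'
  simp only [List.nodup_cons, List.mem_cons, List.mem_append, List.mem_map, Prod.mk.injEq,
    List.not_mem_nil, or_false, not_or, Prod.exists, Prod.map_apply, not_exists, not_and,
    List.nodup_append, List.nodup_nil, and_true, hM, true_and, not_false_eq_true,
    forall_exists_index, and_imp]
  refine ⟨⟨fun h => absurd h.symm (upperEmb_ne_zero v), ?_, fun h => absurd h.symm hlast⟩, ⟨?_, ?_⟩, ?_⟩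
  · intro i j _ h
    exact absurd h (upperEmb_ne_zero i)
  · intro i j _ _ h
    exact absurd h (lowerEmb_ne_one j)
  · intro h
    exact absurd h (upperEmb_ne_last v)
  · rintro x i j _ rfl y rfl h
    rw [Prod.mk.injEq] at h
    exact upperEmb_ne_last i h.1

/-- The Hamiltonian path is contained in the polygon. -/
theorem Ord.polygon_adj (hG : Ord G) (hH : Ord H) (hn : 1 ≤ n) (hk : numPaths G = numPaths H)
    {x y : Fin n ⊕ Fin n} (h : (joinGraph G H).Adj x y) :
    (polygon G H).Adj (Sum.map (upperEmb n) (lowerEmb n) x) (Sum.map (upperEmb n) (lowerEmb n) y) := by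
  obtain ⟨v, -, w, hM⟩ := polygonLinks_eq (hG.length_eq hH hk) (hG.endpointList_ne_nil hn)
  have hmem : ∀ i j, (i, j) ∈ alternatingEdges G H →
      (upperEmb n i, lowerEmb n j) ∈ polygonLinks G H := by
    intro i j hij
    rw [hM]
    refine List.mem_cons_of_mem _ (List.mem_cons_of_mem _ (List.mem_append_left _ ?_))
    exact List.mem_map.2 ⟨(i, j), hij, rfl⟩
  rcases x with x | x <;> rcases y with y | y
  · exact polygon_adj_inl.2 h
  · exact hmem _ _ h
  · exact hmem _ _ h
  · exact polygon_adj_inr.2 h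

theorem Ord.connected_polygon (hG : Ord G) (hH : Ord H) (hn : 1 ≤ n)
    (hk : numPaths G = numPaths H) : (polygon G H).Connected := by
  obtain ⟨v, -, w, hM⟩ := polygonLinks_eq (hG.length_eq hH hk) (hG.endpointList_ne_nil hn)
  let φ : joinGraph G H →g polygon G H :=
    ⟨Sum.map (upperEmb n) (lowerEmb n), fun h => hG.polygon_adj hH hn hk h⟩
  have hconn := hG.connected_joinGraph hH hn hk
  have h0 : ∀ x, (polygon G H).Reachable (.inl (upperEmb n v))
      (Sum.map (upperEmb n) (lowerEmb n) x) := fun x =>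
    (hconn.preconnected (.inl v) x).map φ
  have h1 : (polygon G H).Adj (.inl (upperEmb n v)) (.inr 1) := by
    change (upperEmb n v, (1 : Fin (n + 2))) ∈ polygonLinks G H
    simp [hM]
  have h2 : (polygon G H).Adj (.inr 1) (.inr 0) :=
    adjoinEdge_adj.2 (Or.inr ⟨Or.inr ⟨rfl, rfl⟩, one_ne_zero⟩)
  have h3 : (polygon G H).Adj (.inr 0) (.inl 0) := by
    change ((0 : Fin (n + 2)), (0 : Fin (n + 2))) ∈ polygonLinks G H
    simp [hM]
  have h4 : (polygon G H).Adj (.inl 0) (.inl (Fin.last (n + 1))) :=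
    adjoinEdge_adj.2 (Or.inr ⟨Or.inl ⟨rfl, rfl⟩, (Fin.last_pos).ne⟩)
  have hall : ∀ x, (polygon G H).Reachable (.inl (upperEmb n v)) x := by
    have r1 := h1.reachable
    have r2 := r1.trans h2.reachable
    have r3 := r2.trans h3.reachable
    rintro (x | x)
    · rcases eq_upperEmb x with rfl | rfl | ⟨i, rfl⟩
      · exact r3
      · exact r3.trans h4.reachable
      · exact h0 (.inl i)
    · rcases eq_lowerEmb x with rfl | rfl | ⟨i, rfl⟩
      · exact r2
      · exact r1
      · exact h0 (.inr i)
  have : Nonempty (Fin (n + 2) ⊕ Fin (n + 2)) := ⟨.inl 0⟩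
  exact ⟨fun x y => (hall x).symm.trans (hall y)⟩

theorem Ord.deg_polygon (hG : Ord G) (hH : Ord H) (hn : 1 ≤ n)
    (hk : numPaths G = numPaths H) (x : Fin (n + 2) ⊕ Fin (n + 2)) : deg (polygon G H) x = 2 := by
  have hM := hG.nodup_polygonLinks hH hn hk
  have hl := hG.length_eq hH hk
  rcases x with x | x
  · rw [polygon, deg_linkGraph_inl _ _ hM, map_fst_polygonLinks hl, List.count_cons,
      List.count_append, List.count_singleton]
    have hnm : ∀ x, (∀ i, upperEmb n i ≠ x) → ((endpointList G).map (upperEmb n)).count x = 0 := by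
      intro x hx
      rw [List.count_eq_zero, List.mem_map]
      rintro ⟨i, -, h⟩
      exact hx i h
    rcases eq_upperEmb x with rfl | rfl | ⟨i, rfl⟩
    · rw [deg_adjoinEdge_left upperEmb_ne_zero (Fin.last_pos).ne, hnm _ upperEmb_ne_zero]
      simp
    · rw [deg_adjoinEdge_right upperEmb_ne_last (Fin.last_pos).ne, hnm _ upperEmb_ne_last]
      simp
    · rw [deg_adjoinEdge_apply upperEmb_ne_zero upperEmb_ne_last,
        List.count_map_of_injective _ _ (upperEmb n).injective, count_endpointList]
      have := hG.deg_le_two i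
      have h1 := upperEmb_ne_zero i
      have h2 := upperEmb_ne_last i
      simp [h1.symm, h2.symm]
      omega
  · rw [polygon, deg_linkGraph_inr _ _ hM, map_snd_polygonLinks hl, List.count_cons, List.count_cons]
    have hnm : ∀ x, (∀ i, lowerEmb n i ≠ x) → ((endpointList H).map (lowerEmb n)).count x = 0 := by
      intro x hx
      rw [List.count_eq_zero, List.mem_map]
      rintro ⟨i, -, h⟩
      exact hx i h
    rcases eq_lowerEmb x with rfl | rfl | ⟨i, rfl⟩
    · rw [deg_adjoinEdge_left lowerEmb_ne_zero zero_ne_one, hnm _ lowerEmb_ne_zero]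
      simp
    · rw [deg_adjoinEdge_right lowerEmb_ne_one zero_ne_one, hnm _ lowerEmb_ne_one]
      simp
    · rw [deg_adjoinEdge_apply lowerEmb_ne_zero lowerEmb_ne_one,
        List.count_map_of_injective _ _ (lowerEmb n).injective, count_endpointList]
      have := hH.deg_le_two i
      have h1 := lowerEmb_ne_zero i
      have h2 := lowerEmb_ne_one i
      simp [h1.symm, h2.symm]
      omega

theorem Ord.isPolygonization (hG : Ord G) (hH : Ord H) (hn : 1 ≤ n)
    (hk : numPaths G = numPaths H) {U L : Fin (n + 2) → ℝ × ℝ} (h : IsDoubleChain U L) :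
    IsPolygonization (points U L) (polygon G H) := by
  have hl := hG.length_eq hH hk
  refine ⟨h.nonCrossing_of_nc (by omega) ?_ ?_ (pairwise_le_of_map ?_ ?_),
    isHamiltonianCycle_of_connected (hG.connected_polygon hH hn hk) (hG.deg_polygon hH hn hk)⟩
  · refine hG.nc.adjoinEdge (strictMono_upperEmb n) Fin.last_pos ?_ ?_
    · intro x y _ _ h
      exact absurd h (not_lt.2 (Fin.le_last y))
    · intro x y h
      exact absurd h (not_lt.2 (Fin.zero_le x))
  · refine hH.nc.adjoinEdge (strictMono_lowerEmb n) Fin.zero_lt_one ?_ ?_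
    · intro x y h1 h2
      rw [Fin.lt_def] at h1 h2
      simp at h1 h2
      omega
    · intro x y h
      exact absurd h (not_lt.2 (Fin.zero_le x))
  · rw [map_fst_polygonLinks hl, List.pairwise_cons, List.pairwise_append]
    refine ⟨fun x _ => Fin.zero_le x, ?_, by simp, fun x _ y hy => ?_⟩
    · exact (pairwise_endpointList G).map _ fun a b h => (strictMono_upperEmb n).monotone h
    · rw [List.mem_singleton.1 hy]
      exact Fin.le_last x
  · rw [map_snd_polygonLinks hl, List.pairwise_cons, List.pairwise_cons]
    refine ⟨fun x _ => Fin.zero_le x, fun x hx => ?_, ?_⟩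
    · obtain ⟨i, -, rfl⟩ := List.mem_map.1 hx
      rw [Fin.le_def, val_lowerEmb]
      simp
    · exact (pairwise_endpointList H).map _ fun a b h => (strictMono_lowerEmb n).monotone h

theorem ordCount_mul_le {U L : Fin (n + 2) → ℝ × ℝ} (h : IsDoubleChain U L) (hn : 1 ≤ n) (k : ℕ) :
    ordCount n k * ordCount n k ≤ numPolygonizations (points U L) := by
  rw [ordCount, ← Set.ncard_prod, numPolygonizations]
  refine Set.ncard_le_ncard_of_injOn (fun x => polygon x.1 x.2) ?_ ?_ (Set.toFinite _)
  · rintro ⟨G, H⟩ ⟨⟨hG, hGk⟩, hH, hHk⟩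
    exact hG.isPolygonization hH hn (hGk.trans hHk.symm) h
  · rintro ⟨G, H⟩ - ⟨G', H'⟩ - heq
    obtain ⟨h1, h2⟩ := polygon_injective heq
    exact Prod.ext h1 h2

end Polygon

end NCPath

namespace NCPath

open Filter Topology

/-! ### Enlarging a double chain -/

/-- A double chain of `m` upper and `n` lower points. -/
structure IsDoubleChainOf {m n : ℕ} (U : Fin m → ℝ × ℝ) (L : Fin n → ℝ × ℝ) : Prop where
  upper_left_right : StrictMono fun i => (U i).1
  lower_left_right : StrictMono fun i => (L i).1
  upper_convex : ∀ i j k, i < j → j < k → 0 < orient (U i) (U j) (U k)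
  lower_concave : ∀ i j k, i < j → j < k → orient (L i) (L j) (L k) < 0
  lower_below : ∀ i j k, i < j → orient (U i) (U j) (L k) < 0
  upper_above : ∀ i j k, i < j → 0 < orient (L i) (L j) (U k)

theorem IsDoubleChain.of {n : ℕ} {U L : Fin n → ℝ × ℝ} (h : IsDoubleChain U L) :
    IsDoubleChainOf U L :=
  ⟨h.1, h.2, h.3, h.4, h.5, h.6⟩

theorem IsDoubleChainOf.isDoubleChain {n : ℕ} {U L : Fin n → ℝ × ℝ} (h : IsDoubleChainOf U L) :
    IsDoubleChain U L :=
  ⟨h.1, h.2, h.3, h.4, h.5, h.6⟩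

theorem eventually_pos {f : ℝ → ℝ} (hf : Continuous f) (h : 0 < f 0) :
    ∀ᶠ t in 𝓝[>] (0 : ℝ), 0 < f t :=
  ((hf.tendsto 0).eventually (lt_mem_nhds h)).filter_mono nhdsWithin_le_nhds

section

variable {m n : ℕ} {U : Fin m → ℝ × ℝ} {L : Fin n → ℝ × ℝ}

theorem IsDoubleChainOf.exists_upper_left (h : IsDoubleChainOf U L) (hm : 2 ≤ m) :
    ∃ U' : Fin (m + 1) → ℝ × ℝ, IsDoubleChainOf U' L ∧ ∀ i, U' i.succ = U i := by
  obtain ⟨m, rfl⟩ : ∃ m', m = m' + 2 := ⟨m - 2, by omega⟩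
  obtain ⟨p, hp⟩ : ∃ p : ℝ → ℝ × ℝ, p = fun t => ((U 0).1 - t * ((U 1).1 - (U 0).1),
    (U 0).2 - t * ((U 1).2 - (U 0).2) + t ^ 2) := ⟨_, rfl⟩
  have hx01 : (U 0).1 < (U 1).1 := h.upper_left_right Fin.zero_lt_one
  have hcont : ∀ q r : ℝ × ℝ, Continuous fun t => orient (p t) q r := by
    intro q r
    simp only [orient, hp]
    fun_prop
  have hcont' : ∀ q r : ℝ × ℝ, Continuous fun t => orient q r (p t) := by
    intro q r
    simp only [orient, hp]
    fun_prop
  have hp0 : p 0 = U 0 := by simp [hp]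
  -- the expansion of the orientation at the first upper point
  have hexp : ∀ t r, orient (p t) (U 0) r =
      t * (orient (U 0) (U 1) r + t * (r.1 - (U 0).1)) := by
    intro t r
    simp only [orient, hp]
    ring
  have hpos : ∀ᶠ t in 𝓝[>] (0 : ℝ), 0 < t := eventually_mem_nhdsWithin
  have e1 : ∀ᶠ t in 𝓝[>] (0 : ℝ), ∀ j k : Fin (m + 2), j < k → 0 < orient (p t) (U j) (U k) := by
    rw [eventually_all]
    intro j
    rw [eventually_all]
    intro k
    by_cases hjk : j < k
    · by_cases hj : j = 0
      · filter_upwards [hpos] with t ht _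
        subst hj
        rw [hexp]
        have h1 : (U 0).1 < (U k).1 := h.upper_left_right hjk
        have h2 : 0 ≤ orient (U 0) (U 1) (U k) := by
          by_cases hk : k = 1
          · rw [hk]
            simp only [orient]
            linarith
          · refine (h.upper_convex 0 1 k Fin.zero_lt_one (lt_of_le_of_ne ?_ (Ne.symm hk))).le
            rw [Fin.lt_def] at hjk
            rw [Fin.le_def]
            exact hjk
        have h3 : 0 < t * ((U k).1 - (U 0).1) := mul_pos ht (by linarith)
        exact mul_pos ht (by linarith)
      · have := h.upper_convex 0 j k (Fin.pos_iff_ne_zero.2 hj) hjk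
        filter_upwards [eventually_pos (hcont (U j) (U k)) (by simpa only [hp0] using this)]
          with t ht _ using ht
    · exact Eventually.of_forall fun t h => absurd h hjk
  have e2 : ∀ᶠ t in 𝓝[>] (0 : ℝ), ∀ (j : Fin (m + 2)) (k : Fin n), orient (p t) (U j) (L k) < 0 := by
    rw [eventually_all]
    intro j
    rw [eventually_all]
    intro k
    by_cases hj : j = 0
    · subst hj
      have h1 := h.lower_below 0 1 k Fin.zero_lt_one
      have h2 := eventually_pos
        (f := fun t => -(orient (U 0) (U 1) (L k) + t * ((L k).1 - (U 0).1))) (by fun_prop)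
        (by simpa using h1)
      filter_upwards [hpos, h2] with t ht h2
      rw [hexp]
      exact mul_neg_of_pos_of_neg ht (by linarith)
    · have := h.lower_below 0 j k (Fin.pos_iff_ne_zero.2 hj)
      filter_upwards [eventually_pos (f := fun t => -orient (p t) (U j) (L k))
        (hcont (U j) (L k)).neg (by simpa only [hp0, neg_pos] using this)] with t ht
      exact neg_pos.1 ht
  have e3 : ∀ᶠ t in 𝓝[>] (0 : ℝ), ∀ i j : Fin n, i < j → 0 < orient (L i) (L j) (p t) := by
    rw [eventually_all]
    intro i
    rw [eventually_all]
    intro j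
    by_cases hij : i < j
    · have := h.upper_above i j 0 hij
      filter_upwards [eventually_pos (hcont' (L i) (L j)) (by simpa only [hp0] using this)]
        with t ht _ using ht
    · exact Eventually.of_forall fun t h => absurd h hij
  obtain ⟨t, ht, h1, h2, h3⟩ := (hpos.and (e1.and (e2.and e3))).exists
  have hlt : (p t).1 < (U 0).1 := by
    rw [hp]
    have := mul_pos ht (sub_pos.2 hx01)
    simp only
    linarith
  refine ⟨Fin.cons (p t) U, ⟨?_, h.lower_left_right, ?_, h.lower_concave, ?_, ?_⟩,
    fun i => Fin.cons_succ _ _ i⟩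
  · intro i j hij
    induction j using Fin.cases with
    | zero => exact absurd hij (not_lt.2 (Fin.zero_le i))
    | succ j =>
      induction i using Fin.cases with
      | zero =>
        simp only [Fin.cons_zero, Fin.cons_succ]
        exact lt_of_lt_of_le hlt (h.upper_left_right.monotone (Fin.zero_le j))
      | succ i =>
        simp only [Fin.cons_succ]
        exact h.upper_left_right (Fin.succ_lt_succ_iff.1 hij)
  · intro i j k hij hjk
    induction j using Fin.cases with
    | zero => exact absurd hij (not_lt.2 (Fin.zero_le i))
    | succ j =>
      induction k using Fin.cases with
      | zero => exact absurd hjk (not_lt.2 (Fin.zero_le _))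
      | succ k =>
        have hjk := Fin.succ_lt_succ_iff.1 hjk
        induction i using Fin.cases with
        | zero =>
          simp only [Fin.cons_zero, Fin.cons_succ]
          exact h1 j k hjk
        | succ i =>
          simp only [Fin.cons_succ]
          exact h.upper_convex i j k (Fin.succ_lt_succ_iff.1 hij) hjk
  · intro i j k hij
    induction j using Fin.cases with
    | zero => exact absurd hij (not_lt.2 (Fin.zero_le i))
    | succ j =>
      induction i using Fin.cases with
      | zero =>
        simp only [Fin.cons_zero, Fin.cons_succ]
        exact h2 j k
      | succ i =>
        simp only [Fin.cons_succ]
        exact h.lower_below i j k (Fin.succ_lt_succ_iff.1 hij)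
  · intro i j k hij
    induction k using Fin.cases with
    | zero =>
      simp only [Fin.cons_zero]
      exact h3 i j hij
    | succ k =>
      simp only [Fin.cons_succ]
      exact h.upper_above i j k hij

/-- The reflection at the vertical axis. -/
theorem IsDoubleChainOf.mirror (h : IsDoubleChainOf U L) :
    IsDoubleChainOf (fun i => (-(U i.rev).1, (U i.rev).2)) fun i => (-(L i.rev).1, (L i.rev).2) := by
  have key : ∀ p q r : ℝ × ℝ, orient (-p.1, p.2) (-q.1, q.2) (-r.1, r.2) = orient q p r := by
    intro p q r
    simp only [orient]
    ring
  have key' : ∀ p q r : ℝ × ℝ, orient q p r = orient r q p := by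
    intro p q r
    simp only [orient]
    ring
  refine ⟨?_, ?_, ?_, ?_, ?_, ?_⟩
  · intro i j hij
    exact neg_lt_neg (h.upper_left_right (Fin.rev_lt_rev.2 hij))
  · intro i j hij
    exact neg_lt_neg (h.lower_left_right (Fin.rev_lt_rev.2 hij))
  · intro i j k hij hjk
    rw [key, key']
    exact h.upper_convex _ _ _ (Fin.rev_lt_rev.2 hjk) (Fin.rev_lt_rev.2 hij)
  · intro i j k hij hjk
    rw [key, key']
    exact h.lower_concave _ _ _ (Fin.rev_lt_rev.2 hjk) (Fin.rev_lt_rev.2 hij)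
  · intro i j k hij
    rw [key]
    exact h.lower_below _ _ _ (Fin.rev_lt_rev.2 hij)
  · intro i j k hij
    rw [key]
    exact h.upper_above _ _ _ (Fin.rev_lt_rev.2 hij)

/-- The reflection at the horizontal axis. -/
theorem IsDoubleChainOf.flip (h : IsDoubleChainOf U L) :
    IsDoubleChainOf (fun i => ((L i).1, -(L i).2)) fun i => ((U i).1, -(U i).2) := by
  have key : ∀ p q r : ℝ × ℝ, orient (p.1, -p.2) (q.1, -q.2) (r.1, -r.2) = -orient p q r := by
    intro p q r
    simp only [orient]
    ring
  refine ⟨h.lower_left_right, h.upper_left_right, ?_, ?_, ?_, ?_⟩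
  · intro i j k hij hjk
    rw [key]
    exact neg_pos.2 (h.lower_concave i j k hij hjk)
  · intro i j k hij hjk
    rw [key]
    exact neg_neg_iff_pos.2 (h.upper_convex i j k hij hjk)
  · intro i j k hij
    rw [key]
    exact neg_neg_iff_pos.2 (h.upper_above i j k hij)
  · intro i j k hij
    rw [key]
    exact neg_pos.2 (h.lower_below i j k hij)

theorem IsDoubleChainOf.exists_upper_right (h : IsDoubleChainOf U L) (hm : 2 ≤ m) :
    ∃ U' : Fin (m + 1) → ℝ × ℝ, IsDoubleChainOf U' L ∧ ∀ i, U' i.castSucc = U i := by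
  obtain ⟨U', h', hU⟩ := h.mirror.exists_upper_left hm
  refine ⟨_, by simpa using h'.mirror, fun i => ?_⟩
  simp [Fin.rev_castSucc, hU]

theorem IsDoubleChainOf.exists_lower_left (h : IsDoubleChainOf U L) (hn : 2 ≤ n) :
    ∃ L' : Fin (n + 1) → ℝ × ℝ, IsDoubleChainOf U L' ∧ ∀ i, L' i.succ = L i := by
  obtain ⟨L', h', hL⟩ := h.flip.exists_upper_left hn
  refine ⟨_, by simpa using h'.flip, fun i => ?_⟩
  simp [hL]

end

theorem IsDoubleChain.exists_enlarged {n : ℕ} {U L : Fin n → ℝ × ℝ} (h : IsDoubleChain U L)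
    (hn : 2 ≤ n) : ∃ U' L' : Fin (n + 2) → ℝ × ℝ, IsDoubleChain U' L' ∧
      (∀ i, U' (upperEmb n i) = U i) ∧ ∀ i, L' (lowerEmb n i) = L i := by
  obtain ⟨U₁, h₁, hU₁⟩ := h.of.exists_upper_left hn
  obtain ⟨U₂, h₂, hU₂⟩ := h₁.exists_upper_right (by omega)
  obtain ⟨L₁, h₃, hL₁⟩ := h₂.exists_lower_left hn
  obtain ⟨L₂, h₄, hL₂⟩ := h₃.exists_lower_left (by omega)
  refine ⟨U₂, L₂, h₄.isDoubleChain, fun i => ?_, fun i => ?_⟩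
  · exact (hU₂ _).trans (hU₁ _)
  · exact (hL₂ _).trans (hL₁ _)

/-! ### The hull of two points on each chain -/

open SimpleGraph in
theorem IsDoubleChain.numPolygonizations_pos {U L : Fin 2 → ℝ × ℝ} (h : IsDoubleChain U L) :
    1 ≤ numPolygonizations (points U L) := by
  have hM : ([(0, 0), (1, 1)] : List (Fin 2 × Fin 2)).Nodup := by decide
  have hnc : NC (⊤ : SimpleGraph (Fin 2)) := fun a b c d h1 h2 h3 => by omega
  have hdeg : ∀ i, deg (⊤ : SimpleGraph (Fin 2)) i = 1 := by
    intro i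
    rw [deg, Set.ncard_eq_one]
    refine ⟨i.rev, ?_⟩
    ext x
    fin_cases i <;> fin_cases x <;> simp
  have hP : IsPolygonization (points U L)
      (linkGraph (⊤ : SimpleGraph (Fin 2)) (⊤ : SimpleGraph (Fin 2)) [(0, 0), (1, 1)]) := by
    refine ⟨h.nonCrossing_of_nc le_rfl hnc hnc (by simp), isHamiltonianCycle_of_connected ?_ ?_⟩
    · have h1 : ∀ i : Fin 2, (linkGraph (⊤ : SimpleGraph (Fin 2)) (⊤ : SimpleGraph (Fin 2))
          [(0, 0), (1, 1)]).Reachable (.inl 0) (.inl i) := fun i => by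
        rcases eq_or_ne 0 i with rfl | hi
        · exact Reachable.refl _
        · exact SimpleGraph.Adj.reachable (show (⊤ : SimpleGraph (Fin 2)).Adj 0 i from hi)
      have h2 : ∀ x, (linkGraph (⊤ : SimpleGraph (Fin 2)) (⊤ : SimpleGraph (Fin 2))
          [(0, 0), (1, 1)]).Reachable (.inl 0) x := by
        rintro (i | i)
        · exact h1 i
        · refine (h1 i).trans (SimpleGraph.Adj.reachable ?_)
          change (i, i) ∈ [((0 : Fin 2), (0 : Fin 2)), (1, 1)]
          fin_cases i <;> simp
      have : Nonempty (Fin 2 ⊕ Fin 2) := ⟨.inl 0⟩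
      exact ⟨fun x y => (h2 x).symm.trans (h2 y)⟩
    · rintro (i | i)
      · rw [deg_linkGraph_inl _ _ hM, hdeg]
        fin_cases i <;> simp
      · rw [deg_linkGraph_inr _ _ hM, hdeg]
        fin_cases i <;> simp
  exact (Set.ncard_pos (Set.toFinite _)).2 ⟨_, hP⟩

end NCPath

namespace NCPath

/-! ### Growth of the counts -/

theorem Critical.exists_growth {x y F : ℝ} (hc : Critical x y F) :
    ∃ (k : ℕ → ℕ) (c C : ℝ) (d : ℕ), 0 < c ∧ 0 < C ∧ ∀ n : ℕ, 1 ≤ n → 1 ≤ k n ∧ k n ≤ n ∧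
      c * (1 / x) ^ n / (n : ℝ) ^ d ≤ (ordCount n (k n) : ℝ) ∧
      (ordCount n (k n) : ℝ) ≤ C * (n : ℝ) ^ d * (1 / x) ^ n := by
  obtain ⟨C, hC, hup⟩ := hc.descendants_le
  obtain ⟨c, d, hc0, hlow⟩ := hc.le_descendants
  choose k hk using exists_ordCount
  have hx := hc.x_pos
  have hρ : 1 ≤ 1 / x := by
    rw [le_div_iff₀ hx, one_mul]
    exact hc.x_lt.le
  refine ⟨k, c * x, C, d + 1, by positivity, hC, fun n hn => ?_⟩
  obtain ⟨h1, h2, h3, h4⟩ := hk n hn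
  refine ⟨h1, h2, ?_, ?_⟩
  · obtain ⟨m, rfl⟩ : ∃ m, n = m + 1 := ⟨n - 1, by omega⟩
    have h5 := hlow m
    rw [card_ordSet] at h4
    have h6 : (descendants m 1 0 : ℝ) ≤ ((m + 1 : ℕ) : ℝ) * ordCount (m + 1) (k (m + 1)) := by
      exact_mod_cast h4
    have hm : (0 : ℝ) < ((m + 1 : ℕ) : ℝ) := by positivity
    rw [div_le_iff₀ (by positivity)] at h5 ⊢
    push_cast at h6 hm ⊢
    calc c * x * (1 / x) ^ (m + 1) = c * (1 / x) ^ m := by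
          rw [pow_succ]; field_simp
      _ ≤ descendants m 1 0 * (m + 1) ^ d := h5
      _ ≤ ((m + 1) * ordCount (m + 1) (k (m + 1))) * (m + 1) ^ d := by gcongr
      _ = _ := by ring
  · obtain ⟨m, rfl⟩ : ∃ m, n = m + 1 := ⟨n - 1, by omega⟩
    rw [card_ordSet] at h3
    have hm : (1 : ℝ) ≤ ((m + 1 : ℕ) : ℝ) := by exact_mod_cast hn
    calc (ordCount (m + 1) (k (m + 1)) : ℝ) ≤ descendants m 1 0 := by exact_mod_cast h3
      _ ≤ C * (1 / x) ^ m := hup m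
      _ ≤ C * 1 * (1 / x) ^ (m + 1) := by
          rw [mul_one]
          exact mul_le_mul_of_nonneg_left (pow_le_pow_right₀ hρ (Nat.le_succ m)) hC.le
      _ ≤ _ := by gcongr; exact one_le_pow₀ hm

theorem ConvexClockwise.orderedCount_eq {n : ℕ} {p : Fin n → ℝ × ℝ} (h : ConvexClockwise p) (k : ℕ) :
    orderedCount p k = ordCount n k :=
  NCPath.orderedCount_eq (-1) (fun i j k hij hjk => by simpa using h.2 i j k hij hjk) k

theorem exists_le_numPolygonizations {ρ : ℝ} (hρ : 0 < ρ) {k : ℕ → ℕ} {c : ℝ} {d : ℕ} (hc : 0 < c)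
    (h : ∀ n : ℕ, 1 ≤ n → c * ρ ^ n / (n : ℝ) ^ d ≤ (ordCount n (k n) : ℝ)) :
    ∃ (c : ℝ) (d : ℕ), 0 < c ∧ ∀ n : ℕ, 2 ≤ n → ∀ U L : Fin n → ℝ × ℝ, IsDoubleChain U L →
      c * ρ ^ (2 * n) / ((2 * n : ℕ) : ℝ) ^ d ≤ (numPolygonizations (points U L) : ℝ) := by
  refine ⟨min (c ^ 2) 1 / ρ ^ 4, 2 * d, by positivity, fun n hn U L hUL => ?_⟩
  obtain ⟨m, rfl⟩ : ∃ m, n = m + 2 := ⟨n - 2, by omega⟩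
  have h0 : min (c ^ 2) 1 / ρ ^ 4 * ρ ^ (2 * (m + 2)) = min (c ^ 2) 1 * ρ ^ (2 * m) := by
    rw [show 2 * (m + 2) = 4 + 2 * m by ring, pow_add]
    field_simp
  have hn1 : (1 : ℝ) ≤ ((2 * (m + 2) : ℕ) : ℝ) := by
    exact_mod_cast (by omega : 1 ≤ 2 * (m + 2))
  rw [h0, div_le_iff₀ (by positivity)]
  rcases Nat.eq_zero_or_pos m with rfl | hm
  · have h1 : (1 : ℝ) ≤ numPolygonizations (points U L) := by
      exact_mod_cast hUL.numPolygonizations_pos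
    calc min (c ^ 2) 1 * ρ ^ (2 * 0) ≤ 1 * 1 := by simp
      _ ≤ _ := mul_le_mul h1 (one_le_pow₀ hn1) zero_le_one (by positivity)
  · have h1 := h m hm
    have hm' : (0 : ℝ) < m := by exact_mod_cast hm
    rw [div_le_iff₀ (by positivity)] at h1
    have h2 : ((ordCount m (k m) : ℝ)) * ordCount m (k m) ≤ numPolygonizations (points U L) := by
      exact_mod_cast ordCount_mul_le hUL hm (k m)
    have hmn : (m : ℝ) ≤ ((2 * (m + 2) : ℕ) : ℝ) := by exact_mod_cast (by omega)
    calc min (c ^ 2) 1 * ρ ^ (2 * m) ≤ c ^ 2 * ρ ^ (2 * m) := by gcongr; exact min_le_left _ _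
      _ = (c * ρ ^ m) * (c * ρ ^ m) := by ring
      _ ≤ (ordCount m (k m) * (m : ℝ) ^ d) * (ordCount m (k m) * (m : ℝ) ^ d) := by gcongr
      _ = (ordCount m (k m) * ordCount m (k m)) * (m : ℝ) ^ (2 * d) := by ring
      _ ≤ _ := by gcongr

end NCPath

theorem mainTheorem7 :
    -- existence of the exponential base `ρ = 4.6421263038…`
    ∃ ρ : ℝ, |ρ - 4.6421263038| < 1 / 10 ^ 10 ∧
      4 * ρ ^ 5 - 36 * ρ ^ 4 + 112 * ρ ^ 3 - 168 * ρ ^ 2 + 117 * ρ - 32 = 0 ∧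
      -- for a suitable `k = k(n)`, the number of ordered ncp partitions with `k` paths is `ρ ^ n`
      -- up to polynomial factors
      (∃ (k : ℕ → ℕ) (c C : ℝ) (d : ℕ), 0 < c ∧ 0 < C ∧
        ∀ n : ℕ, 1 ≤ n → 1 ≤ k n ∧ k n ≤ n ∧
          ∀ p : Fin n → ℝ × ℝ, NCPath.ConvexClockwise p →
            c * ρ ^ n / (n : ℝ) ^ d ≤ (NCPath.orderedCount p (k n) : ℝ) ∧
            (NCPath.orderedCount p (k n) : ℝ) ≤ C * (n : ℝ) ^ d * ρ ^ n) ∧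
      -- joining two ordered ncp partitions with equally many paths gives a non-crossing
      -- Hamiltonian path
      (∀ n : ℕ, 2 ≤ n → ∀ U L : Fin n → ℝ × ℝ, NCPath.IsDoubleChain U L →
        ∀ G H : SimpleGraph (Fin n),
          NCPath.IsOrderedNCPPartition U G → NCPath.IsOrderedNCPPartition L H →
          NCPath.numPaths G = NCPath.numPaths H →
            NCPath.NonCrossing (NCPath.points U L) (NCPath.joinGraph G H) ∧
            NCPath.IsHamiltonianPath (NCPath.joinGraph G H)) ∧
      -- after adding four points, each of these paths is contained in a polygonization
      (∀ n : ℕ, 2 ≤ n → ∀ U L : Fin n → ℝ × ℝ, NCPath.IsDoubleChain U L →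
        ∃ (U' L' : Fin (n + 2) → ℝ × ℝ) (a b : Fin n → Fin (n + 2)),
          NCPath.IsDoubleChain U' L' ∧ StrictMono a ∧ StrictMono b ∧
          (∀ i, U' (a i) = U i) ∧ (∀ i, L' (b i) = L i) ∧
          ∀ G H : SimpleGraph (Fin n),
            NCPath.IsOrderedNCPPartition U G → NCPath.IsOrderedNCPPartition L H →
            NCPath.numPaths G = NCPath.numPaths H →
              ∃ P : SimpleGraph (Fin (n + 2) ⊕ Fin (n + 2)),
                NCPath.IsPolygonization (NCPath.points U' L') P ∧
                ∀ x y, (NCPath.joinGraph G H).Adj x y →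
                  P.Adj (Sum.map a b x) (Sum.map a b y)) ∧
      -- a double chain of `N = 2 n` points admits at least `ρ ^ N` polygonizations, up to
      -- polynomial factors
      (∃ (c : ℝ) (d : ℕ), 0 < c ∧
        ∀ n : ℕ, 2 ≤ n → ∀ U L : Fin n → ℝ × ℝ, NCPath.IsDoubleChain U L →
          c * ρ ^ (2 * n) / ((2 * n : ℕ) : ℝ) ^ d ≤
            (NCPath.numPolygonizations (NCPath.points U L) : ℝ)) := by
  obtain ⟨x, y, F, hc, hρ, hpoly⟩ := NCPath.exists_critical
  obtain ⟨k, c, C, d, hc0, hC0, hk⟩ := hc.exists_growth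
  refine ⟨1 / x, hρ, hpoly, ⟨k, c, C, d, hc0, hC0, fun n hn => ?_⟩, ?_, ?_,
    NCPath.exists_le_numPolygonizations (one_div_pos.2 hc.x_pos) hc0 fun n hn => (hk n hn).2.2.1⟩
  · obtain ⟨h1, h2, h3, h4⟩ := hk n hn
    refine ⟨h1, h2, fun p hp => ?_⟩
    rw [hp.orderedCount_eq]
    exact ⟨h3, h4⟩
  · intro n hn U L h G H hG hH hk
    rw [h.upper_iff] at hG
    rw [h.lower_iff] at hH
    refine ⟨?_, hG.isHamiltonianPath_joinGraph hH (by omega) hk⟩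
    rw [NCPath.joinGraph_eq]
    exact h.nonCrossing_of_nc hn hG.nc hH.nc (hG.pairwise_alternatingEdges hH hk)
  · intro n hn U L h
    obtain ⟨U', L', h', hU, hL⟩ := h.exists_enlarged hn
    refine ⟨U', L', NCPath.upperEmb n, NCPath.lowerEmb n, h', NCPath.strictMono_upperEmb n,
      NCPath.strictMono_lowerEmb n, hU, hL, fun G H hG hH hk => ?_⟩
    rw [h.upper_iff] at hG
    rw [h.lower_iff] at hH
    exact ⟨NCPath.polygon G H, hG.isPolygonization hH (by omega) hk h',
      fun x y hxy => hG.polygon_adj hH (by omega) hk hxy⟩
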